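/- Let $K$ be a field of characteristic different from two and let $t,s\in K$. Set $\gamma_1=2s^2-1$, $\gamma_2=t-s$, $\gamma_3=2ts-1$, $\gamma_4=2t^2-1$, and let $X=\mathscr X_{t,s}\subset\mathbb P^5$ be the subscheme defined over $K$ by \[ x_1^2-2t^2x_2^2+\gamma_4x_3^2=2\gamma_4x_0^2,\qquad t^2s\,x_2^2-ts\gamma_2x_3^2-ts^2x_4^2=-\gamma_2x_0^2,\qquad \gamma_1x_3^2-2s^2x_4^2+x_5^2=2\gamma_1x_0^2 . \] Assume that $X$ is a smooth surface. Then the following hold. (1) No quadric of rank three contains $X$. (2) The quadrics of rank four (defined over $K$) containing $X$ are exactly the following 15 quadrics, which are pairwise distinct: \begin{align*} &\gamma_1(x_1^2-2t^2x_2^2)+\gamma_4(2s^2x_4^2-x_5^2)=0,\\ &sx_1^2+\gamma_2x_3^2-tx_5^2-4ts\gamma_2x_0^2=0,\\ &t(tsx_2^2-s\gamma_2x_3^2-s^2x_4^2)+\gamma_2x_0^2=0,\\ &x_1^2-2t^2x_2^2+\gamma_4(x_3^2-2x_0^2)=0,\\ &ts(\gamma_2x_1^2+t\gamma_3x_2^2-s\gamma_4x_4^2)-\gamma_2\gamma_3\gamma_4x_0^2=0,\\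 &s\gamma_3x_1^2+4t^3s\gamma_2x_2^2-\gamma_2\gamma_3\gamma_4x_3^2-t\gamma_4x_5^2=0,\\ &\gamma_1x_3^2-2s^2x_4^2+x_5^2-2\gamma_1x_0^2=0,\\ &ts(t\gamma_1x_2^2-s\gamma_3x_4^2+\gamma_2x_5^2)-\gamma_1\gamma_2\gamma_3x_0^2=0,\\ &s\gamma_1x_1^2-\gamma_1\gamma_2\gamma_3x_3^2+4ts^3\gamma_2x_4^2-t\gamma_3x_5^2=0,\\ &s(x_1^2+\gamma_3x_3^2-2tsx_4^2)-2t\gamma_3x_0^2=0,\\ &t(\gamma_3x_1^2+2t\gamma_2x_2^2-\gamma_4x_5^2)-2\gamma_2\gamma_3\gamma_4x_0^2=0,\\ &\gamma_2x_1^2+2t^3\gamma_3x_2^2-\gamma_2\gamma_3\gamma_4x_3^2-2ts^2\gamma_4x_4^2=0,\\ &t(2tsx_2^2-\gamma_3x_3^2-x_5^2)+2s\gamma_3x_0^2=0,\\ &s(\gamma_1x_1^2+2s\gamma_2x_4^2-\gamma_3x_5^2)-2\gamma_1\gamma_2\gamma_3x_0^2=0,\\ &2st^2\gamma_1x_2^2-\gamma_1\gamma_2\gamma_3x_3^2-2s^3\gamma_3x_4^2+\gamma_2x_5^2=0.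 \end{align*} (3) Every quadric $Q$ of rank four containing $X$ determines exactly two elliptic fibrations on $X$ defined by pencils of hyperplane sections: writing an equation of $Q$ as $ad-bc$ with linear forms $a,b,c,d$ over $K$, which is possible, each of the maps $X\to\mathbb P^1$ given by $[a:b]=[c:d]$ and by $[a:c]=[b:d]$ is an elliptic fibration, and all such decompositions together give, up to having the same fibres, exactly two fibrations. The 15 quadrics together give exactly 30 elliptic fibrations, two fibrations being identified when they have the same fibres. Here an elliptic fibration on $X$ is a surjective morphism $X\to\mathbb P^1$ whose geometric fibres are all connected and all but finitely many of whose geometric fibres are smooth curves of genus one. -/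

import Mathlib

open scoped LinearAlgebra.Projectivization

noncomputable section

namespace KummerKlein

open MvPolynomial

/-! ## Projective varieties through their geometric points

`k` is an algebraically closed extension of the base field `K`; varieties are given by their
`k`-points, and polynomials may have coefficients in `K` or in `k`. -/

/-- The value of a polynomial on the chosen representative of a point of projective space. It is
only used where the choice of the representative does not matter. -/
def evalAt {R k : Type*} {n : ℕ} [CommRing R] [Field k] [Algebra R k]
    (p : MvPolynomial (Fin n) R) (x : ℙ k (Fin n → k)) : k :=
  aeval x.rep p

/-- The set of `k`-points of the projective scheme cut out by the homogeneous polynomials `F i`. -/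
def zeroLocus {R : Type*} (k : Type*) {n : ℕ} {ι : Type*} [CommRing R] [Field k] [Algebra R k]
    (F : ι → MvPolynomial (Fin n) R) : Set (ℙ k (Fin n → k)) :=
  {x | ∀ i, evalAt (F i) x = 0}

/-- The Jacobian matrix of the polynomials `F i` at a point. -/
def jacobian {R k : Type*} {n : ℕ} {ι : Type*} [CommRing R] [Field k] [Algebra R k]
    (F : ι → MvPolynomial (Fin n) R) (x : ℙ k (Fin n → k)) : Matrix ι (Fin n) k :=
  Matrix.of fun i j => evalAt (pderiv j (F i)) x

/-- Jacobian criterion: the subscheme of `ℙ⁵` cut out by the three forms `F i` is a smooth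
surface, i.e. at each of its geometric points the Jacobian matrix has rank `3 = 5 - 2`. -/
def IsSmoothSurface {R : Type*} (k : Type*) [CommRing R] [Field k] [Algebra R k]
    (F : Fin 3 → MvPolynomial (Fin 6) R) : Prop :=
  ∀ x ∈ zeroLocus k F, (jacobian F x).rank = 3

/-- Zariski closed subsets of projective space. -/
def IsZariskiClosed {k : Type*} {n : ℕ} [Field k] (Z : Set (ℙ k (Fin n → k))) : Prop :=
  ∃ S : Set (MvPolynomial (Fin n) k), (∀ p ∈ S, ∃ d, p.IsHomogeneous d) ∧
    Z = {x | ∀ p ∈ S, evalAt p x = 0}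

/-- A set of points of projective space is connected in the Zariski topology (in particular it
is non-empty). -/
def IsZariskiConnected {k : Type*} {n : ℕ} [Field k] (C : Set (ℙ k (Fin n → k))) : Prop :=
  C.Nonempty ∧ ∀ Z₁ Z₂ : Set (ℙ k (Fin n → k)), IsZariskiClosed Z₁ → IsZariskiClosed Z₂ →
    C ⊆ Z₁ ∪ Z₂ → C ∩ Z₁ ∩ Z₂ = ∅ → C ⊆ Z₁ ∨ C ⊆ Z₂

/-- The forms of degree `m` that vanish on `C`: the degree `m` part of the homogeneous ideal
of `C`. -/
def vanishingForms {k : Type*} {n : ℕ} [Field k] (C : Set (ℙ k (Fin n → k))) (m : ℕ) :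
    Submodule k (homogeneousSubmodule (Fin n) k m) :=
  ⨅ x ∈ C, LinearMap.ker
    ((aeval (R := k) x.rep).toLinearMap.comp (homogeneousSubmodule (Fin n) k m).subtype)

/-- The Hilbert function of `C`: the dimension of the degree `m` part of its homogeneous
coordinate ring. -/
def hilbertFunction {k : Type*} {n : ℕ} [Field k] (C : Set (ℙ k (Fin n → k))) (m : ℕ) : ℕ :=
  Module.finrank k (homogeneousSubmodule (Fin n) k m ⧸ vanishingForms C m)

/-- `C` has Hilbert polynomial `d m + 1 - g` with `d > 0`: it has dimension one and arithmetic
genus `g`. For a smooth connected projective curve this `g` is its genus. -/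
def IsCurveOfGenus {k : Type*} {n : ℕ} [Field k] (C : Set (ℙ k (Fin n → k))) (g : ℤ) : Prop :=
  ∃ d : ℕ, 0 < d ∧ ∀ᶠ m : ℕ in Filter.atTop, (hilbertFunction C m : ℤ) = d * m + 1 - g

/-! ## Fibrations over the projective line -/

/-- `π y = [f y : g y]` at every point `y` of `X` where `f` and `g` do not both vanish (where they
both vanish, the equation below is no condition). -/
def IsGivenBy {R k : Type*} {n : ℕ} [CommRing R] [Field k] [Algebra R k]
    {X : Set (ℙ k (Fin n → k))} (π : X → ℙ k (Fin 2 → k)) (f g : MvPolynomial (Fin n) R) : Prop :=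
  ∀ y : X, (π y).rep 0 * evalAt g y.1 = (π y).rep 1 * evalAt f y.1

/-- `[f : g]` is a representation of `π` by forms of the same degree, valid near the point `x`. -/
def IsLocalRep {k : Type*} {n : ℕ} [Field k] {X : Set (ℙ k (Fin n → k))}
    (π : X → ℙ k (Fin 2 → k)) (x : X) (f g : MvPolynomial (Fin n) k) : Prop :=
  (∃ d, f.IsHomogeneous d ∧ g.IsHomogeneous d) ∧
    (evalAt f x.1 ≠ 0 ∨ evalAt g x.1 ≠ 0) ∧ IsGivenBy π f g

/-- `π : X → ℙ¹` is a morphism: near each point it is given by two forms of the same degree. -/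
def IsMorphism {k : Type*} {n : ℕ} [Field k] {X : Set (ℙ k (Fin n → k))}
    (π : X → ℙ k (Fin 2 → k)) : Prop :=
  ∀ x : X, ∃ f g, IsLocalRep π x f g

/-- The derivative of `f` at `x` in the direction `w`. -/
def dirDeriv {k : Type*} {n : ℕ} [Field k] (f : MvPolynomial (Fin n) k) (x : ℙ k (Fin n → k))
    (w : Fin n → k) : k :=
  ∑ j, evalAt (pderiv j f) x * w j

/-- The differential of `π` at `x` is non-zero on the tangent space of the scheme cut out by `F`
(the `w` below run over the tangent space of the affine cone, and `f dg - g df` is, up to a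
non-zero factor, the differential of `[f : g]`). -/
def IsSmoothAt {R k : Type*} {n : ℕ} {ι : Type*} [CommRing R] [Field k] [Algebra R k]
    (F : ι → MvPolynomial (Fin n) R) (π : zeroLocus k F → ℙ k (Fin 2 → k))
    (x : zeroLocus k F) : Prop :=
  ∃ f g, IsLocalRep π x f g ∧ ∃ w : Fin n → k, (jacobian F x.1).mulVec w = 0 ∧
    evalAt f x.1 * dirDeriv g x.1 w - evalAt g x.1 * dirDeriv f x.1 w ≠ 0

/-- The fibre of `π` over `p`, as a set of points of the ambient projective space. -/
def fibre {k : Type*} {n : ℕ} [Field k] {X : Set (ℙ k (Fin n → k))}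
    (π : X → ℙ k (Fin 2 → k)) (p : ℙ k (Fin 2 → k)) : Set (ℙ k (Fin n → k)) :=
  Subtype.val '' (π ⁻¹' {p})

/-- `π` is an elliptic fibration on the smooth surface cut out by `F`: a surjective morphism to
`ℙ¹` with connected fibres, all but finitely many of which are smooth (as schemes: `π` is smooth
along them) curves of genus one. -/
def IsEllipticFibration {R k : Type*} {n : ℕ} {ι : Type*} [CommRing R] [Field k] [Algebra R k]
    (F : ι → MvPolynomial (Fin n) R) (π : zeroLocus k F → ℙ k (Fin 2 → k)) : Prop :=
  IsMorphism π ∧ Function.Surjective π ∧ (∀ p, IsZariskiConnected (fibre π p)) ∧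
    {p | ¬ ((∀ x, π x = p → IsSmoothAt F π x) ∧ IsCurveOfGenus (fibre π p) 1)}.Finite

/-! ## Quadrics -/

/-- The rank of a quadratic form in characteristic different from two: the rank of the symmetric
matrix of its second partial derivatives (twice its Gram matrix). -/
def quadricRank {K : Type*} {n : ℕ} [Field K] (q : MvPolynomial (Fin n) K) : ℕ :=
  (Matrix.of fun i j : Fin n => constantCoeff (pderiv i (pderiv j q))).rank

/-- `q` is a quadratic form over `K` of rank `r` that vanishes on `X`. -/
def IsQuadricThrough {K k : Type*} {n : ℕ} [Field K] [Field k] [Algebra K k]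
    (X : Set (ℙ k (Fin n → k))) (r : ℕ) (q : MvPolynomial (Fin n) K) : Prop :=
  q.IsHomogeneous 2 ∧ quadricRank q = r ∧ ∀ x ∈ X, evalAt q x = 0

/-- The maps `X → ℙ¹` defined over `K` by a ruling of the quadric `q = 0`: for linear forms with
`q = a d - b c`, the map is given by the pencil of hyperplane sections `[a : b]`, and by
`[c : d]`, which is equal to it on `X`. When `q` has rank four, this is the projection from the
vertex of the quadric onto a smooth quadric `ad = bc` in `ℙ³`, isomorphic to `ℙ¹ × ℙ¹`,
followed by one of the two projections to `ℙ¹` (exchanging `b` and `c` gives the other one). -/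
def rulingMaps {K k : Type*} {n : ℕ} [Field K] [Field k] [Algebra K k]
    (X : Set (ℙ k (Fin n → k))) (q : MvPolynomial (Fin n) K) : Set (X → ℙ k (Fin 2 → k)) :=
  {π | ∃ a b c d : MvPolynomial (Fin n) K,
    a.IsHomogeneous 1 ∧ b.IsHomogeneous 1 ∧ c.IsHomogeneous 1 ∧ d.IsHomogeneous 1 ∧
      q = a * d - b * c ∧ IsGivenBy π a b ∧ IsGivenBy π c d}

/-- The fibrations in `S`, two of them being identified when they have the same fibres: each one
is recorded as the equivalence relation "lying on the same fibre". -/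
def fibrationClasses {k : Type*} {n : ℕ} [Field k] {X : Set (ℙ k (Fin n → k))}
    (S : Set (X → ℙ k (Fin 2 → k))) : Set (Setoid X) :=
  Setoid.ker '' S

/-! ## The family of Kummer surfaces -/

/-- The diagonal quadratic form `c₀ x₀² + ⋯ + c₅ x₅²`. -/
def diagForm {K : Type*} [Field K] (c : Fin 6 → K) : MvPolynomial (Fin 6) K :=
  ∑ i, C (c i) * X i ^ 2

def γ₁ {K : Type*} [Field K] (_t s : K) : K := 2 * s ^ 2 - 1
def γ₂ {K : Type*} [Field K] (t s : K) : K := t - s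
def γ₃ {K : Type*} [Field K] (t s : K) : K := 2 * t * s - 1
def γ₄ {K : Type*} [Field K] (t _s : K) : K := 2 * t ^ 2 - 1

/-- The three equations in `ℙ⁵` of the member of the family with parameters `t, s`. -/
def kummerEqs {K : Type*} [Field K] (t s : K) : Fin 3 → MvPolynomial (Fin 6) K :=
  ![diagForm ![-2 * γ₄ t s, 1, -2 * t ^ 2, γ₄ t s, 0, 0],
    diagForm ![γ₂ t s, 0, t ^ 2 * s, -t * s * γ₂ t s, -t * s ^ 2, 0],
    diagForm ![-2 * γ₁ t s, 0, 0, γ₁ t s, -2 * s ^ 2, 1]]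

/-- The fifteen quadrics, listed row by row. -/
def quadricTable {K : Type*} [Field K] (t s : K) : Fin 15 → MvPolynomial (Fin 6) K :=
  let g₁ := γ₁ t s
  let g₂ := γ₂ t s
  let g₃ := γ₃ t s
  let g₄ := γ₄ t s
  ![diagForm ![0, g₁, -2 * t ^ 2 * g₁, 0, 2 * s ^ 2 * g₄, -g₄],
    diagForm ![-4 * t * s * g₂, s, 0, g₂, 0, -t],
    diagForm ![g₂, 0, t ^ 2 * s, -t * s * g₂, -t * s ^ 2, 0],
    diagForm ![-2 * g₄, 1, -2 * t ^ 2, g₄, 0, 0],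
    diagForm ![-g₂ * g₃ * g₄, t * s * g₂, t ^ 2 * s * g₃, 0, -t * s ^ 2 * g₄, 0],
    diagForm ![0, s * g₃, 4 * t ^ 3 * s * g₂, -g₂ * g₃ * g₄, 0, -t * g₄],
    diagForm ![-2 * g₁, 0, 0, g₁, -2 * s ^ 2, 1],
    diagForm ![-g₁ * g₂ * g₃, 0, t ^ 2 * s * g₁, 0, -t * s ^ 2 * g₃, t * s * g₂],
    diagForm ![0, s * g₁, 0, -g₁ * g₂ * g₃, 4 * t * s ^ 3 * g₂, -t * g₃],
    diagForm ![-2 * t * g₃, s, 0, s * g₃, -2 * t * s ^ 2, 0],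
    diagForm ![-2 * g₂ * g₃ * g₄, t * g₃, 2 * t ^ 2 * g₂, 0, 0, -t * g₄],
    diagForm ![0, g₂, 2 * t ^ 3 * g₃, -g₂ * g₃ * g₄, -2 * t * s ^ 2 * g₄, 0],
    diagForm ![2 * s * g₃, 0, 2 * t ^ 2 * s, -t * g₃, 0, -t],
    diagForm ![-2 * g₁ * g₂ * g₃, s * g₁, 0, 0, 2 * s ^ 2 * g₂, -s * g₃],
    diagForm ![0, 0, 2 * s * t ^ 2 * g₁, -g₁ * g₂ * g₃, -2 * s ^ 3 * g₃, g₂]]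

/-- The `k`-points of the member of the family with parameters `t, s`. -/
def kummerSurface {K : Type*} (k : Type*) [Field K] [Field k] [Algebra K k] (t s : K) :
    Set (ℙ k (Fin 6 → k)) :=
  zeroLocus k (kummerEqs t s)

end KummerKlein

end

/-!
The surface is the base locus of a net of diagonal quadrics in `ℙ⁵`, and essentially two facts about
its equations are used: no `3 × 3` minor of the coefficient matrix vanishes, which follows from
smoothness (`isMDS_of_isSmoothSurface`), and the quadrics of rank four in the net split over the
ground field (`exists_split_table`).

*Quadrics.* The surface is invariant under the sign changes of the coordinates, so a quadric
containing it is diagonal, and then belongs to the net (`exists_eq_diagForm_comb`). Its rank is the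
number of its non-zero coefficients. As the minors do not vanish, at most two coefficients of a
non-zero member of the net are zero, and for each of the fifteen pairs of variables there is, up to
a factor, exactly one member in which they do not occur. These are the quadrics of the table.
They split because they have square discriminant and the rational zero `(0, 1, 1, 1, 1, 1)`.

*Fibrations.* Let `c` be the coefficients of such a quadric, and `m`, `n` the variables which do not
occur in it. The other two equations express `x_m²` and `x_n²` as quadratic forms in the other
variables. Hence the part of the surface over a line of the ruling is a curve `X² = f(w), Y² = g(w)`
for binary quadratic forms `f` and `g` (`Ruling.mem_cone_cover_iff`). Functions on it have the form
`A + B X + C Y + E X Y` with binary forms `A`, `B`, `C`, `E`, whose summands are separated by the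
sign changes of `X` and `Y`. This shows that the curve is always connected
(`DoubleCover.isZariskiConnected`), and that its Hilbert function is `4 m` if `f` and `g` are not
zero (`DoubleCover.isCurveOfGenus_one`). The squares of the coordinates of the points of the surface
form a three-dimensional linear space, and a point where the fibration is not smooth satisfies two
further linear conditions on these squares, independent of each other by a Vandermonde argument. So
there are finitely many such points (`Ruling.isDegenerate_of_differential_eq_zero`,
`Ruling.finite_tangency`).

*Counting.* Two points of the surface lie on a common fibre of one of the two rulings if and only
if they are orthogonal for the quadric, and on a common fibre of both if and only if they have the
same projection from its vertex. Both relations depend only on the quadric, and they determine the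
two fibrations up to order, even as equivalence relations on a set (`setoid_eq_or_eq`). So all
decompositions of the quadric give the same two fibrations (`Ruling.Gives.ker_eq_or`). Finally, the
sign change of a variable preserves the fibres if and only if the variable does not occur in the
quadric (`Ruling.Gives.flip_iff`), so that fibrations from different quadrics are different.
-/

noncomputable section

namespace KummerKlein

open MvPolynomial

/-! ### Forms and points of projective space -/

section Basic

variable {R k : Type*} {n : ℕ} [CommRing R] [Field k] [Algebra R k]

lemma aeval_smul_of_isHomogeneous {p : MvPolynomial (Fin n) R} {d : ℕ} (hp : p.IsHomogeneous d)
    (c : k) (v : Fin n → k) : aeval (c • v) p = c ^ d * aeval v p := by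
  simp only [aeval_def, eval₂_eq', Finset.mul_sum]
  refine Finset.sum_congr rfl fun m hm => ?_
  have hdeg := hp.degree_eq_sum_deg_support hm
  have : d = ∑ i, m i := by
    rw [hdeg]
    exact Finset.sum_subset (Finset.subset_univ _) (by simp)
  rw [this, ← Finset.prod_pow_eq_pow_sum]
  simp only [Pi.smul_apply, smul_eq_mul, mul_pow, Finset.prod_mul_distrib]
  ring

/-- A homogeneous polynomial vanishes at a point if and only if it vanishes at some, equivalently
any, representative of the point. -/
lemma evalAt_mk_eq_zero {p : MvPolynomial (Fin n) R} {d : ℕ} (hp : p.IsHomogeneous d)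
    (v : Fin n → k) (hv : v ≠ 0) :
    evalAt p (Projectivization.mk k v hv) = 0 ↔ aeval v p = 0 := by
  obtain ⟨c, hc⟩ := Projectivization.exists_smul_eq_mk_rep k v hv
  rw [evalAt, ← hc, Units.smul_def, aeval_smul_of_isHomogeneous hp]
  simp

/-- The linear form with the given coefficients. -/
def linForm {K : Type*} [CommRing K] (l : Fin n → K) : MvPolynomial (Fin n) K :=
  ∑ j, C (l j) * X j

lemma linForm_isHomogeneous (l : Fin n → R) : (linForm l).IsHomogeneous 1 :=
  IsHomogeneous.sum _ _ _ fun j _ => isHomogeneous_C_mul_X _ j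

lemma aeval_linForm (l : Fin n → R) (v : Fin n → k) :
    aeval v (linForm l) = ∑ j, algebraMap R k (l j) * v j := by
  simp [linForm]

lemma evalAt_linForm (l : Fin n → R) (x : ℙ k (Fin n → k)) :
    evalAt (linForm l) x = ∑ j, algebraMap R k (l j) * x.rep j :=
  aeval_linForm l _

lemma exists_eq_linForm {p : MvPolynomial (Fin n) R} (hp : p.IsHomogeneous 1) :
    ∃ l : Fin n → R, p = linForm l := by
  have h := (mem_homogeneousSubmodule 1 p).2 hp
  rw [homogeneousSubmodule_one_eq_span_X] at h
  obtain ⟨l, hl⟩ := (Submodule.mem_span_range_iff_exists_fun R).1 h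
  exact ⟨l, by simp [linForm, ← hl, smul_eq_C_mul]⟩

lemma pderiv_linForm (l : Fin n → R) (i : Fin n) : pderiv i (linForm l) = C (l i) := by
  simp only [linForm, map_sum, pderiv_C_mul, pderiv_X]
  rw [Finset.sum_eq_single i]
  · simp
  · intro j _ hj
    simp [hj.symm]
  · simp

end Basic

section Diag

variable {K k : Type*} [Field K] [Field k] [Algebra K k]

lemma diagForm_isHomogeneous (c : Fin 6 → K) : (diagForm c).IsHomogeneous 2 :=
  IsHomogeneous.sum _ _ _ fun j _ => isHomogeneous_C_mul_X_pow _ j 2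

lemma aeval_diagForm (c : Fin 6 → K) (v : Fin 6 → k) :
    aeval v (diagForm c) = ∑ j, algebraMap K k (c j) * v j ^ 2 := by
  simp [diagForm]

lemma pderiv_diagForm (c : Fin 6 → K) (i : Fin 6) :
    pderiv i (diagForm c) = C (2 * c i) * X i := by
  simp only [diagForm, map_sum, pderiv_C_mul, pderiv_pow, pderiv_X]
  rw [Finset.sum_eq_single i]
  · simp only [map_mul, map_ofNat, Pi.single_eq_same]
    ring
  · intro j _ hj
    simp [hj.symm]
  · simp

lemma jacobian_diagForm {ι : Type*} (M : ι → Fin 6 → K) (x : ℙ k (Fin 6 → k)) (r : ι)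
    (j : Fin 6) :
    jacobian (fun r => diagForm (M r)) x r j = 2 * algebraMap K k (M r j) * x.rep j := by
  simp [jacobian, pderiv_diagForm, evalAt, map_ofNat]

lemma mk_mem_zeroLocus_diagForm {ι : Type*} (M : ι → Fin 6 → K) (v : Fin 6 → k) (hv : v ≠ 0) :
    Projectivization.mk k v hv ∈ zeroLocus k (fun r => diagForm (M r)) ↔
      ∀ r, ∑ j, algebraMap K k (M r j) * v j ^ 2 = 0 := by
  simp only [zeroLocus, Set.mem_ofPred_eq, evalAt_mk_eq_zero (diagForm_isHomogeneous _),
    aeval_diagForm]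

lemma mem_zeroLocus_diagForm {ι : Type*} (M : ι → Fin 6 → K) (x : ℙ k (Fin 6 → k)) :
    x ∈ zeroLocus k (fun r => diagForm (M r)) ↔
      ∀ r, ∑ j, algebraMap K k (M r j) * x.rep j ^ 2 = 0 := by
  simp only [zeroLocus, Set.mem_ofPred_eq, evalAt, aeval_diagForm]

end Diag

/-! ### Binary forms -/

section BinaryForms

variable {k : Type*} [Field k]

lemma finrank_binaryForms (d : ℕ) :
    Module.finrank k (homogeneousSubmodule (Fin 2) k d) = d + 1 := by
  rw [homogeneousSubmodule_eq_finsupp_supported, (AddMonoidAlgebra.supportedEquivFinsupp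
    (R := k) (S := k) {x : Fin 2 →₀ ℕ | x.degree = d}).finrank_eq]
  let e : {x : Fin 2 →₀ ℕ | x.degree = d} ≃ Fin (d + 1) :=
    { toFun := fun x => ⟨x.1 0, by
        have := x.2
        simp only [Set.mem_ofPred_eq, Finsupp.degree_eq_sum, Fin.sum_univ_two] at this
        omega⟩
      invFun := fun i => ⟨Finsupp.equivFunOnFinite.symm ![i, d - i], by
        simp only [Set.mem_ofPred_eq, Finsupp.degree_eq_sum, Fin.sum_univ_two]
        simp
        omega⟩
      left_inv := fun x => by
        have := x.2
        simp only [Set.mem_ofPred_eq, Finsupp.degree_eq_sum, Fin.sum_univ_two] at this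
        ext i
        fin_cases i <;> simp
        omega
      right_inv := fun i => by ext; simp }
  have : Fintype {x : Fin 2 →₀ ℕ | x.degree = d} := Fintype.ofEquiv _ e.symm
  rw [Module.finrank_finsupp_self, Fintype.card_congr e, Fintype.card_fin]

lemma exists_dehomogenization (A : MvPolynomial (Fin 2) k) :
    ∃ P : Polynomial k, ∀ τ : k, P.eval τ = aeval ![τ, 1] A := by
  let P : Polynomial k := aeval ![Polynomial.X, 1] A
  refine ⟨P, fun τ => ?_⟩
  have h1 : P.eval τ = (Polynomial.aeval τ : Polynomial k →ₐ[k] k) P := by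
    rw [Polynomial.coe_aeval_eq_eval]
  rw [h1]
  change ((Polynomial.aeval τ).comp (aeval ![Polynomial.X, 1])) A = _
  congr 1
  ext i
  fin_cases i <;> simp

/-- A binary form that vanishes at infinitely many points `(τ, 1)` is zero. -/
lemma binaryForm_eq_zero [Infinite k] {A : MvPolynomial (Fin 2) k} {d : ℕ}
    (hA : A.IsHomogeneous d) {T : Set k} (hT : T.Infinite)
    (h : ∀ τ ∈ T, aeval ![τ, 1] A = (0 : k)) : A = 0 := by
  obtain ⟨P, hP⟩ := exists_dehomogenization A
  have hP0 : P = 0 := Polynomial.eq_zero_of_infinite_isRoot P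
    (hT.mono fun τ hτ => by simpa [Polynomial.IsRoot, hP] using h τ hτ)
  have hall : ∀ τ : k, aeval ![τ, 1] A = (0 : k) := fun τ => by rw [← hP, hP0]; simp
  have hXA : (X 1 * A).IsHomogeneous (1 + d) := (isHomogeneous_X k (1 : Fin 2)).mul hA
  have hX0 : X 1 * A = 0 := by
    refine hXA.eq_zero_of_forall_eval_eq_zero fun r => ?_
    rw [map_mul, eval_X]
    by_cases hr : r 1 = 0
    · simp [hr]
    have : r = r 1 • ![r 0 / r 1, 1] := by
      ext i
      fin_cases i <;> simp
      field_simp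
    have h2 : eval r A = aeval r A := by simp [aeval_eq_eval]
    rw [h2, this, aeval_smul_of_isHomogeneous hA, hall]
    simp
  exact (mul_eq_zero.1 hX0).resolve_left (X_ne_zero 1)

/-- A binary form of degree two over an algebraically closed field has a non-trivial zero. -/
lemma exists_zero_of_binaryForm [IsAlgClosed k] {f : MvPolynomial (Fin 2) k}
    (hf : f.IsHomogeneous 2) : ∃ w : Fin 2 → k, w ≠ 0 ∧ aeval w f = (0 : k) := by
  by_cases h1 : aeval ![1, 0] f = (0 : k)
  · exact ⟨_, fun h => one_ne_zero (congrFun h 0), h1⟩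
  obtain ⟨P, hP⟩ := exists_dehomogenization f
  have hdeg : P.degree ≠ 0 := by
    intro h0
    -- otherwise `f` is a multiple of the square of the second variable
    obtain ⟨c, rfl⟩ : ∃ c, P = Polynomial.C c := ⟨_, Polynomial.eq_C_of_degree_eq_zero h0⟩
    have hz : f - C c * X 1 ^ 2 = 0 :=
      binaryForm_eq_zero (hf.sub (isHomogeneous_C_mul_X_pow c 1 2)) Set.infinite_univ
        fun τ _ => by rw [map_sub, ← hP]; simp
    apply h1
    rw [sub_eq_zero.1 hz]
    simp
  obtain ⟨τ, hτ⟩ := IsAlgClosed.exists_root P hdeg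
  exact ⟨![τ, 1], fun h => one_ne_zero (congrFun h 1), by rw [← hP]; exact hτ⟩

end BinaryForms

/-! ### Double covers `X² = f(w), Y² = g(w)` of a line -/

/-- A line in projective space with linear coordinates on it, two further coordinates `i ≠ j`, and
two binary quadratic forms `f`, `g`. These data describe the curve `x_i² = f, x_j² = g` in the
space spanned by the line and the coordinate points `i` and `j`. -/
structure DoubleCover (k : Type*) [Field k] (n : ℕ) where
  /-- two vectors spanning the line -/
  φ : Fin 2 → Fin n → k
  /-- linear forms which restrict to the coordinates on the line -/
  ψ : Fin 2 → Fin n → k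
  i : Fin n
  j : Fin n
  f : MvPolynomial (Fin 2) k
  g : MvPolynomial (Fin 2) k
  ne : i ≠ j
  hf : f.IsHomogeneous 2
  hg : g.IsHomogeneous 2
  dual : ∀ a b, ∑ l, ψ a l * φ b l = if a = b then 1 else 0
  ψ_i : ∀ a, ψ a i = 0
  ψ_j : ∀ a, ψ a j = 0
  φ_i : ∀ a, φ a i = 0
  φ_j : ∀ a, φ a j = 0

namespace DoubleCover

variable {k : Type*} [Field k] {n : ℕ} (D : DoubleCover k n)

/-- The equations of the curve, in coordinates `w` on the line and `X`, `Y`. -/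
def OnCurve (w : Fin 2 → k) (X Y : k) : Prop :=
  X ^ 2 = aeval w D.f ∧ Y ^ 2 = aeval w D.g

/-- The vector with coordinates `w`, `X`, `Y`. -/
def point (w : Fin 2 → k) (X Y : k) : Fin n → k :=
  fun l => w 0 * D.φ 0 l + w 1 * D.φ 1 l + (if l = D.i then X else 0) + (if l = D.j then Y else 0)

/-- The affine cone over the curve. -/
def cone : Set (Fin n → k) :=
  {v | ∃ w X Y, D.OnCurve w X Y ∧ v = D.point w X Y}

/-- The same curve with `f` and `g` exchanged. -/
def swap : DoubleCover k n where
  φ := D.φ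
  ψ := D.ψ
  i := D.j
  j := D.i
  f := D.g
  g := D.f
  ne := D.ne.symm
  hf := D.hg
  hg := D.hf
  dual := D.dual
  ψ_i := D.ψ_j
  ψ_j := D.ψ_i
  φ_i := D.φ_j
  φ_j := D.φ_i

lemma swap_onCurve {w : Fin 2 → k} {X Y : k} : D.swap.OnCurve w X Y ↔ D.OnCurve w Y X :=
  and_comm

lemma swap_point (w : Fin 2 → k) (X Y : k) : D.swap.point w X Y = D.point w Y X := by
  funext l
  simp only [point, swap]
  exact add_right_comm _ _ _

lemma point_i (w : Fin 2 → k) (X Y : k) : D.point w X Y D.i = X := by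
  simp [point, D.φ_i, D.ne]

lemma point_j (w : Fin 2 → k) (X Y : k) : D.point w X Y D.j = Y := by
  simp [point, D.φ_j, D.ne.symm]

lemma sum_ψ_point (w : Fin 2 → k) (X Y : k) (a : Fin 2) :
    ∑ l, D.ψ a l * D.point w X Y l = w a := by
  have h0 := D.dual a 0
  have h1 := D.dual a 1
  have : ∀ l, D.ψ a l * D.point w X Y l
      = w 0 * (D.ψ a l * D.φ 0 l) + w 1 * (D.ψ a l * D.φ 1 l) := by
    intro l
    by_cases hi : l = D.i
    · subst hi
      simp [point, D.ψ_i]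
    by_cases hj : l = D.j
    · subst hj
      simp [point, D.ψ_j]
    simp only [point, hi, hj, if_false]
    ring
  simp only [this, Finset.sum_add_distrib, ← Finset.mul_sum, h0, h1]
  fin_cases a <;> simp

lemma point_ne_zero {w : Fin 2 → k} (hw : w ≠ 0) (X Y : k) : D.point w X Y ≠ 0 := by
  intro h
  apply hw
  funext a
  rw [← D.sum_ψ_point w X Y a, h]
  simp

lemma onCurve_neg_left {w : Fin 2 → k} {X Y : k} (h : D.OnCurve w X Y) : D.OnCurve w (-X) Y :=
  ⟨by rw [neg_sq, h.1], h.2⟩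

lemma onCurve_neg_right {w : Fin 2 → k} {X Y : k} (h : D.OnCurve w X Y) : D.OnCurve w X (-Y) :=
  ⟨h.1, by rw [neg_sq, h.2]⟩

lemma ne_zero_of_point_ne_zero {w : Fin 2 → k} {X Y : k} (h : D.OnCurve w X Y)
    (hp : D.point w X Y ≠ 0) : w ≠ 0 := by
  rintro rfl
  have h0 : (0 : Fin 2 → k) = (0 : k) • 0 := by simp
  have hX : X ^ 2 = 0 := by
    rw [h.1, h0, aeval_smul_of_isHomogeneous D.hf]; simp
  have hY : Y ^ 2 = 0 := by
    rw [h.2, h0, aeval_smul_of_isHomogeneous D.hg]; simp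
  apply hp
  funext l
  simp [point, pow_eq_zero_iff two_ne_zero |>.1 hX, pow_eq_zero_iff two_ne_zero |>.1 hY]

/-- On the curve, `p` of degree `d` coincides with `A + B X + C Y + E X Y` for binary forms
`A`, `B`, `C`, `E` of the appropriate degrees. -/
def HasNormalForm (d : ℕ) (p : MvPolynomial (Fin n) k) : Prop :=
  ∃ A B C E : MvPolynomial (Fin 2) k, A.IsHomogeneous d ∧ B.IsHomogeneous (d - 1) ∧
    C.IsHomogeneous (d - 1) ∧ E.IsHomogeneous (d - 2) ∧ (d < 1 → B = 0 ∧ C = 0) ∧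
    (d < 2 → E = 0) ∧ ∀ w X Y, D.OnCurve w X Y →
      aeval (D.point w X Y) p
        = aeval w A + X * aeval w B + Y * aeval w C + X * Y * aeval w E

lemma hasNormalForm_linear_mul {d : ℕ} {p : MvPolynomial (Fin n) k} (hp : D.HasNormalForm d p)
    (m : Fin n → k) : D.HasNormalForm (d + 1) (linForm m * p) := by
  obtain ⟨A, B, C', E, hA, hB, hC, hE, h1, h2, h⟩ := hp
  let a : Fin 2 → k := fun b => ∑ l, m l * D.φ b l
  have hlin : (linForm a).IsHomogeneous 1 := linForm_isHomogeneous a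
  have hC0 : ∀ r : k, (C r : MvPolynomial (Fin 2) k).IsHomogeneous 0 := isHomogeneous_C (Fin 2)
  refine ⟨linForm a * A + C (m D.i) * D.f * B + C (m D.j) * D.g * C',
    linForm a * B + C (m D.i) * A + C (m D.j) * D.g * E,
    linForm a * C' + C (m D.j) * A + C (m D.i) * D.f * E,
    linForm a * E + C (m D.i) * C' + C (m D.j) * B, ?_, ?_, ?_, ?_, ?_, ?_, ?_⟩
  · have hfB : (C (m D.i) * D.f * B).IsHomogeneous (d + 1) := by
      rcases d with _ | d
      · simp [(h1 (by omega)).1, isHomogeneous_zero]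
      · convert (D.hf.C_mul (m D.i)).mul hB using 1
        omega
    have hgC : (C (m D.j) * D.g * C').IsHomogeneous (d + 1) := by
      rcases d with _ | d
      · simp [(h1 (by omega)).2, isHomogeneous_zero]
      · convert (D.hg.C_mul (m D.j)).mul hC using 1
        omega
    have hlA : (linForm a * A).IsHomogeneous (d + 1) := by
      rw [add_comm]; exact hlin.mul hA
    exact (hlA.add hfB).add hgC
  · have h3 : (linForm a * B).IsHomogeneous d := by
      rcases d with _ | d
      · simp [(h1 (by omega)).1, isHomogeneous_zero]
      · convert hlin.mul hB using 1
        omega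
    have h4 : (C (m D.j) * D.g * E).IsHomogeneous d := by
      rcases d with _ | _ | d
      · simp [h2 (by omega), isHomogeneous_zero]
      · simp [h2 (by omega), isHomogeneous_zero]
      · convert (D.hg.C_mul (m D.j)).mul hE using 1
        omega
    exact (h3.add (hA.C_mul _)).add h4
  · have h3 : (linForm a * C').IsHomogeneous d := by
      rcases d with _ | d
      · simp [(h1 (by omega)).2, isHomogeneous_zero]
      · convert hlin.mul hC using 1
        omega
    have h4 : (C (m D.i) * D.f * E).IsHomogeneous d := by
      rcases d with _ | _ | d
      · simp [h2 (by omega), isHomogeneous_zero]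
      · simp [h2 (by omega), isHomogeneous_zero]
      · convert (D.hf.C_mul (m D.i)).mul hE using 1
        omega
    exact (h3.add (hA.C_mul _)).add h4
  · have h3 : (linForm a * E).IsHomogeneous (d - 1) := by
      rcases d with _ | _ | d
      · simp [h2 (by omega), isHomogeneous_zero]
      · simp [h2 (by omega), isHomogeneous_zero]
      · convert hlin.mul hE using 1
        omega
    exact (h3.add (hC.C_mul _)).add (hB.C_mul _)
  · intro hd
    omega
  · intro hd
    have hd0 : d < 1 := by omega
    simp [h1 hd0, h2 (by omega : d < 2)]
  · intro w X Y hw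
    have hm : aeval (D.point w X Y) (linForm m)
        = aeval w (linForm a) + m D.i * X + m D.j * Y := by
      simp only [aeval_linForm, a, Algebra.algebraMap_self, RingHom.id_apply, Fin.sum_univ_two,
        Finset.sum_mul]
      have : ∀ l, m l * D.point w X Y l = m l * D.φ 0 l * w 0 + m l * D.φ 1 l * w 1
          + (if l = D.i then m l * X else 0) + (if l = D.j then m l * Y else 0) := by
        intro l
        simp only [point]
        split_ifs <;> ring
      simp only [this, Finset.sum_add_distrib, Finset.sum_ite_eq', Finset.mem_univ, if_true]
    rw [map_mul, hm, h w X Y hw]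
    simp only [map_add, map_mul, aeval_C, Algebra.algebraMap_self, RingHom.id_apply, ← hw.1,
      ← hw.2]
    ring

lemma hasNormalForm {d : ℕ} {p : MvPolynomial (Fin n) k} (hp : p.IsHomogeneous d) :
    D.HasNormalForm d p := by
  have hp' : p ∈ homogeneousSubmodule (Fin n) k 1 ^ d := by
    rw [homogeneousSubmodule_one_pow]; exact hp
  refine Submodule.pow_induction_on_left' (C := fun d p _ => D.HasNormalForm d p) _ ?_ ?_ ?_ hp'
  · intro r
    refine ⟨C r, 0, 0, 0, isHomogeneous_C _ r, isHomogeneous_zero _ _ _, isHomogeneous_zero _ _ _,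
      isHomogeneous_zero _ _ _, fun _ => ⟨rfl, rfl⟩, fun _ => rfl, fun w X Y _ => ?_⟩
    simp [algebraMap_eq]
  · rintro x y i - - ⟨A, B, C, E, hA, hB, hC, hE, h1, h2, h⟩
      ⟨A', B', C', E', hA', hB', hC', hE', h1', h2', h'⟩
    refine ⟨A + A', B + B', C + C', E + E', hA.add hA', hB.add hB', hC.add hC', hE.add hE',
      fun hi => by simp [h1 hi, h1' hi], fun hi => by simp [h2 hi, h2' hi], fun w X Y hw => ?_⟩
    rw [map_add, h w X Y hw, h' w X Y hw]
    simp only [map_add]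
    ring
  · intro m hm i x _ hx
    obtain ⟨l, rfl⟩ := exists_eq_linForm (p := m) hm
    exact D.hasNormalForm_linear_mul hx l

/-- The coefficients of the normal form are determined, at a point, by the values at the
points in the orbit of this point under the sign changes of `X` and `Y`. -/
lemma normalForm_eq_zero (h2 : (2 : k) ≠ 0) {a b c e X Y : k}
    (h1 : a + X * b + Y * c + X * Y * e = 0) (h3 : a + -X * b + Y * c + -X * Y * e = 0)
    (h4 : a + X * b + -Y * c + X * -Y * e = 0) (h5 : a + -X * b + -Y * c + -X * -Y * e = 0) :
    a = 0 ∧ X * b = 0 ∧ Y * c = 0 ∧ X * Y * e = 0 := by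
  have h4' : (2 * 2 : k) ≠ 0 := mul_ne_zero h2 h2
  refine ⟨?_, ?_, ?_, ?_⟩ <;> apply mul_left_cancel₀ h4'
  · linear_combination h1 + h3 + h4 + h5
  · linear_combination h1 - h3 + h4 - h5
  · linear_combination h1 + h3 - h4 - h5
  · linear_combination h1 - h3 - h4 + h5

end DoubleCover

/-! ### Connectedness of double covers -/

/-- Zariski closed cones in affine space. -/
def IsClosedCone {k : Type*} {n : ℕ} [Field k] (V : Set (Fin n → k)) : Prop :=
  ∃ S : Set (MvPolynomial (Fin n) k), (∀ p ∈ S, ∃ d, p.IsHomogeneous d) ∧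
    V = {v | ∀ p ∈ S, aeval v p = (0 : k)}

section ClosedCone

variable {k : Type*} {n : ℕ} [Field k]

lemma IsClosedCone.inter {V W : Set (Fin n → k)} (hV : IsClosedCone V) (hW : IsClosedCone W) :
    IsClosedCone (V ∩ W) := by
  obtain ⟨S, hS, rfl⟩ := hV
  obtain ⟨T, hT, rfl⟩ := hW
  refine ⟨S ∪ T, fun p hp => hp.elim (hS p) (hT p), ?_⟩
  ext v
  simp only [Set.mem_inter_iff, Set.mem_ofPred_eq, Set.mem_union, or_imp, forall_and]

lemma IsClosedCone.union {V W : Set (Fin n → k)} (hV : IsClosedCone V) (hW : IsClosedCone W) :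
    IsClosedCone (V ∪ W) := by
  obtain ⟨S, hS, rfl⟩ := hV
  obtain ⟨T, hT, rfl⟩ := hW
  refine ⟨Set.image2 (· * ·) S T, ?_, ?_⟩
  · rintro _ ⟨p, hp, q, hq, rfl⟩
    obtain ⟨d, hd⟩ := hS p hp
    obtain ⟨e, he⟩ := hT q hq
    exact ⟨d + e, hd.mul he⟩
  · ext v
    simp only [Set.mem_union, Set.mem_ofPred_eq, Set.forall_mem_image2, map_mul, mul_eq_zero]
    constructor
    · rintro (h | h) p hp q hq
      · exact Or.inl (h p hp)
      · exact Or.inr (h q hq)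
    · intro h
      by_contra! hc
      obtain ⟨⟨p, hp, hp0⟩, ⟨q, hq, hq0⟩⟩ := hc
      exact (h p hp q hq).elim hp0 hq0

/-- Change of the sign of the coordinate `i`. -/
def flip (i : Fin n) (v : Fin n → k) : Fin n → k := fun l => if l = i then -v l else v l

lemma IsClosedCone.flip {V : Set (Fin n → k)} (hV : IsClosedCone V) (i : Fin n) :
    IsClosedCone (KummerKlein.flip i ⁻¹' V) := by
  obtain ⟨S, hS, rfl⟩ := hV
  let θ : MvPolynomial (Fin n) k →ₐ[k] MvPolynomial (Fin n) k :=
    aeval fun l => if l = i then C (-1) * X l else X l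
  have hθ : ∀ (v : Fin n → k) p, aeval v (θ p) = aeval (KummerKlein.flip i v) p := by
    intro v p
    change ((aeval v).comp θ) p = _
    congr 1
    ext l
    simp only [AlgHom.comp_apply, θ, aeval_X, KummerKlein.flip]
    split_ifs <;> simp
  refine ⟨θ '' S, ?_, ?_⟩
  · rintro _ ⟨p, hp, rfl⟩
    obtain ⟨d, hd⟩ := hS p hp
    refine ⟨1 * d, hd.aeval _ fun l => ?_⟩
    split_ifs
    · exact isHomogeneous_C_mul_X _ _
    · exact isHomogeneous_X _ _
  · ext v
    simp only [Set.mem_preimage, Set.mem_ofPred_eq, Set.forall_mem_image, hθ]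

/-- The cone over a Zariski closed set. -/
lemma exists_isClosedCone {Z : Set (ℙ k (Fin n → k))} (hZ : IsZariskiClosed Z) :
    ∃ V, IsClosedCone V ∧ ∀ v (hv : v ≠ 0), Projectivization.mk k v hv ∈ Z ↔ v ∈ V := by
  obtain ⟨S, hS, rfl⟩ := hZ
  refine ⟨_, ⟨S, hS, rfl⟩, fun v hv => ?_⟩
  simp only [Set.mem_ofPred_eq]
  refine forall₂_congr fun p hp => ?_
  obtain ⟨d, hd⟩ := hS p hp
  exact evalAt_mk_eq_zero hd v hv

end ClosedCone

namespace DoubleCover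

variable {k : Type*} [Field k] {n : ℕ} (D : DoubleCover k n)

lemma flip_point_i (w : Fin 2 → k) (X Y : k) :
    KummerKlein.flip D.i (D.point w X Y) = D.point w (-X) Y := by
  funext l
  by_cases h : l = D.i
  · subst h
    simp [KummerKlein.flip, point, D.φ_i, D.ne]
  · simp [KummerKlein.flip, point, h]

lemma flip_point_j (w : Fin 2 → k) (X Y : k) :
    KummerKlein.flip D.j (D.point w X Y) = D.point w X (-Y) := by
  funext l
  by_cases h : l = D.j
  · subst h
    simp [KummerKlein.flip, point, D.φ_j, D.ne.symm]
  · simp [KummerKlein.flip, point, h]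

lemma onCurve_unique {w : Fin 2 → k} {X Y X' Y' : k} (h : D.OnCurve w X Y)
    (h' : D.OnCurve w X' Y') : (X' = X ∨ X' = -X) ∧ (Y' = Y ∨ Y' = -Y) :=
  ⟨sq_eq_sq_iff_eq_or_eq_neg.1 (h'.1.trans h.1.symm),
    sq_eq_sq_iff_eq_or_eq_neg.1 (h'.2.trans h.2.symm)⟩

lemma swap_cover {P : (Fin n → k) → Prop}
    (h : ∀ w X Y, w ≠ 0 → D.OnCurve w X Y → P (D.point w X Y)) :
    ∀ w X Y, w ≠ 0 → D.swap.OnCurve w X Y → P (D.swap.point w X Y) := by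
  intro w X Y hw0 hw
  rw [swap_point]
  exact h w Y X hw0 (D.swap_onCurve.1 hw)

variable [IsAlgClosed k]

lemma exists_onCurve (w : Fin 2 → k) : ∃ X Y, D.OnCurve w X Y := by
  obtain ⟨X, hX⟩ := IsAlgClosed.exists_pow_nat_eq (aeval w D.f : k) two_pos
  obtain ⟨Y, hY⟩ := IsAlgClosed.exists_pow_nat_eq (aeval w D.g : k) two_pos
  exact ⟨X, Y, hX, hY⟩

/-- A normal form which vanishes at all points of the curve over infinitely many points `(τ, 1)`
of the line is zero, up to coefficients that do not matter when `f` or `g` is zero. -/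
lemma normalForm_eq_zero_of_infinite (h2 : (2 : k) ≠ 0) {T : Set k}
    (hT : T.Infinite) {A B C E : MvPolynomial (Fin 2) k} {a b c e : ℕ} (hA : A.IsHomogeneous a)
    (hB : B.IsHomogeneous b) (hC : C.IsHomogeneous c) (hE : E.IsHomogeneous e)
    (h : ∀ τ ∈ T, ∀ X Y, D.OnCurve ![τ, 1] X Y → aeval ![τ, 1] A + X * aeval ![τ, 1] B
      + Y * aeval ![τ, 1] C + X * Y * aeval ![τ, 1] E = (0 : k)) :
    A = 0 ∧ D.f * B = 0 ∧ D.g * C = 0 ∧ D.f * D.g * E = 0 := by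
  have := IsAlgClosed.instInfinite (K := k)
  have key : ∀ τ ∈ T, aeval ![τ, 1] A = (0 : k) ∧ aeval ![τ, 1] (D.f * B) = (0 : k) ∧
      aeval ![τ, 1] (D.g * C) = (0 : k) ∧ aeval ![τ, 1] (D.f * D.g * E) = (0 : k) := by
    intro τ hτ
    obtain ⟨X, Y, ho⟩ := D.exists_onCurve ![τ, 1]
    obtain ⟨e1, e2, e3, e4⟩ := normalForm_eq_zero h2 (h τ hτ _ _ ho)
      (h τ hτ _ _ (D.onCurve_neg_left ho)) (h τ hτ _ _ (D.onCurve_neg_right ho))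
      (h τ hτ _ _ (D.onCurve_neg_left (D.onCurve_neg_right ho)))
    refine ⟨e1, ?_, ?_, ?_⟩
    · rw [map_mul, ← ho.1]
      linear_combination X * e2
    · rw [map_mul, ← ho.2]
      linear_combination Y * e3
    · rw [map_mul, map_mul, ← ho.1, ← ho.2]
      linear_combination X * Y * e4
  exact ⟨binaryForm_eq_zero hA hT fun τ hτ => (key τ hτ).1,
    binaryForm_eq_zero (D.hf.mul hB) hT fun τ hτ => (key τ hτ).2.1,
    binaryForm_eq_zero (D.hg.mul hC) hT fun τ hτ => (key τ hτ).2.2.1,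
    binaryForm_eq_zero ((D.hf.mul D.hg).mul hE) hT fun τ hτ => (key τ hτ).2.2.2⟩

/-- A closed cone that contains all points of the curve over infinitely many points of the line
contains the whole curve. -/
lemma point_mem_of_infinite (h2 : (2 : k) ≠ 0) {V : Set (Fin n → k)} (hV : IsClosedCone V)
    {T : Set k} (hT : T.Infinite)
    (h : ∀ τ ∈ T, ∀ X Y, D.OnCurve ![τ, 1] X Y → D.point ![τ, 1] X Y ∈ V)
    {w : Fin 2 → k} {X Y : k} (hw : D.OnCurve w X Y) : D.point w X Y ∈ V := by
  obtain ⟨S, hS, rfl⟩ := hV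
  intro p hp
  obtain ⟨d, hd⟩ := hS p hp
  obtain ⟨A, B, C, E, hA', hB', hC', hE', -, -, hn⟩ := D.hasNormalForm hd
  obtain ⟨hA, hB, hC, hE⟩ := D.normalForm_eq_zero_of_infinite h2 hT hA' hB' hC' hE'
    fun τ hτ X Y hXY => (hn _ X Y hXY).symm.trans (h τ hτ X Y hXY p hp)
  have z1 : X * aeval w B = 0 := by
    have := congrArg (aeval w) hB
    rw [map_mul, ← hw.1, map_zero] at this
    refine pow_eq_zero_iff two_ne_zero |>.1 ?_
    linear_combination aeval w B * this
  have z2 : Y * aeval w C = 0 := by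
    have := congrArg (aeval w) hC
    rw [map_mul, ← hw.2, map_zero] at this
    refine pow_eq_zero_iff two_ne_zero |>.1 ?_
    linear_combination aeval w C * this
  have z3 : X * Y * aeval w E = 0 := by
    have := congrArg (aeval w) hE
    rw [map_mul, map_mul, ← hw.1, ← hw.2, map_zero] at this
    refine pow_eq_zero_iff two_ne_zero |>.1 ?_
    linear_combination aeval w E * this
  rw [hn w X Y hw, z1, z2, z3, hA]
  simp

/-- If each orbit of points of the curve under the sign changes is contained in one of two closed
cones, then so is the whole curve. -/
lemma mem_or_mem_of_orbits (h2 : (2 : k) ≠ 0) {V₁ V₂ : Set (Fin n → k)} (hV₁ : IsClosedCone V₁)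
    (hV₂ : IsClosedCone V₂)
    (h : ∀ w, w ≠ 0 → (∀ X Y, D.OnCurve w X Y → D.point w X Y ∈ V₁) ∨
      ∀ X Y, D.OnCurve w X Y → D.point w X Y ∈ V₂) :
    (∀ w X Y, D.OnCurve w X Y → D.point w X Y ∈ V₁) ∨
      ∀ w X Y, D.OnCurve w X Y → D.point w X Y ∈ V₂ := by
  have := IsAlgClosed.instInfinite (K := k)
  have hU : ({τ : k | ∀ X Y, D.OnCurve ![τ, 1] X Y → D.point ![τ, 1] X Y ∈ V₁} ∪
      {τ : k | ∀ X Y, D.OnCurve ![τ, 1] X Y → D.point ![τ, 1] X Y ∈ V₂}) = Set.univ := by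
    ext τ
    simpa using h ![τ, 1] fun h => one_ne_zero (congrFun h 1)
  have hinf := Set.infinite_univ (α := k)
  rw [← hU, Set.infinite_union] at hinf
  rcases hinf with hinf | hinf
  · exact Or.inl fun w X Y hw => D.point_mem_of_infinite h2 hV₁ hinf (fun τ hτ => hτ) hw
  · exact Or.inr fun w X Y hw => D.point_mem_of_infinite h2 hV₂ hinf (fun τ hτ => hτ) hw

/-- If two disjoint closed cones cover the curve, the sign change of `X` preserves each of them:
otherwise the points which it moves from one to the other form, together with their images under
the sign changes, the whole curve, but it fixes the points with `X = 0`. -/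
lemma neg_mem_of_mem (h2 : (2 : k) ≠ 0) {V₁ V₂ : Set (Fin n → k)} (hV₁ : IsClosedCone V₁)
    (hV₂ : IsClosedCone V₂)
    (hcov : ∀ w X Y, w ≠ 0 → D.OnCurve w X Y → D.point w X Y ∈ V₁ ∨ D.point w X Y ∈ V₂)
    (hdis : ∀ w X Y, w ≠ 0 → D.OnCurve w X Y → ¬ (D.point w X Y ∈ V₁ ∧ D.point w X Y ∈ V₂))
    {w : Fin 2 → k} {X Y : k} (hw0 : w ≠ 0) (hw : D.OnCurve w X Y)
    (hmem : D.point w X Y ∈ V₂) : D.point w (-X) Y ∈ V₂ := by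
  set σ : (Fin n → k) → Fin n → k := KummerKlein.flip D.i with hσ
  set ρ : (Fin n → k) → Fin n → k := KummerKlein.flip D.j with hρ
  let A : Set (Fin n → k) := V₂ ∩ σ ⁻¹' V₁
  let B : Set (Fin n → k) := V₁ ∪ σ ⁻¹' V₂
  have hA : IsClosedCone A := hV₂.inter (hV₁.flip _)
  have hB : IsClosedCone B := hV₁.union (hV₂.flip _)
  let W₂ : Set (Fin n → k) := (A ∪ σ ⁻¹' A) ∪ ρ ⁻¹' (A ∪ σ ⁻¹' A)
  let W₁ : Set (Fin n → k) := (B ∩ σ ⁻¹' B) ∩ ρ ⁻¹' (B ∩ σ ⁻¹' B)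
  have hW₂ : IsClosedCone W₂ := (hA.union (hA.flip _)).union ((hA.union (hA.flip _)).flip _)
  have hW₁ : IsClosedCone W₁ := (hB.inter (hB.flip _)).inter ((hB.inter (hB.flip _)).flip _)
  have mA : ∀ w X Y, D.point w X Y ∈ A ↔ D.point w X Y ∈ V₂ ∧ D.point w (-X) Y ∈ V₁ := by
    intro w X Y
    simp only [A, Set.mem_inter_iff, Set.mem_preimage, hσ, flip_point_i]
  have mB : ∀ w X Y, D.point w X Y ∈ B ↔ D.point w X Y ∈ V₁ ∨ D.point w (-X) Y ∈ V₂ := by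
    intro w X Y
    simp only [B, Set.mem_union, Set.mem_preimage, hσ, flip_point_i]
  have mW₂ : ∀ w X Y, D.OnCurve w X Y → (D.point w X Y ∈ W₂ ↔
      ∃ X' Y', D.OnCurve w X' Y' ∧ D.point w X' Y' ∈ A) := by
    intro w X Y hw
    simp only [W₂, Set.mem_union, Set.mem_preimage, hσ, hρ, flip_point_i, flip_point_j]
    constructor
    · rintro ((h | h) | h | h)
      · exact ⟨_, _, hw, h⟩
      · exact ⟨_, _, D.onCurve_neg_left hw, h⟩
      · exact ⟨_, _, D.onCurve_neg_right hw, h⟩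
      · exact ⟨_, _, D.onCurve_neg_left (D.onCurve_neg_right hw), h⟩
    · rintro ⟨X', Y', hw', h⟩
      obtain ⟨rfl | rfl, rfl | rfl⟩ := D.onCurve_unique hw hw'
      · exact Or.inl (Or.inl h)
      · exact Or.inr (Or.inl h)
      · exact Or.inl (Or.inr h)
      · exact Or.inr (Or.inr h)
  have mW₁ : ∀ w X Y, D.OnCurve w X Y → (D.point w X Y ∈ W₁ ↔
      ∀ X' Y', D.OnCurve w X' Y' → D.point w X' Y' ∈ B) := by
    intro w X Y hw
    simp only [W₁, Set.mem_inter_iff, Set.mem_preimage, hσ, hρ, flip_point_i, flip_point_j]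
    constructor
    · rintro ⟨⟨h1, h3⟩, h4, h5⟩ X' Y' hw'
      obtain ⟨rfl | rfl, rfl | rfl⟩ := D.onCurve_unique hw hw'
      · exact h1
      · exact h4
      · exact h3
      · exact h5
    · intro h
      exact ⟨⟨h _ _ hw, h _ _ (D.onCurve_neg_left hw)⟩, h _ _ (D.onCurve_neg_right hw),
        h _ _ (D.onCurve_neg_left (D.onCurve_neg_right hw))⟩
  -- on the curve, a point which is not in `B` is in `A`, so that each orbit is in `W₁` or in `W₂`
  have hBA : ∀ w X Y, w ≠ 0 → D.OnCurve w X Y → D.point w X Y ∉ B → D.point w X Y ∈ A := by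
    intro w X Y hw0 hw h
    rw [mB, not_or] at h
    rw [mA]
    exact ⟨(hcov w X Y hw0 hw).resolve_left h.1,
      (hcov w (-X) Y hw0 (D.onCurve_neg_left hw)).resolve_right h.2⟩
  have horb : ∀ w, w ≠ 0 → (∀ X Y, D.OnCurve w X Y → D.point w X Y ∈ W₁) ∨
      ∀ X Y, D.OnCurve w X Y → D.point w X Y ∈ W₂ := by
    intro w hw0
    by_cases hall : ∀ X' Y', D.OnCurve w X' Y' → D.point w X' Y' ∈ B
    · exact Or.inl fun X Y hw => (mW₁ w X Y hw).2 hall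
    · push Not at hall
      obtain ⟨X', Y', hw', hn⟩ := hall
      exact Or.inr fun X Y hw => (mW₂ w X Y hw).2 ⟨X', Y', hw', hBA w X' Y' hw0 hw' hn⟩
  rcases D.mem_or_mem_of_orbits h2 hW₁ hW₂ horb with h | h
  · have h3 := (mB _ _ _).1 ((mW₁ w X Y hw).1 (h w X Y hw) X Y hw)
    exact h3.resolve_left fun h4 => hdis w X Y hw0 hw ⟨h4, hmem⟩
  · -- a point with `X = 0` would belong to both cones
    obtain ⟨w, hw0, hf⟩ := exists_zero_of_binaryForm D.hf
    obtain ⟨X, Y, hw⟩ := D.exists_onCurve w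
    obtain ⟨X', Y', hw', h1⟩ := (mW₂ w X Y hw).1 (h w X Y hw)
    have hX : X' = 0 := pow_eq_zero_iff two_ne_zero |>.1 (hw'.1.trans hf)
    subst hX
    rw [mA, neg_zero] at h1
    exact (hdis w 0 Y' hw0 hw' ⟨h1.2, h1.1⟩).elim

/-- The curve `X² = f(w), Y² = g(w)` is connected, for arbitrary binary quadratic forms. -/
theorem isZariskiConnected (h2 : (2 : k) ≠ 0) {Γ : Set (ℙ k (Fin n → k))}
    (hΓ : ∀ v (hv : v ≠ 0), Projectivization.mk k v hv ∈ Γ ↔ v ∈ D.cone) :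
    IsZariskiConnected Γ := by
  have hpt : ∀ w X Y, D.OnCurve w X Y → ∀ hw0 : w ≠ 0,
      Projectivization.mk k _ (D.point_ne_zero hw0 X Y) ∈ Γ :=
    fun w X Y hw hw0 => (hΓ _ _).2 ⟨w, X, Y, hw, rfl⟩
  constructor
  · obtain ⟨X, Y, hw⟩ := D.exists_onCurve ![1, 0]
    exact ⟨_, hpt _ X Y hw fun h => one_ne_zero (congrFun h 0)⟩
  intro Z₁ Z₂ hZ₁ hZ₂ hcov hdis
  obtain ⟨V₁, hV₁, e₁⟩ := exists_isClosedCone hZ₁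
  obtain ⟨V₂, hV₂, e₂⟩ := exists_isClosedCone hZ₂
  have hcov' : ∀ w X Y, w ≠ 0 → D.OnCurve w X Y →
      D.point w X Y ∈ V₁ ∨ D.point w X Y ∈ V₂ := by
    intro w X Y hw0 hw
    rw [← e₁ _ (D.point_ne_zero hw0 X Y), ← e₂ _ (D.point_ne_zero hw0 X Y)]
    exact hcov (hpt w X Y hw hw0)
  have hdis' : ∀ w X Y, w ≠ 0 → D.OnCurve w X Y →
      ¬ (D.point w X Y ∈ V₁ ∧ D.point w X Y ∈ V₂) := by
    intro w X Y hw0 hw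
    rw [← e₁ _ (D.point_ne_zero hw0 X Y), ← e₂ _ (D.point_ne_zero hw0 X Y)]
    rintro ⟨h1, h3⟩
    have : _ ∈ Γ ∩ Z₁ ∩ Z₂ := ⟨⟨hpt w X Y hw hw0, h1⟩, h3⟩
    rw [hdis] at this
    exact this
  have s1 : ∀ w X Y, w ≠ 0 → D.OnCurve w X Y → D.point w X Y ∈ V₂ → D.point w (-X) Y ∈ V₂ :=
    fun w X Y hw0 hw hm => D.neg_mem_of_mem h2 hV₁ hV₂ hcov' hdis' hw0 hw hm
  have s2 : ∀ w X Y, w ≠ 0 → D.OnCurve w X Y → D.point w X Y ∈ V₂ → D.point w X (-Y) ∈ V₂ := by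
    intro w X Y hw0 hw hm
    have := D.swap.neg_mem_of_mem h2 hV₁ hV₂
      (D.swap_cover (P := fun v => v ∈ V₁ ∨ v ∈ V₂) hcov')
      (D.swap_cover (P := fun v => ¬ (v ∈ V₁ ∧ v ∈ V₂)) hdis') hw0
      (D.swap_onCurve.2 hw) (by rwa [swap_point])
    rwa [swap_point] at this
  have horb : ∀ w, w ≠ 0 → (∀ X Y, D.OnCurve w X Y → D.point w X Y ∈ V₁) ∨
      ∀ X Y, D.OnCurve w X Y → D.point w X Y ∈ V₂ := by
    intro w hw0
    obtain ⟨X, Y, hw⟩ := D.exists_onCurve w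
    by_cases hm : D.point w X Y ∈ V₂
    · right
      intro X' Y' hw'
      obtain ⟨rfl | rfl, rfl | rfl⟩ := D.onCurve_unique hw hw'
      · exact hm
      · exact s2 _ _ _ hw0 hw hm
      · exact s1 _ _ _ hw0 hw hm
      · exact s2 _ _ _ hw0 (D.onCurve_neg_left hw) (s1 _ _ _ hw0 hw hm)
    · left
      intro X' Y' hw'
      refine (hcov' w X' Y' hw0 hw').resolve_right fun hm' => hm ?_
      obtain ⟨rfl | rfl, rfl | rfl⟩ := D.onCurve_unique hw' hw
      · exact hm'
      · exact s2 _ _ _ hw0 hw' hm'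
      · exact s1 _ _ _ hw0 hw' hm'
      · exact s2 _ _ _ hw0 (D.onCurve_neg_left hw') (s1 _ _ _ hw0 hw' hm')
  rcases D.mem_or_mem_of_orbits h2 hV₁ hV₂ horb with h | h
  · left
    intro x hx
    rw [← x.mk_rep] at hx ⊢
    obtain ⟨w, X, Y, hw, hv⟩ := (hΓ _ _).1 hx
    exact (e₁ _ _).2 (hv ▸ h w X Y hw)
  · right
    intro x hx
    rw [← x.mk_rep] at hx ⊢
    obtain ⟨w, X, Y, hw, hv⟩ := (hΓ _ _).1 hx
    exact (e₂ _ _).2 (hv ▸ h w X Y hw)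

end DoubleCover

/-! ### The genus of double covers -/

namespace DoubleCover

variable {k : Type*} [Field k] {n : ℕ} (D : DoubleCover k n)

/-- A binary form, considered as a form on the ambient space. -/
def pullback : MvPolynomial (Fin 2) k →ₐ[k] MvPolynomial (Fin n) k :=
  aeval fun a => linForm (D.ψ a)

lemma pullback_isHomogeneous {A : MvPolynomial (Fin 2) k} {d : ℕ} (hA : A.IsHomogeneous d) :
    (D.pullback A).IsHomogeneous d := by
  have := hA.aeval (fun a => linForm (D.ψ a)) (n := 1) fun a => linForm_isHomogeneous _
  rwa [one_mul] at this

lemma aeval_point_pullback (w : Fin 2 → k) (X Y : k) (A : MvPolynomial (Fin 2) k) :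
    aeval (D.point w X Y) (D.pullback A) = (aeval w A : k) := by
  change ((aeval (D.point w X Y)).comp (aeval fun a => linForm (D.ψ a))) A = _
  congr 1
  ext a
  simp only [AlgHom.comp_apply, aeval_X, aeval_linForm, Algebra.algebraMap_self, RingHom.id_apply,
    sum_ψ_point]

/-- The form on the ambient space with a given normal form. -/
def ofNormalForm (d : ℕ) : (homogeneousSubmodule (Fin 2) k (d + 2) ×
    homogeneousSubmodule (Fin 2) k (d + 1) × homogeneousSubmodule (Fin 2) k (d + 1) ×
    homogeneousSubmodule (Fin 2) k d) →ₗ[k] homogeneousSubmodule (Fin n) k (d + 2) where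
  toFun A := ⟨D.pullback A.1 + X D.i * D.pullback A.2.1 + X D.j * D.pullback A.2.2.1
      + X D.i * X D.j * D.pullback A.2.2.2, by
    have hi : (X D.i : MvPolynomial (Fin n) k).IsHomogeneous 1 := isHomogeneous_X _ _
    have hj : (X D.j : MvPolynomial (Fin n) k).IsHomogeneous 1 := isHomogeneous_X _ _
    have h1 := D.pullback_isHomogeneous A.1.2
    have h2 := hi.mul (D.pullback_isHomogeneous A.2.1.2)
    have h3 := hj.mul (D.pullback_isHomogeneous A.2.2.1.2)
    have h4 := (hi.mul hj).mul (D.pullback_isHomogeneous A.2.2.2.2)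
    rw [show 1 + (d + 1) = d + 2 by omega] at h2 h3
    rw [show 1 + 1 + d = d + 2 by omega] at h4
    exact ((h1.add h2).add h3).add h4⟩
  map_add' A B := by
    ext1
    simp only [Prod.fst_add, Prod.snd_add, Submodule.coe_add, map_add]
    ring
  map_smul' c A := by
    ext1
    simp only [Prod.smul_fst, Prod.smul_snd, Submodule.coe_smul, map_smul, RingHom.id_apply]
    simp only [smul_eq_C_mul]
    ring

lemma mem_vanishingForms {Γ : Set (ℙ k (Fin n → k))}
    (hΓ : ∀ v (hv : v ≠ 0), Projectivization.mk k v hv ∈ Γ ↔ v ∈ D.cone) (m : ℕ)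
    (p : homogeneousSubmodule (Fin n) k m) :
    p ∈ vanishingForms Γ m ↔
      ∀ w X Y, w ≠ 0 → D.OnCurve w X Y → aeval (D.point w X Y) p.1 = (0 : k) := by
  simp only [vanishingForms, Submodule.mem_iInf, LinearMap.mem_ker, LinearMap.comp_apply,
    Submodule.subtype_apply, AlgHom.toLinearMap_apply]
  constructor
  · intro h w X Y hw0 hw
    have hv := D.point_ne_zero hw0 X Y
    exact (evalAt_mk_eq_zero p.2 _ hv).1 (h _ ((hΓ _ hv).2 ⟨w, X, Y, hw, rfl⟩))
  · intro h x hx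
    rw [← x.mk_rep] at hx
    obtain ⟨w, X, Y, hw, hv⟩ := (hΓ _ _).1 hx
    rw [hv]
    exact h w X Y (D.ne_zero_of_point_ne_zero hw (hv ▸ x.rep_nonzero)) hw

lemma aeval_ofNormalForm (d : ℕ) (A) (w : Fin 2 → k) (X Y : k) :
    aeval (D.point w X Y) (D.ofNormalForm d A).1 = aeval w A.1.1 + X * aeval w A.2.1.1
      + Y * aeval w A.2.2.1.1 + X * Y * aeval w A.2.2.2.1 := by
  simp only [ofNormalForm, LinearMap.coe_mk, AddHom.coe_mk, map_add, map_mul,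
    aeval_point_pullback, aeval_X, point_i, point_j]

variable [IsAlgClosed k]

/-- The curve `X² = f(w), Y² = g(w)` has genus one if neither `f` nor `g` is zero: then the normal
form of a function on the curve is unique, and the spaces of binary forms of degrees `m`, `m - 1`,
`m - 1`, `m - 2` have dimensions adding up to `4 m`. -/
theorem isCurveOfGenus_one (h2 : (2 : k) ≠ 0) (hf : D.f ≠ 0) (hg : D.g ≠ 0)
    {Γ : Set (ℙ k (Fin n → k))}
    (hΓ : ∀ v (hv : v ≠ 0), Projectivization.mk k v hv ∈ Γ ↔ v ∈ D.cone) :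
    IsCurveOfGenus Γ 1 := by
  have := IsAlgClosed.instInfinite (K := k)
  refine ⟨4, by norm_num, ?_⟩
  filter_upwards [Filter.eventually_ge_atTop 2] with m hm
  obtain ⟨d, rfl⟩ := Nat.exists_eq_add_of_le' hm
  let Ψ := (vanishingForms Γ (d + 2)).mkQ.comp (D.ofNormalForm d)
  have hinj : Function.Injective Ψ := by
    rw [injective_iff_map_eq_zero]
    rintro ⟨A, B, C, E⟩ h
    simp only [Ψ, LinearMap.comp_apply, Submodule.mkQ_apply, Submodule.Quotient.mk_eq_zero,
      D.mem_vanishingForms hΓ, aeval_ofNormalForm] at h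
    obtain ⟨hA, hB, hC, hE⟩ := D.normalForm_eq_zero_of_infinite h2 Set.infinite_univ A.2 B.2 C.2
      E.2 fun τ _ X Y hXY => h _ X Y (fun h => one_ne_zero (congrFun h 1)) hXY
    have hB := (mul_eq_zero.1 hB).resolve_left hf
    have hC := (mul_eq_zero.1 hC).resolve_left hg
    have hE := (mul_eq_zero.1 hE).resolve_left (mul_ne_zero hf hg)
    ext1
    · exact Subtype.ext hA
    ext1
    · exact Subtype.ext hB
    ext1
    · exact Subtype.ext hC
    · exact Subtype.ext hE
  have hsurj : Function.Surjective Ψ := by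
    intro y
    obtain ⟨p, rfl⟩ := Submodule.mkQ_surjective _ y
    obtain ⟨A, B, C, E, hA, hB, hC, hE, -, -, hn⟩ := D.hasNormalForm p.2
    refine ⟨(⟨A, hA⟩, ⟨B, hB⟩, ⟨C, hC⟩, ⟨E, hE⟩), ?_⟩
    simp only [Ψ, LinearMap.comp_apply, Submodule.mkQ_apply]
    rw [Submodule.Quotient.eq, D.mem_vanishingForms hΓ]
    intro w X Y _ hw
    rw [Submodule.coe_sub, map_sub, aeval_ofNormalForm, hn w X Y hw]
    simp
  have hfin : ∀ e, Module.Finite k (homogeneousSubmodule (Fin 2) k e) := fun e =>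
    Module.finite_of_finrank_pos (by rw [finrank_binaryForms]; omega)
  have hrank := (LinearEquiv.ofBijective Ψ ⟨hinj, hsurj⟩).finrank_eq
  have h1 := hfin (d + 2)
  have h3 := hfin (d + 1)
  have h4 := hfin d
  rw [Module.finrank_prod, Module.finrank_prod, Module.finrank_prod, finrank_binaryForms,
    finrank_binaryForms, finrank_binaryForms] at hrank
  rw [hilbertFunction, ← hrank]
  push_cast
  ring

end DoubleCover

/-! ### Nets of diagonal quadrics -/

/-- The coefficients of the member with parameters `μ` of the net spanned by the diagonal forms
with coefficients `N r`. -/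
def comb {k : Type*} [Field k] (N : Fin 3 → Fin 6 → k) (μ : Fin 3 → k) (j : Fin 6) : k :=
  ∑ r, μ r * N r j

/-- All `3 × 3` minors of `N` are non-zero: a non-zero member of the net has at most two zero
coefficients. In other words, the rows of `N` span a maximum distance separable code. -/
def IsMDS {k : Type*} [Field k] (N : Fin 3 → Fin 6 → k) : Prop :=
  ∀ (μ : Fin 3 → k) (a b c : Fin 6), a ≠ b → a ≠ c → b ≠ c →
    comb N μ a = 0 → comb N μ b = 0 → comb N μ c = 0 → μ = 0

section Net

variable {k : Type*} [Field k] {N : Fin 3 → Fin 6 → k}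

/-- The affine cone over the intersection of the quadrics of the net. -/
def baseCone (N : Fin 3 → Fin 6 → k) : Set (Fin 6 → k) :=
  {v | ∀ r, ∑ j, N r j * v j ^ 2 = 0}

/-- The linear relations between the columns of `N`. -/
def relations (N : Fin 3 → Fin 6 → k) : Submodule k (Fin 6 → k) :=
  LinearMap.ker (Matrix.mulVecLin (Matrix.of N))

lemma mem_relations {y : Fin 6 → k} : y ∈ relations N ↔ ∀ r, ∑ j, N r j * y j = 0 := by
  simp [relations, funext_iff, Matrix.mulVec, dotProduct]

lemma mem_baseCone {v : Fin 6 → k} : v ∈ baseCone N ↔ (fun j => v j ^ 2) ∈ relations N :=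
  mem_relations.symm

lemma sum_comb_mul {y : Fin 6 → k} (hy : y ∈ relations N) (μ : Fin 3 → k) :
    ∑ j, comb N μ j * y j = 0 := by
  simp only [comb, Finset.sum_mul]
  rw [Finset.sum_comm]
  refine Finset.sum_eq_zero fun r _ => ?_
  simp only [mul_assoc]
  rw [← Finset.mul_sum, mem_relations.1 hy r, mul_zero]

lemma sum_comb_mul_sq {v : Fin 6 → k} (hv : v ∈ baseCone N) (μ : Fin 3 → k) :
    ∑ j, comb N μ j * v j ^ 2 = 0 :=
  sum_comb_mul (mem_baseCone.1 hv) μ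

lemma comb_add (μ ν : Fin 3 → k) (j : Fin 6) : comb N (μ + ν) j = comb N μ j + comb N ν j := by
  simp [comb, add_mul, Finset.sum_add_distrib]

lemma comb_smul (a : k) (μ : Fin 3 → k) (j : Fin 6) : comb N (a • μ) j = a * comb N μ j := by
  simp [comb, Finset.mul_sum, mul_assoc]

lemma comb_sub (μ ν : Fin 3 → k) (j : Fin 6) : comb N (μ - ν) j = comb N μ j - comb N ν j := by
  simp [comb, sub_mul, Finset.sum_sub_distrib]

/-- Two members of the net which agree in three coefficients are equal. -/
lemma IsMDS.eq_of_comb_eq (hN : IsMDS N) {μ ν : Fin 3 → k} {a b c : Fin 6} (hab : a ≠ b)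
    (hac : a ≠ c) (hbc : b ≠ c) (ha : comb N μ a = comb N ν a) (hb : comb N μ b = comb N ν b)
    (hc : comb N μ c = comb N ν c) : μ = ν :=
  sub_eq_zero.1 (hN (μ - ν) a b c hab hac hbc (by rw [comb_sub, ha, sub_self])
    (by rw [comb_sub, hb, sub_self]) (by rw [comb_sub, hc, sub_self]))

/-- Three coefficients of a member of the net can be prescribed. -/
lemma IsMDS.exists_comb (hN : IsMDS N) {a b c : Fin 6} (hab : a ≠ b) (hac : a ≠ c) (hbc : b ≠ c)
    (x y z : k) : ∃ μ, comb N μ a = x ∧ comb N μ b = y ∧ comb N μ c = z := by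
  let F : (Fin 3 → k) →ₗ[k] Fin 3 → k :=
    { toFun := fun μ => ![comb N μ a, comb N μ b, comb N μ c]
      map_add' := fun μ ν => by
        ext i; fin_cases i <;> simp [comb_add]
      map_smul' := fun r μ => by
        ext i; fin_cases i <;> simp [comb_smul] }
  have hF : Function.Injective F := by
    rw [injective_iff_map_eq_zero]
    intro μ h
    exact hN μ a b c hab hac hbc (congrFun h 0) (congrFun h 1) (congrFun h 2)
  obtain ⟨μ, hμ⟩ := LinearMap.injective_iff_surjective.1 hF ![x, y, z]
  exact ⟨μ, congrFun hμ 0, congrFun hμ 1, congrFun hμ 2⟩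

lemma exists_two_others {a b c d : Fin 6} (hab : a ≠ b) (hac : a ≠ c) (had : a ≠ d) (hbc : b ≠ c)
    (hbd : b ≠ d) (hcd : c ≠ d) : ∃ e f : Fin 6, e ≠ f ∧ e ≠ a ∧ e ≠ b ∧ e ≠ c ∧ e ≠ d ∧
      f ≠ a ∧ f ≠ b ∧ f ≠ c ∧ f ≠ d ∧
      ∀ x, x = a ∨ x = b ∨ x = c ∨ x = d ∨ x = e ∨ x = f := by
  have hcard : ({a, b, c, d} : Finset (Fin 6))ᶜ.card = 2 := by
    rw [Finset.card_compl, Finset.card_eq_succ.2 ⟨a, {b, c, d}, by simp [*], rfl,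
      Finset.card_eq_three.2 ⟨b, c, d, hbc, hbd, hcd, rfl⟩⟩]
    rfl
  obtain ⟨e, f, hef, h⟩ := Finset.card_eq_two.1 hcard
  have hm : ∀ x, x ∈ ({a, b, c, d} : Finset (Fin 6))ᶜ ↔ x = e ∨ x = f := by
    intro x
    rw [h]
    simp
  have he := (hm e).2 (Or.inl rfl)
  have hf := (hm f).2 (Or.inr rfl)
  simp only [Finset.mem_compl, Finset.mem_insert, Finset.mem_singleton, not_or] at he hf hm
  refine ⟨e, f, hef, he.1, he.2.1, he.2.2.1, he.2.2.2, hf.1, hf.2.1, hf.2.2.1, hf.2.2.2, ?_⟩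
  intro x
  have := hm x
  tauto

/-- A relation between three columns of `N` is trivial. -/
lemma IsMDS.relation_eq_zero (hN : IsMDS N) {y : Fin 6 → k} (hy : y ∈ relations N) {b c d : Fin 6}
    (hbc : b ≠ c) (hbd : b ≠ d) (hcd : c ≠ d) (hb : y b = 0) (hc : y c = 0) (hd : y d = 0) :
    y = 0 := by
  funext a
  by_cases hab : a = b
  · rw [hab, hb]; rfl
  by_cases hac : a = c
  · rw [hac, hc]; rfl
  by_cases had : a = d
  · rw [had, hd]; rfl
  obtain ⟨e, f, hef, hea, -, -, -, hfa, -, -, -, hall⟩ :=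
    exists_two_others hab hac had hbc hbd hcd
  obtain ⟨μ, h1, h2, h3⟩ := hN.exists_comb hea.symm hfa.symm hef 1 0 0
  have hs := sum_comb_mul hy μ
  rw [Finset.sum_eq_single a] at hs
  · simpa [h1] using hs
  · intro x _ hx
    rcases hall x with rfl | rfl | rfl | rfl | rfl | rfl <;> simp_all
  · simp

/-- Three coordinates of a relation can be prescribed. -/
lemma IsMDS.exists_relation (hN : IsMDS N) {a b c : Fin 6} (hab : a ≠ b) (hac : a ≠ c)
    (hbc : b ≠ c) (x y z : k) : ∃ v ∈ relations N, v a = x ∧ v b = y ∧ v c = z := by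
  let F : relations N →ₗ[k] Fin 3 → k :=
    { toFun := fun v => ![v.1 a, v.1 b, v.1 c]
      map_add' := fun μ ν => by
        ext i; fin_cases i <;> simp
      map_smul' := fun r μ => by
        ext i; fin_cases i <;> simp }
  have hF : Function.Injective F := by
    rw [injective_iff_map_eq_zero]
    intro v h
    exact Subtype.ext (hN.relation_eq_zero v.2 hab hac hbc (congrFun h 0) (congrFun h 1)
      (congrFun h 2))
  have h1 := LinearMap.finrank_le_finrank_of_injective hF
  have h2 := LinearMap.finrank_range_add_finrank_ker (Matrix.mulVecLin (Matrix.of N))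
  have h3 := Submodule.finrank_le (LinearMap.range (Matrix.mulVecLin (Matrix.of N)))
  rw [Module.finrank_fin_fun] at h1 h2 h3
  have h4 : Module.finrank k (relations N) = Module.finrank k (Fin 3 → k) := by
    rw [Module.finrank_fin_fun]
    change _ + Module.finrank k (relations N) = 6 at h2
    omega
  obtain ⟨v, hv⟩ := (LinearMap.injective_iff_surjective_of_finrank_eq_finrank h4).1 hF ![x, y, z]
  exact ⟨v.1, v.2, congrFun hv 0, congrFun hv 1, congrFun hv 2⟩

/-- Over an algebraically closed field, every relation consists of the squares of the coordinates of
a point of the base locus. -/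
lemma exists_mem_baseCone [IsAlgClosed k] {y : Fin 6 → k} (hy : y ∈ relations N) :
    ∃ v ∈ baseCone N, ∀ j, v j ^ 2 = y j := by
  choose v hv using fun j => IsAlgClosed.exists_pow_nat_eq (y j) two_pos
  exact ⟨v, mem_baseCone.2 (by simpa only [hv] using hy), hv⟩

end Net

section Smooth

variable {K k : Type*} [Field K] [Field k] [Algebra K k]

/-- The coefficients of the net, in the extension field. -/
def baseChange (k : Type*) [Field k] [Algebra K k] (M : Fin 3 → Fin 6 → K) : Fin 3 → Fin 6 → k :=
  fun r j => algebraMap K k (M r j)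

lemma comb_baseChange (M : Fin 3 → Fin 6 → K) (μ : Fin 3 → K) (j : Fin 6) :
    comb (baseChange k M) (fun r => algebraMap K k (μ r)) j = algebraMap K k (comb M μ j) := by
  simp [comb, baseChange]

lemma IsMDS.of_baseChange {M : Fin 3 → Fin 6 → K} (h : IsMDS (baseChange k M)) : IsMDS M := by
  intro μ a b c hab hac hbc ha hb hc
  have := h (fun r => algebraMap K k (μ r)) a b c hab hac hbc
    (by rw [comb_baseChange, ha, map_zero]) (by rw [comb_baseChange, hb, map_zero])
    (by rw [comb_baseChange, hc, map_zero])
  funext r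
  exact (map_eq_zero (algebraMap K k)).1 (congrFun this r)

lemma mk_mem_zeroLocus_iff (M : Fin 3 → Fin 6 → K) (v : Fin 6 → k) (hv : v ≠ 0) :
    Projectivization.mk k v hv ∈ zeroLocus k (fun r => diagForm (M r)) ↔
      v ∈ baseCone (baseChange k M) :=
  mk_mem_zeroLocus_diagForm M v hv

lemma mem_zeroLocus_iff (M : Fin 3 → Fin 6 → K) (x : ℙ k (Fin 6 → k)) :
    x ∈ zeroLocus k (fun r => diagForm (M r)) ↔ x.rep ∈ baseCone (baseChange k M) :=
  mem_zeroLocus_diagForm M x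

/-- If the intersection of three diagonal quadrics is a smooth surface, no `3 × 3` minor of the
coefficient matrix vanishes: otherwise there is a point all of whose non-zero coordinates belong
to three dependent columns, and it is singular. -/
lemma isMDS_of_isSmoothSurface [IsAlgClosed k] {M : Fin 3 → Fin 6 → K}
    (hX : IsSmoothSurface k (fun r => diagForm (M r))) : IsMDS (baseChange k M) := by
  intro μ a b c hab hac hbc ha hb hc
  by_contra hμ
  set N := baseChange k M
  let e : Fin 3 → Fin 6 := ![a, b, c]
  have he : Function.Injective e := by
    intro i j hij
    fin_cases i <;> fin_cases j <;> simp_all [e]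
  let A : Matrix (Fin 3) (Fin 3) k := Matrix.of fun r i => N r (e i)
  have hdet : A.det = 0 := by
    refine Matrix.exists_vecMul_eq_zero_iff.1 ⟨μ, hμ, ?_⟩
    funext i
    have : comb N μ (e i) = 0 := by fin_cases i <;> assumption
    simpa [A, Matrix.vecMul, dotProduct, comb] using this
  obtain ⟨z, hz, hAz⟩ := Matrix.exists_mulVec_eq_zero_iff.2 hdet
  choose x hx using fun i => IsAlgClosed.exists_pow_nat_eq (z i) two_pos
  let v : Fin 6 → k := fun j => ∑ i, if e i = j then x i else 0
  have hve : ∀ i, v (e i) = x i := by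
    intro i
    simp [v, he.eq_iff]
  have hv0 : ∀ j, (∀ i, e i ≠ j) → v j = 0 := fun j hj =>
    Finset.sum_eq_zero fun i _ => if_neg (hj i)
  have hv : v ≠ 0 := by
    intro h
    apply hz
    funext i
    rw [← hx, ← hve, h]
    simp
  have hmem : v ∈ baseCone N := by
    intro r
    have h1 : ∑ i, N r (e i) * v (e i) ^ 2 = 0 := by
      simp only [hve, hx]
      exact congrFun hAz r
    rw [← h1]
    symm
    rw [← Finset.sum_image (f := fun j => N r j * v j ^ 2) (s := Finset.univ) (g := e)
      (fun i _ j _ h => he h)]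
    refine Finset.sum_subset (Finset.subset_univ _) fun j _ hj => ?_
    rw [hv0 j (fun i hi => hj (Finset.mem_image.2 ⟨i, Finset.mem_univ _, hi⟩))]
    ring
  have hrank := hX _ ((mk_mem_zeroLocus_iff M v hv).2 hmem)
  set J := jacobian (fun r => diagForm (M r)) (Projectivization.mk k v hv) with hJ
  -- the rows of the Jacobian matrix are linearly dependent
  obtain ⟨u, hu⟩ := Projectivization.exists_smul_eq_mk_rep k v hv
  have hdep : J.transpose.mulVecLin μ = 0 := by
    funext j
    simp only [Matrix.mulVecLin_apply, Matrix.mulVec, dotProduct, Matrix.transpose_apply,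
      Pi.zero_apply, hJ, jacobian_diagForm, ← hu, Units.smul_def, Pi.smul_apply, smul_eq_mul]
    have : ∀ r, 2 * algebraMap K k (M r j) * (u * v j) * μ r
        = 2 * (u * v j) * (μ r * N r j) := fun r => by
      simp only [N, baseChange]; ring
    simp only [this]
    rw [← Finset.mul_sum]
    by_cases hj : ∃ i, e i = j
    · obtain ⟨i, rfl⟩ := hj
      have : comb N μ (e i) = 0 := by fin_cases i <;> assumption
      rw [comb] at this
      rw [this, mul_zero]
    · push Not at hj
      rw [hv0 j hj]
      ring
  rw [← Matrix.rank_transpose] at hrank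
  have h2 := LinearMap.finrank_range_add_finrank_ker J.transpose.mulVecLin
  rw [Module.finrank_fin_fun] at h2
  change J.transpose.rank + _ = 3 at h2
  have h3 : Module.finrank k (LinearMap.ker J.transpose.mulVecLin) = 0 := by omega
  rw [Submodule.finrank_eq_zero] at h3
  exact hμ ((Submodule.mem_bot k).1 (h3 ▸ LinearMap.mem_ker.2 hdep))

end Smooth

/-! ### The quadrics containing the base locus of a net -/

section Quadrics

variable {K k : Type*} [Field K] [Field k] [Algebra K k]

/-- A quadratic form has a symmetric Gram matrix. -/
lemma exists_gram {n : ℕ} (h2 : (2 : K) ≠ 0) {q : MvPolynomial (Fin n) K} (hq : q.IsHomogeneous 2) :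
    ∃ G : Matrix (Fin n) (Fin n) K, G.transpose = G ∧ q = ∑ i, ∑ j, C (G i j) * (X i * X j) := by
  have hq' : q ∈ homogeneousSubmodule (Fin n) K 1 * homogeneousSubmodule (Fin n) K 1 := by
    rw [← pow_two, homogeneousSubmodule_one_pow]; exact hq
  have hex : ∃ G : Matrix (Fin n) (Fin n) K, q = ∑ i, ∑ j, C (G i j) * (X i * X j) := by
    refine Submodule.mul_induction_on hq' ?_ ?_
    · intro a ha b hb
      obtain ⟨l, rfl⟩ := exists_eq_linForm (p := a) ha
      obtain ⟨m, rfl⟩ := exists_eq_linForm (p := b) hb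
      refine ⟨Matrix.of fun i j => l i * m j, ?_⟩
      rw [linForm, linForm, Finset.sum_mul_sum]
      refine Finset.sum_congr rfl fun i _ => Finset.sum_congr rfl fun j _ => ?_
      rw [Matrix.of_apply, C_mul]
      ring
    · rintro x y ⟨G, rfl⟩ ⟨H, rfl⟩
      refine ⟨G + H, ?_⟩
      simp only [← Finset.sum_add_distrib, Matrix.add_apply, C_add, add_mul]
  obtain ⟨G, rfl⟩ := hex
  refine ⟨(2 : K)⁻¹ • (G + G.transpose), ?_, ?_⟩
  · rw [Matrix.transpose_smul, Matrix.transpose_add, Matrix.transpose_transpose, add_comm]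
  · have hswap : ∑ i, ∑ j, C (G j i) * (X i * X j : MvPolynomial (Fin n) K)
        = ∑ i, ∑ j, C (G i j) * (X i * X j) := by
      rw [Finset.sum_comm]
      simp only [mul_comm]
    have hsum : ∑ i, ∑ j, C (((2 : K)⁻¹ • (G + G.transpose)) i j) *
        (X i * X j : MvPolynomial (Fin n) K) = C (2 : K)⁻¹ * (∑ i, ∑ j, C (G i j) * (X i * X j) +
          ∑ i, ∑ j, C (G j i) * (X i * X j)) := by
      simp only [← Finset.sum_add_distrib, Finset.mul_sum]
      refine Finset.sum_congr rfl fun i _ => Finset.sum_congr rfl fun j _ => ?_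
      simp only [Matrix.smul_apply, Matrix.add_apply, Matrix.transpose_apply, smul_eq_mul, C_mul,
        C_add]
      ring
    have h1 : (C (2 : K)⁻¹ * C 2 : MvPolynomial (Fin n) K) = 1 := by
      rw [← C_mul, inv_mul_cancel₀ h2, C_1]
    rw [hsum, hswap, ← two_mul, ← mul_assoc, ← map_ofNat C 2, h1, one_mul]

lemma quadricRank_diagForm [DecidableEq K] (h2 : (2 : K) ≠ 0) (c : Fin 6 → K) :
    (Finset.univ.filter fun j => c j = 0).card + quadricRank (diagForm c) = 6 := by
  have : (Matrix.of fun i j : Fin 6 => constantCoeff (pderiv i (pderiv j (diagForm c))))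
      = Matrix.diagonal fun i => 2 * c i := by
    ext i j
    rw [Matrix.of_apply, pderiv_diagForm, pderiv_C_mul, pderiv_X]
    by_cases h : i = j
    · subst h
      simp [map_ofNat]
    · simp [h, Ne.symm h]
  rw [quadricRank, this, Matrix.rank_diagonal, Fintype.card_subtype]
  simp only [ne_eq, mul_eq_zero, h2, false_or]
  rw [Finset.card_filter_add_card_filter_not]
  rfl

lemma diagForm_injective : Function.Injective (diagForm (K := K)) := by
  intro c d h
  funext i
  have h1 := congrArg (fun p => aeval (Pi.single i (1 : K)) p) h
  simpa [aeval_diagForm, Pi.single_apply] using h1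

lemma C_mul_diagForm (a : K) (c : Fin 6 → K) : C a * diagForm c = diagForm fun j => a * c j := by
  simp only [diagForm, Finset.mul_sum, C_mul, mul_assoc]

/-- The second difference of a quadratic form with respect to two sign changes. -/
lemma gram_second_difference {n : ℕ} (G : Matrix (Fin n) (Fin n) k) (hG : G.transpose = G)
    (x u w : Fin n → k) :
    x ⬝ᵥ G.mulVec x - (x - u) ⬝ᵥ G.mulVec (x - u) - (x - w) ⬝ᵥ G.mulVec (x - w)
      + (x - u - w) ⬝ᵥ G.mulVec (x - u - w) = 2 * (u ⬝ᵥ G.mulVec w) := by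
  have h1 : w ⬝ᵥ G.mulVec u = u ⬝ᵥ G.mulVec w := by
    rw [Matrix.dotProduct_mulVec, ← Matrix.mulVec_transpose, hG, dotProduct_comm]
  simp only [Matrix.mulVec_sub, sub_dotProduct, dotProduct_sub, h1]
  ring

/-- The base locus has points where two given coordinates do not vanish. -/
lemma IsMDS.exists_mem_baseCone_ne_zero [IsAlgClosed k] {N : Fin 3 → Fin 6 → k} (hN : IsMDS N)
    {a b : Fin 6} (hab : a ≠ b) : ∃ v ∈ baseCone N, v a ≠ 0 ∧ v b ≠ 0 := by
  obtain ⟨c, hc⟩ : ∃ c, c ∉ ({a, b} : Finset (Fin 6)) := by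
    by_contra! h
    have := Finset.card_le_card (fun x _ => h x : Finset.univ ⊆ ({a, b} : Finset (Fin 6)))
    have h3 := Finset.card_le_two (a := a) (b := b)
    simp at this
    omega
  simp only [Finset.mem_insert, Finset.mem_singleton, not_or] at hc
  obtain ⟨y, hy, ha, hb, -⟩ := hN.exists_relation hab (Ne.symm hc.1) (Ne.symm hc.2) 1 1 0
  obtain ⟨v, hv, hvy⟩ := exists_mem_baseCone hy
  exact ⟨v, hv, fun h => by simpa [h, ha] using hvy a, fun h => by simpa [h, hb] using hvy b⟩

/-- The quadrics which contain the base locus of a net of diagonal quadrics without vanishing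
minors belong to the net. The sign changes of the coordinates show that such a quadric is
diagonal. -/
lemma exists_eq_diagForm_comb [IsAlgClosed k] (h2 : (2 : K) ≠ 0) {M : Fin 3 → Fin 6 → K}
    (hM : IsMDS (baseChange k M)) {q : MvPolynomial (Fin 6) K} (hq : q.IsHomogeneous 2)
    (hX : ∀ x ∈ zeroLocus k (fun r => diagForm (M r)), evalAt q x = 0) :
    ∃ μ, q = diagForm (comb M μ) := by
  set N := baseChange k M with hNdef
  have h2k : (2 : k) ≠ 0 := by
    rw [← map_ofNat (algebraMap K k) 2]; exact (map_ne_zero _).2 h2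
  obtain ⟨G, hG, rfl⟩ := exists_gram h2 hq
  let H : Matrix (Fin 6) (Fin 6) k := G.map (algebraMap K k)
  have hH : H.transpose = H := by rw [← Matrix.transpose_map, hG]
  have heval : ∀ v : Fin 6 → k, aeval v (∑ i, ∑ j, C (G i j) * (X i * X j))
      = v ⬝ᵥ H.mulVec v := by
    intro v
    simp only [map_sum, map_mul, aeval_C, aeval_X, dotProduct, Matrix.mulVec, Finset.mul_sum, H,
      Matrix.map_apply]
    refine Finset.sum_congr rfl fun i _ => Finset.sum_congr rfl fun j _ => ?_
    ring
  have hvan : ∀ v ∈ baseCone N, v ⬝ᵥ H.mulVec v = 0 := by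
    intro v hv
    by_cases hv0 : v = 0
    · simp [hv0]
    rw [← heval, ← evalAt_mk_eq_zero hq v hv0]
    exact hX _ ((mk_mem_zeroLocus_iff M v hv0).2 hv)
  have hflip : ∀ v ∈ baseCone N, ∀ i, v - Pi.single i (2 * v i) ∈ baseCone N := by
    intro v hv i r
    rw [← hv r]
    refine Finset.sum_congr rfl fun j _ => ?_
    by_cases h : j = i
    · subst h
      simp only [Pi.sub_apply, Pi.single_eq_same]
      ring
    · simp [h]
  have hoff : ∀ i j, i ≠ j → H i j = 0 := by
    intro i j hij
    obtain ⟨v, hv, hi, hj⟩ := hM.exists_mem_baseCone_ne_zero hij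
    have h1 := gram_second_difference H hH v (Pi.single i (2 * v i)) (Pi.single j (2 * v j))
    have h3 := hflip _ (hflip v hv i) j
    have h4 : (v - Pi.single i (2 * v i) : Fin 6 → k) j = v j := by simp [hij.symm]
    rw [h4] at h3
    rw [hvan v hv, hvan _ (hflip v hv i), hvan _ (hflip v hv j), hvan _ h3] at h1
    simp only [sub_self, add_zero, Matrix.mulVec_single, single_dotProduct] at h1
    have h5 : (2 * (2 * v i * (2 * v j))) * H i j = 0 := by
      rw [show (0 : k) = 2 * (2 * v i * (MulOpposite.op (2 * v j) • H.col j) i) from h1]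
      simp only [Pi.smul_apply, Matrix.col_apply, MulOpposite.smul_eq_mul_unop,
        MulOpposite.unop_op]
      ring
    exact (mul_eq_zero.1 h5).resolve_left (by simp [h2k, hi, hj])
  have hoffG : ∀ i j, i ≠ j → G i j = 0 := fun i j hij =>
    (map_eq_zero (algebraMap K k)).1 (hoff i j hij)
  have hdiag : (∑ i, ∑ j, C (G i j) * (X i * X j)) = diagForm fun i => G i i := by
    refine Finset.sum_congr rfl fun i _ => ?_
    rw [Finset.sum_eq_single i (fun j _ hj => by rw [hoffG i j hj.symm]; simp) (by simp)]
    rw [pow_two]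
  -- subtract the member of the net with the same first three coefficients
  obtain ⟨μ, e0, e1, e2⟩ := hM.of_baseChange.exists_comb (a := 0) (b := 1) (c := 2)
    (by decide) (by decide) (by decide) (G 0 0) (G 1 1) (G 2 2)
  refine ⟨μ, ?_⟩
  rw [hdiag]
  congr 1
  have hrel : ∀ y ∈ relations N, ∑ j, algebraMap K k (G j j - comb M μ j) * y j = 0 := by
    intro y hy
    obtain ⟨v, hv, hvy⟩ := exists_mem_baseCone hy
    have h1 := hvan v hv
    rw [← heval, hdiag, aeval_diagForm] at h1
    simp only [hvy] at h1
    have h3 := sum_comb_mul hy fun r => algebraMap K k (μ r)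
    simp only [hNdef, comb_baseChange] at h3
    simp only [map_sub, sub_mul, Finset.sum_sub_distrib, h1, h3, sub_zero]
  have key : ∀ y ∈ relations N, algebraMap K k (G 3 3 - comb M μ 3) * y 3 +
      algebraMap K k (G 4 4 - comb M μ 4) * y 4 + algebraMap K k (G 5 5 - comb M μ 5) * y 5 = 0 := by
    intro y hy
    have := hrel y hy
    simp only [Fin.sum_univ_six, e0, e1, e2, sub_self, map_zero, zero_mul, zero_add] at this
    exact this
  have n34 : (3 : Fin 6) ≠ 4 := by decide
  have n35 : (3 : Fin 6) ≠ 5 := by decide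
  have n45 : (4 : Fin 6) ≠ 5 := by decide
  have d3 : G 3 3 = comb M μ 3 := by
    obtain ⟨y, hy, h3, h4, h5⟩ := hM.exists_relation n34 n35 n45 1 0 0
    have := key y hy
    rw [h3, h4, h5, mul_one, mul_zero, mul_zero, add_zero, add_zero, map_eq_zero] at this
    exact sub_eq_zero.1 this
  have d4 : G 4 4 = comb M μ 4 := by
    obtain ⟨y, hy, h3, h4, h5⟩ := hM.exists_relation n34 n35 n45 0 1 0
    have := key y hy
    rw [h3, h4, h5, mul_one, mul_zero, mul_zero, add_zero, zero_add, map_eq_zero] at this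
    exact sub_eq_zero.1 this
  have d5 : G 5 5 = comb M μ 5 := by
    obtain ⟨y, hy, h3, h4, h5⟩ := hM.exists_relation n34 n35 n45 0 0 1
    have := key y hy
    rw [h3, h4, h5, mul_one, mul_zero, mul_zero, zero_add, zero_add, map_eq_zero] at this
    exact sub_eq_zero.1 this
  funext i
  fin_cases i
  exacts [e0.symm, e1.symm, e2.symm, d3, d4, d5]

lemma evalAt_diagForm_comb (M : Fin 3 → Fin 6 → K) (μ : Fin 3 → K) {x : ℙ k (Fin 6 → k)}
    (hx : x ∈ zeroLocus k (fun r => diagForm (M r))) : evalAt (diagForm (comb M μ)) x = 0 := by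
  have := sum_comb_mul_sq ((mem_zeroLocus_iff M x).1 hx) fun r => algebraMap K k (μ r)
  simp only [comb_baseChange] at this
  rwa [evalAt, aeval_diagForm]

/-- A quadric containing the base locus has rank `r ≤ 4` only if `r = 0` or it is a non-zero member
of the net with two vanishing coefficients, in which case `r = 4`. -/
lemma IsQuadricThrough.rank_eq_four [IsAlgClosed k] (h2 : (2 : K) ≠ 0) {M : Fin 3 → Fin 6 → K}
    (hM : IsMDS (baseChange k M)) {q : MvPolynomial (Fin 6) K} {r : ℕ} (hr0 : 0 < r) (hr : r ≤ 4)
    (hq : IsQuadricThrough (zeroLocus k (fun r => diagForm (M r))) r q) :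
    r = 4 ∧ ∃ μ, q = diagForm (comb M μ) ∧ ∃ a b, a ≠ b ∧ ∀ j, comb M μ j = 0 ↔ j = a ∨ j = b := by
  classical
  obtain ⟨hq1, hq2, hq3⟩ := hq
  obtain ⟨μ, rfl⟩ := exists_eq_diagForm_comb h2 hM hq1 hq3
  set Z : Finset (Fin 6) := Finset.univ.filter fun j => comb M μ j = 0 with hZ
  have hcard : Z.card + r = 6 := by
    rw [← hq2, hZ]
    exact quadricRank_diagForm h2 _
  have hle : Z.card ≤ 2 := by
    by_contra! h3
    obtain ⟨a, b, c, ha, hb, hc, hab, hac, hbc⟩ := Finset.two_lt_card_iff.1 h3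
    simp only [hZ, Finset.mem_filter, Finset.mem_univ, true_and] at ha hb hc
    have h0 := hM.of_baseChange μ a b c hab hac hbc ha hb hc
    have : ∀ j, comb M μ j = 0 := fun j => by simp [h0, comb]
    rw [hZ] at hcard
    simp [this] at hcard
    omega
  refine ⟨by omega, μ, rfl, ?_⟩
  obtain ⟨a, b, hab, hZab⟩ := Finset.card_eq_two.1 (show Z.card = 2 by omega)
  refine ⟨a, b, hab, fun j => ?_⟩
  have : j ∈ Z ↔ j ∈ ({a, b} : Finset (Fin 6)) := by rw [hZab]
  simpa [hZ] using this

/-- A non-zero member of the net with two vanishing coefficients has no further ones. -/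
lemma IsMDS.comb_eq_zero_iff {N : Fin 3 → Fin 6 → k} (hN : IsMDS N) {μ : Fin 3 → k} (hμ : μ ≠ 0)
    {a b : Fin 6} (hab : a ≠ b) (ha : comb N μ a = 0) (hb : comb N μ b = 0) (j : Fin 6) :
    comb N μ j = 0 ↔ j = a ∨ j = b := by
  constructor
  · intro hj
    by_contra! h
    exact hμ (hN μ a b j hab h.1.symm h.2.symm ha hb hj)
  · rintro (rfl | rfl) <;> assumption

lemma quadricRank_eq_four (h2 : (2 : K) ≠ 0) {c : Fin 6 → K} {a b : Fin 6} (hab : a ≠ b)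
    (hc : ∀ j, c j = 0 ↔ j = a ∨ j = b) : quadricRank (diagForm c) = 4 := by
  classical
  have h1 := quadricRank_diagForm h2 c
  have h3 : (Finset.univ.filter fun j : Fin 6 => c j = 0) = {a, b} := by
    ext j; simp [hc]
  rw [h3, Finset.card_pair hab] at h1
  omega

end Quadrics

/-! ### The table of quadrics -/

/-- The coefficients of the equations of the surface. -/
def kummerCoeff {K : Type*} [Field K] (t s : K) : Fin 3 → Fin 6 → K :=
  ![![-2 * γ₄ t s, 1, -2 * t ^ 2, γ₄ t s, 0, 0],
    ![γ₂ t s, 0, t ^ 2 * s, -t * s * γ₂ t s, -t * s ^ 2, 0],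
    ![-2 * γ₁ t s, 0, 0, γ₁ t s, -2 * s ^ 2, 1]]

/-- The coordinates of the quadrics of the table with respect to the equations of the surface. -/
def tableParam {K : Type*} [Field K] (t s : K) : Fin 15 → Fin 3 → K :=
  let g₁ := γ₁ t s
  let g₂ := γ₂ t s
  let g₃ := γ₃ t s
  let g₄ := γ₄ t s
  ![![g₁, 0, -g₄], ![s, 2, -t], ![0, 1, 0], ![1, 0, 0], ![t * s * g₂, g₄, 0],
    ![s * g₃, 4 * t * g₂ + 2 * g₃, -t * g₄], ![0, 0, 1], ![0, g₁, t * s * g₂],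
    ![s * g₁, 2 * g₁, -t * g₃], ![s, 2, 0], ![t * g₃, 2 * g₄, -t * g₄], ![g₂, 2 * g₄, 0],
    ![0, 2, -t], ![s * g₁, 2 * g₁, -s * g₃], ![0, 2 * g₁, g₂]]

/-- The two coordinates which do not occur in the quadrics of the table. -/
def tablePair : Fin 15 → Fin 6 × Fin 6 :=
  ![(0, 3), (2, 4), (1, 5), (4, 5), (3, 5), (0, 4), (1, 2), (1, 3), (0, 2), (2, 5), (3, 4), (0, 5),
    (1, 4), (2, 3), (0, 1)]

/-- The four coordinates which occur in the quadrics of the table. -/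
def tableQuad : Fin 15 → Fin 4 → Fin 6 :=
  ![![1, 2, 4, 5], ![0, 1, 3, 5], ![0, 2, 3, 4], ![0, 1, 2, 3], ![0, 1, 2, 4], ![1, 2, 3, 5],
    ![0, 3, 4, 5], ![0, 2, 4, 5], ![1, 3, 4, 5], ![0, 1, 3, 4], ![0, 1, 2, 5], ![1, 2, 3, 4],
    ![0, 2, 3, 5], ![0, 1, 4, 5], ![2, 3, 4, 5]]

/-- The square roots of the discriminants of the quadrics of the table, up to sign. -/
def tableDisc {K : Type*} [Field K] (t s : K) : Fin 15 → K :=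
  let g₁ := γ₁ t s
  let g₂ := γ₂ t s
  let g₃ := γ₃ t s
  let g₄ := γ₄ t s
  ![2 * t * s * g₁ * g₄, 2 * t * s * g₂, t ^ 2 * s ^ 2 * g₂, 2 * t * g₄,
    t ^ 2 * s ^ 2 * g₂ * g₃ * g₄, 2 * t ^ 2 * s * g₂ * g₃ * g₄, 2 * s * g₁,
    t ^ 2 * s ^ 2 * g₁ * g₂ * g₃, 2 * t * s ^ 2 * g₁ * g₂ * g₃, 2 * t * s ^ 2 * g₃,
    2 * t ^ 2 * g₂ * g₃ * g₄, 2 * t ^ 2 * s * g₂ * g₃ * g₄, 2 * t ^ 2 * s * g₃,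
    2 * s ^ 2 * g₁ * g₂ * g₃, 2 * t * s ^ 2 * g₁ * g₂ * g₃]

section Table

variable {K k : Type*} [Field K] [Field k] [Algebra K k]

lemma kummerEqs_eq (t s : K) : kummerEqs t s = fun r => diagForm (kummerCoeff t s r) := by
  funext r
  fin_cases r <;> rfl

lemma quadricTable_eq (t s : K) (i : Fin 15) :
    quadricTable t s i = diagForm (comb (kummerCoeff t s) (tableParam t s i)) := by
  fin_cases i <;>
  · refine congrArg diagForm (funext fun j => ?_)
    fin_cases j <;>
    · simp [comb, kummerCoeff, tableParam, Fin.sum_univ_three, γ₁, γ₂, γ₃, γ₄]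
      try ring

/-- The rational point `(0, 1, 1, 1, 1, 1)` of the surface. -/
def kummerPoint {K : Type*} [Field K] : Fin 6 → K := ![0, 1, 1, 1, 1, 1]

lemma kummerPoint_mem (t s : K) : kummerPoint ∈ baseCone (kummerCoeff t s) := by
  intro r
  fin_cases r <;>
  · simp [kummerCoeff, kummerPoint, Fin.sum_univ_six, γ₁, γ₂, γ₄]
    try ring

lemma tablePair_ne (i : Fin 15) : (tablePair i).1 ≠ (tablePair i).2 := by
  fin_cases i <;> decide

lemma exists_tablePair : ∀ a b : Fin 6, a ≠ b →
    ∃ i, tablePair i = (a, b) ∨ tablePair i = (b, a) := by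
  decide

lemma tablePair_injective : ∀ i j : Fin 15,
    (∀ l, (l = (tablePair i).1 ∨ l = (tablePair i).2) ↔
      (l = (tablePair j).1 ∨ l = (tablePair j).2)) → i = j := by
  decide

lemma comb_tablePair (t s : K) (i : Fin 15) :
    comb (kummerCoeff t s) (tableParam t s i) (tablePair i).1 = 0 ∧
      comb (kummerCoeff t s) (tableParam t s i) (tablePair i).2 = 0 := by
  fin_cases i <;>
  · constructor <;>
    · simp [comb, kummerCoeff, tableParam, tablePair, Fin.sum_univ_three, γ₁, γ₂, γ₃, γ₄]
      try ring

/-- The discriminants of the quadrics of the table are squares. -/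
lemma tableDisc_sq (t s : K) (i : Fin 15) :
    ∏ l, comb (kummerCoeff t s) (tableParam t s i) (tableQuad i l) = tableDisc t s i ^ 2 := by
  fin_cases i <;>
  · simp [comb, kummerCoeff, tableParam, tableQuad, tableDisc, Fin.sum_univ_three,
      Fin.prod_univ_four, γ₁, γ₂, γ₃, γ₄]
    ring

/-- The choice of the order ensures that the rational point has non-zero coordinates in the second
and the fourth of the variables of each quadric. -/
lemma tableQuad_spec (i : Fin 15) : Function.Injective (tableQuad i) ∧
    (∀ j, (∀ l, tableQuad i l ≠ j) ↔ j = (tablePair i).1 ∨ j = (tablePair i).2) ∧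
    tableQuad i 1 ≠ 0 ∧ tableQuad i 3 ≠ 0 := by
  fin_cases i <;> decide

lemma tableParam_ne_zero (h2 : (2 : K) ≠ 0) {t s : K} (hM : IsMDS (kummerCoeff t s))
    (i : Fin 15) : tableParam t s i ≠ 0 := by
  have hg₁ : γ₁ t s ≠ 0 := by
    intro h
    have := hM ![0, 0, 1] 0 1 2 (by decide) (by decide) (by decide)
      (by simp [comb, kummerCoeff, Fin.sum_univ_three, h])
      (by simp [comb, kummerCoeff, Fin.sum_univ_three])
      (by simp [comb, kummerCoeff, Fin.sum_univ_three])
    exact one_ne_zero (congrFun this 2)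
  have hg₄ : γ₄ t s ≠ 0 := by
    intro h
    have := hM ![1, 0, 0] 0 4 5 (by decide) (by decide) (by decide)
      (by simp [comb, kummerCoeff, Fin.sum_univ_three, h])
      (by simp [comb, kummerCoeff, Fin.sum_univ_three])
      (by simp [comb, kummerCoeff, Fin.sum_univ_three])
    exact one_ne_zero (congrFun this 0)
  have ht : t ≠ 0 := by
    intro h
    have := hM ![0, 1, 0] 1 2 5 (by decide) (by decide) (by decide)
      (by simp [comb, kummerCoeff, Fin.sum_univ_three])
      (by simp [comb, kummerCoeff, Fin.sum_univ_three, h])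
      (by simp [comb, kummerCoeff, Fin.sum_univ_three])
    exact one_ne_zero (congrFun this 1)
  intro h
  have h0 := congrFun h 0
  have h1 := congrFun h 1
  have h3 := congrFun h 2
  fin_cases i <;> simp [tableParam, h2, hg₁, hg₄, ht] at h0 h1 h3

end Table

/-! ### Split quadrics -/

section Split

/-- A diagonal quadratic form in four variables with square discriminant is, up to factors, a sum of
two norms from the same quadratic algebra. If it has a zero `v` at which its two halves do not
vanish, the multiplication by a suitable element, formed with the values `η` of the product at `v`,
maps the second norm to the negative of the first one, so that the form becomes a difference of two
values of the same norm form, which splits. -/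
lemma split_identity {R : Type*} [CommRing R] {c₀ c₁ c₂ c₃ e u w v₀ v₁ v₂ v₃ : R}
    (h1 : c₂ * c₃ = e ^ 2 * (c₀ * c₁))
    (h2 : c₀ * v₀ ^ 2 + c₁ * v₁ ^ 2 + c₂ * v₂ ^ 2 + c₃ * v₃ ^ 2 = 0)
    (h3 : w * (c₂ * (c₂ * v₂ ^ 2 + c₃ * v₃ ^ 2)) = 1) (h4 : u * c₀ = 1) (y₀ y₁ y₂ y₃ : R) :
    let η₁ := c₀ * c₂ * v₀ * v₂ + c₀ * c₁ * e * v₁ * v₃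
    let η₂ := c₂ * v₁ * v₂ - c₀ * e * v₀ * v₃
    let θ₁ := w * (c₂ * η₁) * y₂ - w * (c₀ * c₁ * e * η₂) * y₃
    let θ₂ := w * (c₂ * η₂) * y₂ + w * (e * η₁) * y₃
    c₀ * y₀ ^ 2 + c₁ * y₁ ^ 2 + c₂ * y₂ ^ 2 + c₃ * y₃ ^ 2 =
      (u * (c₀ * y₀ - θ₁)) * (c₀ * y₀ + θ₁) - (-(u * (c₀ * c₁)) * (y₁ - θ₂)) * (y₁ + θ₂) := by
  intro η₁ η₂ θ₁ θ₂
  have hη : η₁ ^ 2 + c₀ * c₁ * η₂ ^ 2 = (c₀ * (c₀ * v₀ ^ 2 + c₁ * v₁ ^ 2)) *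
      (c₂ * (c₂ * v₂ ^ 2 + c₃ * v₃ ^ 2)) := by
    simp only [η₁, η₂]
    linear_combination -(c₀ * (c₀ * v₀ ^ 2 + c₁ * v₁ ^ 2)) * v₃ ^ 2 * h1
  have hθ : θ₁ ^ 2 + c₀ * c₁ * θ₂ ^ 2 = w ^ 2 * (c₂ * (c₂ * y₂ ^ 2 + c₃ * y₃ ^ 2)) *
      (η₁ ^ 2 + c₀ * c₁ * η₂ ^ 2) := by
    simp only [θ₁, θ₂]
    linear_combination -w ^ 2 * y₃ ^ 2 * (η₁ ^ 2 + c₀ * c₁ * η₂ ^ 2) * h1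
  set n := c₂ * v₂ ^ 2 + c₃ * v₃ ^ 2 with hn
  have h5 : c₀ * v₀ ^ 2 + c₁ * v₁ ^ 2 = -n := by linear_combination h2
  rw [hη, h5] at hθ
  have h6 : θ₁ ^ 2 + c₀ * c₁ * θ₂ ^ 2 = -c₀ * (c₂ * y₂ ^ 2 + c₃ * y₃ ^ 2) := by
    rw [hθ]
    linear_combination (-c₀ * (c₂ * y₂ ^ 2 + c₃ * y₃ ^ 2)) * (w * (c₂ * n) + 1) * h3
  linear_combination u * h6 - (c₀ * y₀ ^ 2 + c₁ * y₁ ^ 2 + c₂ * y₂ ^ 2 + c₃ * y₃ ^ 2) * h4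

variable {K : Type*} [Field K]

/-- A diagonal quadratic form of rank four with square discriminant and a non-trivial zero is the
determinant of a `2 × 2` matrix of linear forms. -/
lemma exists_split {c : Fin 6 → K} {e : Fin 4 → Fin 6} (he : Function.Injective e)
    (hc : ∀ j, (∀ l, e l ≠ j) → c j = 0) (hne : ∀ l, c (e l) ≠ 0) {δ : K}
    (hδ : ∏ l, c (e l) = δ ^ 2) {v : Fin 6 → K} (hv : ∑ j, c j * v j ^ 2 = 0) (hv₁ : v (e 1) ≠ 0)
    (hv₃ : v (e 3) ≠ 0) :
    ∃ l : Fin 4 → Fin 6 → K,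
      diagForm c = linForm (l 0) * linForm (l 3) - linForm (l 1) * linForm (l 2) := by
  have hsum : ∀ {A : Type _} [AddCommMonoid A] (F : Fin 6 → A), (∀ j, c j = 0 → F j = 0) →
      ∑ j, F j = F (e 0) + F (e 1) + F (e 2) + F (e 3) := by
    intro A _ F hF
    rw [← Fin.sum_univ_four (fun l => F (e l)),
      ← Finset.sum_image (f := F) (s := Finset.univ) (g := e) (fun i _ j _ h => he h)]
    symm
    refine Finset.sum_subset (Finset.subset_univ _) fun j _ hj => hF j (hc j fun l hl => hj ?_)
    exact Finset.mem_image.2 ⟨l, Finset.mem_univ _, hl⟩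
  rw [hsum (fun j => c j * v j ^ 2) (fun j hj => by simp [hj])] at hv
  have hq : diagForm c = C (c (e 0)) * X (e 0) ^ 2 + C (c (e 1)) * X (e 1) ^ 2
      + C (c (e 2)) * X (e 2) ^ 2 + C (c (e 3)) * X (e 3) ^ 2 :=
    hsum (fun j => C (c j) * X j ^ 2) (fun j hj => by simp [hj])
  have hlin : ∀ a b d f : MvPolynomial (Fin 6) K, a.IsHomogeneous 1 → b.IsHomogeneous 1 →
      d.IsHomogeneous 1 → f.IsHomogeneous 1 → diagForm c = a * f - b * d →
      ∃ l : Fin 4 → Fin 6 → K,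
        diagForm c = linForm (l 0) * linForm (l 3) - linForm (l 1) * linForm (l 2) := by
    intro a b d f ha hb hd hf h
    obtain ⟨a, rfl⟩ := exists_eq_linForm ha
    obtain ⟨b, rfl⟩ := exists_eq_linForm hb
    obtain ⟨d, rfl⟩ := exists_eq_linForm hd
    obtain ⟨f, rfl⟩ := exists_eq_linForm hf
    exact ⟨![a, b, d, f], h⟩
  have hX : ∀ (r : K) (j : Fin 6), (C r * X j).IsHomogeneous 1 := isHomogeneous_C_mul_X
  have hX1 : ∀ j : Fin 6, (X j : MvPolynomial (Fin 6) K).IsHomogeneous 1 := isHomogeneous_X K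
  have hC : ∀ r : K, r ≠ 0 → (C r⁻¹ * C r : MvPolynomial (Fin 6) K) = 1 := fun r hr => by
    rw [← C_mul, inv_mul_cancel₀ hr, C_1]
  rw [Fin.prod_univ_four] at hδ
  have h0 := hne 0
  have h1 := hne 1
  have h2 := hne 2
  have h3 := hne 3
  generalize c (e 0) = c₀ at *
  generalize c (e 1) = c₁ at *
  generalize c (e 2) = c₂ at *
  generalize c (e 3) = c₃ at *
  generalize v (e 0) = v₀ at *
  generalize v (e 1) = v₁ at *
  generalize v (e 2) = v₂ at *
  generalize v (e 3) = v₃ at *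
  by_cases hn : c₂ * v₂ ^ 2 + c₃ * v₃ ^ 2 = 0
  · -- both halves of the form vanish at `v` and split
    have r1 : (c₀ * v₀ * v₁⁻¹) ^ 2 = -(c₀ * c₁) := by
      field_simp
      linear_combination hv - hn
    have r2 : (c₂ * v₂ * v₃⁻¹) ^ 2 = -(c₂ * c₃) := by
      field_simp
      linear_combination hn
    generalize c₀ * v₀ * v₁⁻¹ = ρ at *
    generalize c₂ * v₂ * v₃⁻¹ = κ at *
    have r1' := congrArg (C (σ := Fin 6)) r1
    have r2' := congrArg (C (σ := Fin 6)) r2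
    simp only [map_pow, map_neg, map_mul] at r1' r2'
    refine hlin (C c₀⁻¹ * (C c₀ * X (e 0) - C ρ * X (e 1)))
      (-(C c₂⁻¹ * (C c₂ * X (e 2) - C κ * X (e 3)))) (C c₂ * X (e 2) + C κ * X (e 3))
      (C c₀ * X (e 0) + C ρ * X (e 1)) (((hX _ _).sub (hX _ _)).C_mul _)
      (((hX _ _).sub (hX _ _)).C_mul _).neg ((hX _ _).add (hX _ _)) ((hX _ _).add (hX _ _)) ?_
    rw [hq]
    linear_combination C c₀⁻¹ * X (e 1) ^ 2 * r1' + C c₂⁻¹ * X (e 3) ^ 2 * r2'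
      - (C c₀ * X (e 0) ^ 2 + C c₁ * X (e 1) ^ 2) * hC c₀ h0
      - (C c₂ * X (e 2) ^ 2 + C c₃ * X (e 3) ^ 2) * hC c₂ h2
  · have r1 : c₂ * c₃ = (δ * (c₀ * c₁)⁻¹) ^ 2 * (c₀ * c₁) := by
      field_simp
      linear_combination hδ
    have r3 : (c₂ * (c₂ * v₂ ^ 2 + c₃ * v₃ ^ 2))⁻¹ * (c₂ * (c₂ * v₂ ^ 2 + c₃ * v₃ ^ 2)) = 1 :=
      inv_mul_cancel₀ (mul_ne_zero h2 hn)
    generalize δ * (c₀ * c₁)⁻¹ = ε at *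
    generalize (c₂ * (c₂ * v₂ ^ 2 + c₃ * v₃ ^ 2))⁻¹ = w at *
    have r1' := congrArg (C (σ := Fin 6)) r1
    have r2' := congrArg (C (σ := Fin 6)) hv
    have r3' := congrArg (C (σ := Fin 6)) r3
    simp only [map_pow, map_mul, map_add, map_zero, map_one] at r1' r2' r3'
    have key := split_identity r1' r2' r3' (hC c₀ h0) (X (e 0)) (X (e 1)) (X (e 2)) (X (e 3))
    simp only [← C_mul, ← C_add, ← C_sub, ← C_neg] at key
    refine hlin _ _ _ _ ?_ ?_ ?_ ?_ (hq.trans key)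
    · exact ((hX _ _).sub ((hX _ _).sub (hX _ _))).C_mul _
    · exact ((hX1 _).sub ((hX _ _).add (hX _ _))).C_mul _
    · exact (hX1 _).add ((hX _ _).add (hX _ _))
    · exact (hX _ _).add ((hX _ _).sub (hX _ _))

/-- The quadrics of the table are split over the ground field. -/
lemma exists_split_table {t s : K} {i : Fin 15}
    (h : ∀ j, comb (kummerCoeff t s) (tableParam t s i) j = 0 ↔
      j = (tablePair i).1 ∨ j = (tablePair i).2) :
    ∃ l : Fin 4 → Fin 6 → K, diagForm (comb (kummerCoeff t s) (tableParam t s i))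
      = linForm (l 0) * linForm (l 3) - linForm (l 1) * linForm (l 2) := by
  obtain ⟨hinj, hne, hq1, hq3⟩ := tableQuad_spec i
  have hone : ∀ j : Fin 6, j ≠ 0 → (kummerPoint j : K) ≠ 0 := by
    intro j hj
    fin_cases j <;> simp_all [kummerPoint]
  refine exists_split hinj ?_ ?_ (tableDisc_sq t s i)
    (sum_comb_mul_sq (kummerPoint_mem t s) (tableParam t s i)) (hone _ hq1) (hone _ hq3)
  · exact fun j hj => (h j).2 ((hne j).1 hj)
  · exact fun l hl => (hne _).2 ((h _).1 hl) l rfl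

end Split

/-! ### Rulings of the quadrics of rank four -/

/-- A decomposition `L₀ L₃ - L₁ L₂` of a member of rank four of a net of diagonal quadrics. The
variables `m` and `n` do not occur in it. The members of the net with parameters `νf`, `νg` express
the squares of the variables `m` and `n` through those of the other variables. -/
structure Ruling {k : Type*} [Field k] (N : Fin 3 → Fin 6 → k) where
  m : Fin 6
  n : Fin 6
  μ : Fin 3 → k
  νf : Fin 3 → k
  νg : Fin 3 → k
  L : Fin 4 → Fin 6 → k
  mds : IsMDS N
  hmn : m ≠ n
  hμ : ∀ j, comb N μ j = 0 ↔ j = m ∨ j = n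
  f_m : comb N νf m = 1
  f_n : comb N νf n = 0
  g_m : comb N νg m = 0
  g_n : comb N νg n = 1
  hq : ∀ x, (L 0 ⬝ᵥ x) * (L 3 ⬝ᵥ x) - (L 1 ⬝ᵥ x) * (L 2 ⬝ᵥ x) = ∑ j, comb N μ j * x j ^ 2

lemma exists_third (a b : Fin 6) : ∃ c, c ≠ a ∧ c ≠ b := by
  revert a b
  decide

namespace Ruling

variable {k : Type*} [Field k] {N : Fin 3 → Fin 6 → k} (R : Ruling N)

/-- The coefficients of the quadric. -/
def c (j : Fin 6) : k := comb N R.μ j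

/-- The coefficients of the member of the net which contains the square of the variable `m`, but
not that of `n`. -/
def f (j : Fin 6) : k := comb N R.νf j

/-- The same decomposition with `m` and `n` exchanged. -/
def swap : Ruling N where
  m := R.n
  n := R.m
  μ := R.μ
  νf := R.νg
  νg := R.νf
  L := R.L
  mds := R.mds
  hmn := R.hmn.symm
  hμ := fun j => (R.hμ j).trans or_comm
  f_m := R.g_n
  f_n := R.g_m
  g_m := R.f_n
  g_n := R.f_m
  hq := R.hq

/-- The decomposition with the two middle linear forms exchanged, which describes the other
ruling. -/
def other : Ruling N where
  m := R.m
  n := R.n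
  μ := R.μ
  νf := R.νf
  νg := R.νg
  L := ![R.L 0, R.L 2, R.L 1, R.L 3]
  mds := R.mds
  hmn := R.hmn
  hμ := R.hμ
  f_m := R.f_m
  f_n := R.f_n
  g_m := R.g_m
  g_n := R.g_n
  hq := fun x => by
    rw [← R.hq x]
    change (R.L 0 ⬝ᵥ x) * (R.L 3 ⬝ᵥ x) - (R.L 2 ⬝ᵥ x) * (R.L 1 ⬝ᵥ x) = _
    ring

lemma c_m : R.c R.m = 0 := (R.hμ _).2 (Or.inl rfl)

lemma c_n : R.c R.n = 0 := (R.hμ _).2 (Or.inr rfl)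

lemma c_ne_zero {j : Fin 6} (hm : j ≠ R.m) (hn : j ≠ R.n) : R.c j ≠ 0 := fun h =>
  ((R.hμ j).1 h).elim hm hn

/-- The polarization of the decomposition. -/
lemma polar (x y : Fin 6 → k) :
    (R.L 0 ⬝ᵥ x) * (R.L 3 ⬝ᵥ y) + (R.L 3 ⬝ᵥ x) * (R.L 0 ⬝ᵥ y) - (R.L 1 ⬝ᵥ x) * (R.L 2 ⬝ᵥ y)
      - (R.L 2 ⬝ᵥ x) * (R.L 1 ⬝ᵥ y) = 2 * ∑ j, R.c j * (x j * y j) := by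
  have h1 := R.hq (x + y)
  have h2 := R.hq x
  have h3 := R.hq y
  simp only [dotProduct_add] at h1
  have h4 : ∑ j, comb N R.μ j * (x + y) j ^ 2 = ∑ j, comb N R.μ j * x j ^ 2
      + ∑ j, comb N R.μ j * y j ^ 2 + 2 * ∑ j, R.c j * (x j * y j) := by
    rw [Finset.mul_sum, ← Finset.sum_add_distrib, ← Finset.sum_add_distrib]
    refine Finset.sum_congr rfl fun j _ => ?_
    simp only [Pi.add_apply, c]
    ring
  linear_combination h1 - h2 - h3 + h4

/-- A point where all the linear forms vanish lies on the vertex of the quadric. -/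
lemma eq_zero_of_forms_eq_zero (h2 : (2 : k) ≠ 0) {x : Fin 6 → k} (hx : ∀ i, R.L i ⬝ᵥ x = 0)
    {j : Fin 6} (hm : j ≠ R.m) (hn : j ≠ R.n) : x j = 0 := by
  have h := R.polar x (Pi.single j 1)
  simp only [hx, zero_mul, add_zero, sub_zero] at h
  rw [Finset.sum_eq_single j (fun i _ hi => by simp [hi]) (by simp)] at h
  simp only [Pi.single_eq_same, mul_one] at h
  have h3 := (mul_eq_zero.1 h.symm).resolve_left h2
  exact (mul_eq_zero.1 h3).resolve_left (R.c_ne_zero hm hn)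

lemma exists_forms_eq (h2 : (2 : k) ≠ 0) (p : Fin 4 → k) : ∃ x, ∀ i, R.L i ⬝ᵥ x = p i := by
  let F : (Fin 6 → k) →ₗ[k] Fin 4 → k := Matrix.mulVecLin (Matrix.of R.L)
  have hF : ∀ x i, F x i = R.L i ⬝ᵥ x := fun x i => rfl
  let E : LinearMap.ker F →ₗ[k] Fin 2 → k :=
    { toFun := fun x => ![x.1 R.m, x.1 R.n]
      map_add' := fun x y => by ext i; fin_cases i <;> simp
      map_smul' := fun r x => by ext i; fin_cases i <;> simp }
  have hE : Function.Injective E := by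
    rw [injective_iff_map_eq_zero]
    intro x hx
    ext j
    have hm : x.1 R.m = 0 := congrFun hx 0
    have hn : x.1 R.n = 0 := congrFun hx 1
    by_cases h1 : j = R.m
    · rw [h1, hm]; rfl
    by_cases h3 : j = R.n
    · rw [h3, hn]; rfl
    exact R.eq_zero_of_forms_eq_zero h2 (fun i => by
      rw [← hF, LinearMap.mem_ker.1 x.2]; rfl) h1 h3
  have h1 := LinearMap.finrank_le_finrank_of_injective hE
  have h3 := LinearMap.finrank_range_add_finrank_ker F
  rw [Module.finrank_fin_fun] at h1 h3
  have h4 : LinearMap.range F = ⊤ := by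
    refine Submodule.eq_top_of_finrank_eq (le_antisymm (Submodule.finrank_le _) ?_)
    rw [Module.finrank_fin_fun]
    omega
  obtain ⟨x, hx⟩ := LinearMap.range_eq_top.1 h4 p
  exact ⟨x, fun i => by rw [← hF, hx]⟩

/-- The variables `m` and `n` do not occur in the linear forms. -/
lemma L_apply_eq_zero (h2 : (2 : k) ≠ 0) {j : Fin 6} (hj : R.c j = 0) (i : Fin 4) :
    R.L i j = 0 := by
  have h : ∀ y, R.L 0 j * (R.L 3 ⬝ᵥ y) + R.L 3 j * (R.L 0 ⬝ᵥ y) - R.L 1 j * (R.L 2 ⬝ᵥ y)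
      - R.L 2 j * (R.L 1 ⬝ᵥ y) = 0 := by
    intro y
    have := R.polar (Pi.single j 1) y
    rw [Finset.sum_eq_single j (fun i _ hi => by simp [hi]) (by simp), hj] at this
    simpa using this
  have key : ∀ l : Fin 4, ∃ y, ∀ i, R.L i ⬝ᵥ y = if i = l then 1 else 0 := fun l =>
    R.exists_forms_eq h2 fun i => if i = l then 1 else 0
  obtain ⟨y0, e0⟩ := key 0
  obtain ⟨y1, e1⟩ := key 1
  obtain ⟨y2, e2⟩ := key 2
  obtain ⟨y3, e3⟩ := key 3
  have a0 := h y0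
  have a1 := h y1
  have a2 := h y2
  have a3 := h y3
  simp only [e0, e1, e2, e3] at a0 a1 a2 a3
  fin_cases i
  · simpa using a3
  · simpa using a2
  · simpa using a1
  · simpa using a0

/-- The values of the linear forms can be prescribed, and the coordinates `m` and `n` as well. -/
lemma exists_section (h2 : (2 : k) ≠ 0) (p : Fin 4 → k) :
    ∃ x : Fin 6 → k, (∀ i, R.L i ⬝ᵥ x = p i) ∧ x R.m = 0 ∧ x R.n = 0 := by
  obtain ⟨x, hx⟩ := R.exists_forms_eq h2 p
  refine ⟨x - Pi.single R.m (x R.m) - Pi.single R.n (x R.n), fun i => ?_, ?_, ?_⟩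
  · simp [dotProduct_sub, hx, R.L_apply_eq_zero h2 R.c_m, R.L_apply_eq_zero h2 R.c_n]
  · simp [R.hmn]
  · simp [R.hmn.symm]

/-- The members of the net in which the variables `m` and `n` do not occur are the multiples of the
given one. -/
lemma eq_smul_of_comb_eq_zero {ν : Fin 3 → k} (hm : comb N ν R.m = 0) (hn : comb N ν R.n = 0) :
    ∃ r : k, ν = r • R.μ := by
  obtain ⟨i, him, hin⟩ := exists_third R.m R.n
  have hc := R.c_ne_zero him hin
  refine ⟨comb N ν i / R.c i, R.mds.eq_of_comb_eq R.hmn him.symm hin.symm ?_ ?_ ?_⟩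
  · rw [comb_smul, hm, (R.hμ _).2 (Or.inl rfl), mul_zero]
  · rw [comb_smul, hn, (R.hμ _).2 (Or.inr rfl), mul_zero]
  · rw [comb_smul]
    change _ = comb N ν i / R.c i * R.c i
    rw [div_mul_cancel₀ _ hc]

lemma mem_baseCone_iff {x : Fin 6 → k} : x ∈ baseCone N ↔
    ∑ j, R.c j * x j ^ 2 = 0 ∧ ∑ j, R.f j * x j ^ 2 = 0 ∧ ∑ j, R.swap.f j * x j ^ 2 = 0 := by
  refine ⟨fun h => ⟨sum_comb_mul_sq h _, sum_comb_mul_sq h _, sum_comb_mul_sq h _⟩, ?_⟩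
  rintro ⟨h1, h3, h4⟩ r
  let ν : Fin 3 → k := Pi.single r 1
  have hν : ∀ j, comb N ν j = N r j := fun j => by simp [comb, ν, Pi.single_apply]
  obtain ⟨a, ha⟩ := R.eq_smul_of_comb_eq_zero
    (ν := ν - comb N ν R.m • R.νf - comb N ν R.n • R.νg)
    (by simp [comb_sub, comb_smul, R.f_m, R.g_m]) (by simp [comb_sub, comb_smul, R.f_n, R.g_n])
  have hj : ∀ j, N r j = a * R.c j + N r R.m * R.f j + N r R.n * R.swap.f j := by
    intro j
    have := congrArg (fun ν => comb N ν j) ha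
    simp only [comb_sub, comb_smul, hν] at this
    simp only [c, f, swap]
    linear_combination this
  have : ∀ j, N r j * x j ^ 2 = a * (R.c j * x j ^ 2) + N r R.m * (R.f j * x j ^ 2)
      + N r R.n * (R.swap.f j * x j ^ 2) := by
    intro j
    rw [hj j]
    ring
  simp only [this, Finset.sum_add_distrib, ← Finset.mul_sum, h1, h3, h4, mul_zero, add_zero]

/-- The base locus does not meet the vertex of the quadric. -/
lemma exists_form_ne_zero (h2 : (2 : k) ≠ 0) {x : Fin 6 → k} (hx : x ∈ baseCone N) (hx0 : x ≠ 0) :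
    ∃ i, R.L i ⬝ᵥ x ≠ 0 := by
  by_contra! h
  obtain ⟨-, hf, hg⟩ := R.mem_baseCone_iff.1 hx
  have hzero : ∀ j, j ≠ R.m → j ≠ R.n → x j = 0 := fun j hm hn =>
    R.eq_zero_of_forms_eq_zero h2 h hm hn
  have hm : x R.m = 0 := by
    rw [Finset.sum_eq_single R.m] at hf
    · rw [f, R.f_m, one_mul] at hf
      exact pow_eq_zero_iff two_ne_zero |>.1 hf
    · intro j _ hj
      by_cases hn : j = R.n
      · rw [hn, f, R.f_n, zero_mul]
      · rw [hzero j hj hn]; ring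
    · simp
  have hn : x R.n = 0 := by
    rw [Finset.sum_eq_single R.n] at hg
    · rw [f, show comb N R.swap.νf R.n = 1 from R.g_n, one_mul] at hg
      exact pow_eq_zero_iff two_ne_zero |>.1 hg
    · intro j _ hj
      by_cases hm' : j = R.m
      · rw [hm', hm]; ring
      · rw [hzero j hm' hj]; ring
    · simp
  apply hx0
  funext j
  by_cases h1 : j = R.m
  · rw [h1, hm]; rfl
  by_cases h3 : j = R.n
  · rw [h3, hn]; rfl
  exact hzero j h1 h3

end Ruling

/-! ### The fibres of a ruling -/

namespace Ruling

variable {k : Type*} [Field k] {N : Fin 3 → Fin 6 → k} (R : Ruling N)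

/-- Vectors dual to the linear forms. -/
def dualVec (h2 : (2 : k) ≠ 0) (l : Fin 4) : Fin 6 → k :=
  (R.exists_section h2 fun i => if i = l then 1 else 0).choose

lemma dotProduct_dualVec (h2 : (2 : k) ≠ 0) (i l : Fin 4) :
    R.L i ⬝ᵥ R.dualVec h2 l = if i = l then 1 else 0 :=
  (R.exists_section h2 fun i => if i = l then 1 else 0).choose_spec.1 i

lemma dualVec_m (h2 : (2 : k) ≠ 0) (l : Fin 4) : R.dualVec h2 l R.m = 0 :=
  (R.exists_section h2 fun i => if i = l then 1 else 0).choose_spec.2.1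

lemma dualVec_n (h2 : (2 : k) ≠ 0) (l : Fin 4) : R.dualVec h2 l R.n = 0 :=
  (R.exists_section h2 fun i => if i = l then 1 else 0).choose_spec.2.2

/-- The vectors spanning a line of the ruling in the space where the coordinates `m` and `n`
vanish. -/
def lineVec (h2 : (2 : k) ≠ 0) (p : Fin 2 → k) : Fin 2 → Fin 6 → k :=
  ![p 0 • R.dualVec h2 0 + p 1 • R.dualVec h2 1, p 0 • R.dualVec h2 2 + p 1 • R.dualVec h2 3]

lemma lineVec_m (h2 : (2 : k) ≠ 0) (p : Fin 2 → k) (a : Fin 2) : R.lineVec h2 p a R.m = 0 := by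
  fin_cases a <;> simp [lineVec, dualVec_m]

lemma lineVec_n (h2 : (2 : k) ≠ 0) (p : Fin 2 → k) (a : Fin 2) : R.lineVec h2 p a R.n = 0 := by
  fin_cases a <;> simp [lineVec, dualVec_n]

lemma dotProduct_lineVec_zero (h2 : (2 : k) ≠ 0) (p : Fin 2 → k) :
    R.L 0 ⬝ᵥ R.lineVec h2 p 0 = p 0 ∧ R.L 1 ⬝ᵥ R.lineVec h2 p 0 = p 1 ∧
      R.L 2 ⬝ᵥ R.lineVec h2 p 0 = 0 ∧ R.L 3 ⬝ᵥ R.lineVec h2 p 0 = 0 := by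
  simp [lineVec, dotProduct_add, dotProduct_dualVec]

lemma dotProduct_lineVec_one (h2 : (2 : k) ≠ 0) (p : Fin 2 → k) :
    R.L 0 ⬝ᵥ R.lineVec h2 p 1 = 0 ∧ R.L 1 ⬝ᵥ R.lineVec h2 p 1 = 0 ∧
      R.L 2 ⬝ᵥ R.lineVec h2 p 1 = p 0 ∧ R.L 3 ⬝ᵥ R.lineVec h2 p 1 = p 1 := by
  simp [lineVec, dotProduct_add, dotProduct_dualVec]

/-- The restriction of a diagonal quadratic form to a line of the ruling, up to sign. -/
def squareForm (h2 : (2 : k) ≠ 0) (p : Fin 2 → k) (e : Fin 6 → k) : MvPolynomial (Fin 2) k :=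
  -∑ j, C (e j) * (linForm fun a => R.lineVec h2 p a j) ^ 2

lemma squareForm_isHomogeneous (h2 : (2 : k) ≠ 0) (p : Fin 2 → k) (e : Fin 6 → k) :
    (R.squareForm h2 p e).IsHomogeneous 2 :=
  (IsHomogeneous.sum _ _ _ fun _ _ => ((linForm_isHomogeneous _).pow 2).C_mul _).neg

lemma aeval_squareForm (h2 : (2 : k) ≠ 0) (p w : Fin 2 → k) (e : Fin 6 → k) :
    aeval w (R.squareForm h2 p e)
      = -∑ j, e j * (w 0 * R.lineVec h2 p 0 j + w 1 * R.lineVec h2 p 1 j) ^ 2 := by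
  simp only [squareForm, map_neg, map_sum, map_mul, map_pow, aeval_C, aeval_linForm,
    Fin.sum_univ_two, Algebra.algebraMap_self, RingHom.id_apply]
  simp only [mul_comm (w _)]

/-- The fibre of a ruling over the point `p`, as a double cover of the line where `L₁ : L₀` and
`L₃ : L₂` are `p₁ : p₀`. The vector `r` serves to write the coordinates on this line as linear
forms. -/
def cover (h2 : (2 : k) ≠ 0) (p r : Fin 2 → k) (hr : r 0 * p 0 + r 1 * p 1 = 1) :
    DoubleCover k 6 where
  φ := R.lineVec h2 p
  ψ := ![r 0 • R.L 0 + r 1 • R.L 1, r 0 • R.L 2 + r 1 • R.L 3]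
  i := R.m
  j := R.n
  f := R.squareForm h2 p R.f
  g := R.squareForm h2 p R.swap.f
  ne := R.hmn
  hf := R.squareForm_isHomogeneous h2 p _
  hg := R.squareForm_isHomogeneous h2 p _
  dual := fun a b => by
    obtain ⟨a0, a1, a2, a3⟩ := R.dotProduct_lineVec_zero h2 p
    obtain ⟨b0, b1, b2, b3⟩ := R.dotProduct_lineVec_one h2 p
    change _ ⬝ᵥ R.lineVec h2 p b = _
    fin_cases a <;> fin_cases b <;> simp [add_dotProduct, a0, a1, a2, a3, b0, b1, b2, b3, hr]
  ψ_i := fun a => by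
    fin_cases a <;> simp [R.L_apply_eq_zero h2 R.c_m]
  ψ_j := fun a => by
    fin_cases a <;> simp [R.L_apply_eq_zero h2 R.c_n]
  φ_i := R.lineVec_m h2 p
  φ_j := R.lineVec_n h2 p

lemma cover_point (h2 : (2 : k) ≠ 0) (p r : Fin 2 → k) (hr : r 0 * p 0 + r 1 * p 1 = 1)
    (w : Fin 2 → k) (X Y : k) : (R.cover h2 p r hr).point w X Y = w 0 • R.lineVec h2 p 0
      + w 1 • R.lineVec h2 p 1 + Pi.single R.m X + Pi.single R.n Y := by
  funext l
  simp only [DoubleCover.point, cover, Pi.add_apply, Pi.smul_apply, smul_eq_mul, Pi.single_apply]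
  rfl

lemma L_dotProduct_cover_point (h2 : (2 : k) ≠ 0) (p r : Fin 2 → k)
    (hr : r 0 * p 0 + r 1 * p 1 = 1) (w : Fin 2 → k) (X Y : k) (i : Fin 4) :
    R.L i ⬝ᵥ (R.cover h2 p r hr).point w X Y
      = ![w 0 * p 0, w 0 * p 1, w 1 * p 0, w 1 * p 1] i := by
  obtain ⟨a0, a1, a2, a3⟩ := R.dotProduct_lineVec_zero h2 p
  obtain ⟨b0, b1, b2, b3⟩ := R.dotProduct_lineVec_one h2 p
  rw [cover_point]
  simp only [dotProduct_add, dotProduct_smul, dotProduct_single, R.L_apply_eq_zero h2 R.c_m,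
    R.L_apply_eq_zero h2 R.c_n]
  fin_cases i <;> simp [a0, a1, a2, a3, b0, b1, b2, b3]

lemma sum_cover_point (h2 : (2 : k) ≠ 0) (p r : Fin 2 → k) (hr : r 0 * p 0 + r 1 * p 1 = 1)
    (w : Fin 2 → k) (X Y : k) (e : Fin 6 → k) :
    ∑ j, e j * (R.cover h2 p r hr).point w X Y j ^ 2
      = e R.m * X ^ 2 + e R.n * Y ^ 2 - aeval w (R.squareForm h2 p e) := by
  have hj : ∀ j, e j * (R.cover h2 p r hr).point w X Y j ^ 2
      = (if j = R.m then e j * X ^ 2 else 0) + (if j = R.n then e j * Y ^ 2 else 0)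
        + e j * (w 0 * R.lineVec h2 p 0 j + w 1 * R.lineVec h2 p 1 j) ^ 2 := by
    intro j
    rw [cover_point]
    by_cases hm : j = R.m
    · simp [hm, R.hmn, lineVec_m]
    by_cases hn : j = R.n
    · simp [hn, R.hmn.symm, lineVec_n]
    · simp [hm, hn]
  rw [aeval_squareForm, sub_neg_eq_add]
  simp only [hj, Finset.sum_add_distrib, Finset.sum_ite_eq', Finset.mem_univ, if_true]

/-- The cone over the fibre of a ruling is the cone over the double cover. -/
lemma mem_cone_cover_iff (h2 : (2 : k) ≠ 0) (p r : Fin 2 → k) (hr : r 0 * p 0 + r 1 * p 1 = 1)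
    (x : Fin 6 → k) : x ∈ (R.cover h2 p r hr).cone ↔ x ∈ baseCone N ∧
      p 0 * (R.L 1 ⬝ᵥ x) = p 1 * (R.L 0 ⬝ᵥ x) ∧ p 0 * (R.L 3 ⬝ᵥ x) = p 1 * (R.L 2 ⬝ᵥ x) := by
  constructor
  · rintro ⟨w, X, Y, ⟨hX, hY⟩, rfl⟩
    have hL := R.L_dotProduct_cover_point h2 p r hr w X Y
    have l0 := hL 0
    have l1 := hL 1
    have l2 := hL 2
    have l3 := hL 3
    simp only [Matrix.cons_val] at l0 l1 l2 l3
    refine ⟨R.mem_baseCone_iff.2 ⟨?_, ?_, ?_⟩, ?_, ?_⟩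
    · change ∑ j, comb N R.μ j * _ = 0
      rw [← R.hq, l0, l1, l2, l3]
      ring
    · rw [sum_cover_point, show R.f R.m = 1 from R.f_m, show R.f R.n = 0 from R.f_n, hX]
      change 1 * aeval w (R.squareForm h2 p R.f) + _ - _ = 0
      ring
    · rw [sum_cover_point, show R.swap.f R.m = 0 from R.g_m, show R.swap.f R.n = 1 from R.g_n, hY]
      change _ + 1 * aeval w (R.squareForm h2 p R.swap.f) - _ = 0
      ring
    · rw [l0, l1]; ring
    · rw [l2, l3]; ring
  · rintro ⟨hx, e1, e2⟩
    let w : Fin 2 → k := ![r 0 * (R.L 0 ⬝ᵥ x) + r 1 * (R.L 1 ⬝ᵥ x),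
      r 0 * (R.L 2 ⬝ᵥ x) + r 1 * (R.L 3 ⬝ᵥ x)]
    have hpt : x = (R.cover h2 p r hr).point w (x R.m) (x R.n) := by
      have hL : ∀ i, R.L i ⬝ᵥ (x - (R.cover h2 p r hr).point w (x R.m) (x R.n)) = 0 := by
        intro i
        rw [dotProduct_sub, L_dotProduct_cover_point, sub_eq_zero]
        fin_cases i
        · change R.L 0 ⬝ᵥ x = (r 0 * (R.L 0 ⬝ᵥ x) + r 1 * (R.L 1 ⬝ᵥ x)) * p 0
          linear_combination -(R.L 0 ⬝ᵥ x) * hr - r 1 * e1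
        · change R.L 1 ⬝ᵥ x = (r 0 * (R.L 0 ⬝ᵥ x) + r 1 * (R.L 1 ⬝ᵥ x)) * p 1
          linear_combination -(R.L 1 ⬝ᵥ x) * hr + r 0 * e1
        · change R.L 2 ⬝ᵥ x = (r 0 * (R.L 2 ⬝ᵥ x) + r 1 * (R.L 3 ⬝ᵥ x)) * p 0
          linear_combination -(R.L 2 ⬝ᵥ x) * hr - r 1 * e2
        · change R.L 3 ⬝ᵥ x = (r 0 * (R.L 2 ⬝ᵥ x) + r 1 * (R.L 3 ⬝ᵥ x)) * p 1
          linear_combination -(R.L 3 ⬝ᵥ x) * hr + r 0 * e2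
      funext j
      by_cases hm : j = R.m
      · rw [hm]; exact ((R.cover h2 p r hr).point_i _ _ _).symm
      by_cases hn : j = R.n
      · rw [hn]; exact ((R.cover h2 p r hr).point_j _ _ _).symm
      exact sub_eq_zero.1 (R.eq_zero_of_forms_eq_zero h2 hL hm hn)
    obtain ⟨-, hf, hg⟩ := R.mem_baseCone_iff.1 hx
    rw [hpt] at hf hg
    rw [sum_cover_point, show R.f R.m = 1 from R.f_m, show R.f R.n = 0 from R.f_n] at hf
    rw [sum_cover_point, show R.swap.f R.m = 0 from R.g_m, show R.swap.f R.n = 1 from R.g_n] at hg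
    refine ⟨w, x R.m, x R.n, ⟨?_, ?_⟩, hpt⟩
    · change _ = aeval w (R.squareForm h2 p R.f)
      linear_combination hf
    · change _ = aeval w (R.squareForm h2 p R.swap.f)
      linear_combination hg

/-! ### The finitely many degenerate points -/

/-- Points of projective space for which the squares of the coordinates satisfy linear equations
with a one-dimensional space of solutions: there are finitely many of them, which differ by the
signs of the coordinates. -/
lemma finite_of_squares_mem {n : ℕ} (Y : Submodule k (Fin n → k)) (i : Fin n)
    (hY : ∀ y ∈ Y, y i = 0 → y = 0) :
    {x : ℙ k (Fin n → k) | (fun j => x.rep j ^ 2) ∈ Y}.Finite := by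
  rcases Set.eq_empty_or_nonempty {x : ℙ k (Fin n → k) | (fun j => x.rep j ^ 2) ∈ Y} with h | ⟨z, hz⟩
  · rw [h]; exact Set.finite_empty
  have hne : ∀ x : ℙ k (Fin n → k), (fun j => x.rep j ^ 2) ∈ Y → x.rep i ≠ 0 := by
    intro x hx h0
    have := hY _ hx (by simp [h0])
    apply x.rep_nonzero
    funext j
    exact pow_eq_zero_iff two_ne_zero |>.1 (congrFun this j)
  have hsq : ∀ x : ℙ k (Fin n → k), (fun j => x.rep j ^ 2) ∈ Y → ∀ j,
      x.rep j * z.rep i = x.rep i * z.rep j ∨ x.rep j * z.rep i = -(x.rep i * z.rep j) := by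
    intro x hx j
    have h1 := Y.sub_mem (Y.smul_mem (z.rep i ^ 2) hx) (Y.smul_mem (x.rep i ^ 2) hz)
    have h2 := congrFun (hY _ h1 (by simp; ring)) j
    apply sq_eq_sq_iff_eq_or_eq_neg.1
    simp only [Pi.sub_apply, Pi.smul_apply, smul_eq_mul, Pi.zero_apply] at h2
    linear_combination h2
  refine Set.Finite.of_injOn (f := fun x : ℙ k (Fin n → k) =>
    {j | x.rep j * z.rep i = x.rep i * z.rep j}) (Set.mapsTo_univ _ _) ?_ Set.finite_univ
  intro x hx y hy hxy
  have hxi := hne x hx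
  have hyi := hne y hy
  have hzi := hne z hz
  rw [← x.mk_rep, ← y.mk_rep, Projectivization.mk_eq_mk_iff']
  refine ⟨x.rep i / y.rep i, ?_⟩
  funext j
  have hj : x.rep j * z.rep i = x.rep i * z.rep j ↔ y.rep j * z.rep i = y.rep i * z.rep j :=
    Set.ext_iff.1 hxy j
  simp only [Pi.smul_apply, smul_eq_mul]
  rw [div_mul_eq_mul_div, div_eq_iff hyi]
  apply mul_right_cancel₀ hzi
  by_cases h : x.rep j * z.rep i = x.rep i * z.rep j
  · linear_combination x.rep i * hj.1 h - y.rep i * h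
  · linear_combination x.rep i * (hsq y hy j).resolve_left (fun h' => h (hj.2 h'))
      - y.rep i * (hsq x hx j).resolve_left h

/-- The conditions on the squares of the coordinates of a point `x` of the base locus such that
`x_m = 0` and the vector of the `f_j x_j` is isotropic for the quadratic form dual to the quadric.
The dual form has no terms in the variables `m` and `n`, in accordance with `0⁻¹ = 0`. -/
def tangency : Submodule k (Fin 6 → k) where
  carrier := {y | y ∈ relations N ∧ y R.m = 0 ∧ ∑ j, R.f j ^ 2 * (R.c j)⁻¹ * y j = 0}
  add_mem' := by
    rintro x y ⟨h1, h2, h3⟩ ⟨h1', h2', h3'⟩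
    refine ⟨add_mem h1 h1', by simp [h2, h2'], ?_⟩
    simp only [Pi.add_apply, mul_add, Finset.sum_add_distrib, h3, h3', add_zero]
  zero_mem' := by simp
  smul_mem' := by
    rintro a x ⟨h1, h2, h3⟩
    refine ⟨Submodule.smul_mem _ a h1, by simp [h2], ?_⟩
    have : ∀ j, R.f j ^ 2 * (R.c j)⁻¹ * (a • x) j = a * (R.f j ^ 2 * (R.c j)⁻¹ * x j) := fun j => by
      simp only [Pi.smul_apply, smul_eq_mul]; ring
    simp only [this, ← Finset.mul_sum, h3, mul_zero]

/-- The three sums `∑ c_j y_j`, `∑ f_j y_j`, `∑ f_j² / c_j y_j` form a Vandermonde system in the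
ratios `f_j / c_j`, which are different. -/
lemma tangency_eq_zero {y : Fin 6 → k} (hy : y ∈ R.tangency) {i : Fin 6} (him : i ≠ R.m)
    (hin : i ≠ R.n) (hi : y i = 0) : y = 0 := by
  obtain ⟨hrel, hm, hsum⟩ := hy
  obtain ⟨j, hj⟩ : ∃ j, j ∉ ({i, R.m, R.n} : Finset (Fin 6)) := by
    by_contra! h
    have h1 := Finset.card_le_card
      (fun x _ => h x : Finset.univ ⊆ ({i, R.m, R.n} : Finset (Fin 6)))
    have h3 := Finset.card_le_three (a := i) (b := R.m) (c := R.n)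
    simp only [Finset.card_univ, Fintype.card_fin] at h1
    omega
  simp only [Finset.mem_insert, Finset.mem_singleton, not_or] at hj
  obtain ⟨hji, hjm, hjn⟩ := hj
  obtain ⟨a, b, hab, hai, ham, han, haj, hbi, hbm, hbn, hbj, hall⟩ :=
    exists_two_others him hin (Ne.symm hji) R.hmn (Ne.symm hjm) (Ne.symm hjn)
  refine R.mds.relation_eq_zero hrel him (Ne.symm hji) (Ne.symm hjm) hi hm ?_
  have hca := R.c_ne_zero ham han
  have hcb := R.c_ne_zero hbm hbn
  have hcj := R.c_ne_zero hjm hjn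
  have hf := sum_comb_mul hrel R.νf
  have hc := sum_comb_mul hrel R.μ
  set x := R.f a / R.c a with hx
  set z := R.f b / R.c b with hz
  have key : ∑ l, (R.f l - x * R.c l) * (R.f l - z * R.c l) * (R.c l)⁻¹ * y l = 0 := by
    have : ∀ l, (R.f l - x * R.c l) * (R.f l - z * R.c l) * (R.c l)⁻¹ * y l
        = R.f l ^ 2 * (R.c l)⁻¹ * y l - (x + z) * (comb N R.νf l * y l)
          + x * z * (comb N R.μ l * y l) := by
      intro l
      change _ = R.f l ^ 2 * (R.c l)⁻¹ * y l - (x + z) * (R.f l * y l) + x * z * (R.c l * y l)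
      by_cases hlm : l = R.m
      · rw [hlm, hm]; ring
      by_cases hln : l = R.n
      · rw [hln, R.c_n, show R.f R.n = 0 from R.f_n]; ring
      have := R.c_ne_zero hlm hln
      field_simp
      ring
    simp only [this, Finset.sum_add_distrib, Finset.sum_sub_distrib, ← Finset.mul_sum, hsum, hf,
      hc]
    ring
  rw [Finset.sum_eq_single j] at key
  · have hd : ∀ l, l ≠ R.m → l ≠ R.n → l ≠ j → R.f j - R.f l / R.c l * R.c j ≠ 0 := by
      intro l hlm hln hlj h
      have hcl := R.c_ne_zero hlm hln
      have h0 := R.mds (R.νf - (R.f l / R.c l) • R.μ) R.n j l (Ne.symm hjn) (Ne.symm hln)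
        (Ne.symm hlj)
        (by rw [comb_sub, comb_smul, R.f_n, (R.hμ _).2 (Or.inr rfl)]; ring)
        (by rw [comb_sub, comb_smul]; exact h)
        (by
          rw [comb_sub, comb_smul]
          change R.f l - R.f l / R.c l * R.c l = 0
          rw [div_mul_cancel₀ _ hcl, sub_self])
      have h1 : comb N (R.νf - (R.f l / R.c l) • R.μ) R.m = 1 := by
        rw [comb_sub, comb_smul, R.f_m, (R.hμ _).2 (Or.inl rfl)]; ring
      rw [h0] at h1
      simp [comb] at h1
    have hda := hd a ham han haj
    have hdb := hd b hbm hbn hbj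
    exact (mul_eq_zero.1 key).resolve_left
      (mul_ne_zero (mul_ne_zero hda hdb) (inv_ne_zero hcj))
  · intro l _ hlj
    rcases hall l with rfl | rfl | rfl | rfl | rfl | rfl
    · rw [hi, mul_zero]
    · rw [hm, mul_zero]
    · rw [R.c_n, inv_zero]; ring
    · exact (hlj rfl).elim
    · rw [hx, div_mul_cancel₀ _ hca, sub_self]; ring
    · rw [hz, div_mul_cancel₀ _ hcb, sub_self]; ring
  · simp

lemma finite_tangency : {x : ℙ k (Fin 6 → k) | (fun j => x.rep j ^ 2) ∈ R.tangency}.Finite := by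
  obtain ⟨i, him, hin⟩ := exists_third R.m R.n
  exact finite_of_squares_mem _ i fun y hy hi => R.tangency_eq_zero hy him hin hi

lemma finite_branch : {x : ℙ k (Fin 6 → k) | x.rep ∈ baseCone N ∧ x.rep R.m = 0 ∧
    x.rep R.n = 0}.Finite := by
  obtain ⟨i, him, hin⟩ := exists_third R.m R.n
  refine (finite_of_squares_mem (relations N ⊓ LinearMap.ker (LinearMap.proj R.m) ⊓
    LinearMap.ker (LinearMap.proj R.n)) i fun y hy hi => ?_).subset ?_
  · exact R.mds.relation_eq_zero hy.1.1 R.hmn him.symm hin.symm hy.1.2 hy.2 hi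
  · rintro x ⟨h1, h3, h4⟩
    exact ⟨⟨mem_baseCone.1 h1, by simp [h3]⟩, by simp [h4]⟩

end Ruling

/-! ### Rulings define elliptic fibrations -/

namespace Ruling

variable {k : Type*} [Field k] {N : Fin 3 → Fin 6 → k} (R : Ruling N)

/-- The linear forms, expressed through the dual vectors and the Gram matrix of the quadric. -/
lemma L_apply (h2 : (2 : k) ≠ 0) (j : Fin 6) :
    R.L 0 j = 2 * R.c j * R.dualVec h2 3 j ∧ R.L 1 j = -(2 * R.c j * R.dualVec h2 2 j) ∧
      R.L 2 j = -(2 * R.c j * R.dualVec h2 1 j) ∧ R.L 3 j = 2 * R.c j * R.dualVec h2 0 j := by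
  have h : ∀ l, R.L 0 j * (R.L 3 ⬝ᵥ R.dualVec h2 l) + R.L 3 j * (R.L 0 ⬝ᵥ R.dualVec h2 l)
      - R.L 1 j * (R.L 2 ⬝ᵥ R.dualVec h2 l) - R.L 2 j * (R.L 1 ⬝ᵥ R.dualVec h2 l)
      = 2 * (R.c j * R.dualVec h2 l j) := by
    intro l
    have := R.polar (Pi.single j 1) (R.dualVec h2 l)
    rw [Finset.sum_eq_single j (fun i _ hi => by simp [hi]) (by simp)] at this
    simpa using this
  have h0 := h 0
  have h1 := h 1
  have h3 := h 2
  have h4 := h 3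
  simp [dotProduct_dualVec] at h0 h1 h3 h4
  refine ⟨?_, ?_, ?_, ?_⟩
  · linear_combination h4
  · linear_combination -h3
  · linear_combination -h1
  · linear_combination h0

/-- If a gradient `(2 c_j ρ_j)` of the quadric, at a point `ρ` of the quadric, is up to a factor two
the gradient at `x` of a member of the net with a term in `x_m²`, but none in `x_n²`, then `x`
satisfies the conditions of tangency. -/
lemma mem_tangency (x ρ : Fin 6 → k) (hx : x ∈ baseCone N) (hρ : ∑ j, R.c j * ρ j ^ 2 = 0)
    {ν : Fin 3 → k} (hν : ∀ j, comb N ν j * x j = 2 * R.c j * ρ j) (hm : comb N ν R.m ≠ 0)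
    (hn : comb N ν R.n = 0) : (fun j => x j ^ 2) ∈ R.tangency := by
  have hxm : x R.m = 0 := by
    have := hν R.m
    rw [R.c_m, mul_zero, zero_mul] at this
    exact (mul_eq_zero.1 this).resolve_left hm
  refine ⟨mem_baseCone.1 hx, by simp [hxm], ?_⟩
  obtain ⟨a, ha⟩ := R.eq_smul_of_comb_eq_zero (ν := ν - comb N ν R.m • R.νf)
    (by simp [comb_sub, comb_smul, R.f_m]) (by simp [comb_sub, comb_smul, R.f_n, hn])
  set ε := comb N ν R.m
  have he : ∀ j, comb N ν j = ε * R.f j + a * R.c j := by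
    intro j
    have := congrArg (fun ν => comb N ν j) ha
    simp only [comb_sub, comb_smul] at this
    simp only [c, f]
    linear_combination this
  have key : ∀ j, ε ^ 2 * (R.f j ^ 2 * (R.c j)⁻¹ * x j ^ 2) = 4 * (R.c j * ρ j ^ 2)
      - 2 * a * (comb N ν j * x j ^ 2) + a ^ 2 * (comb N R.μ j * x j ^ 2) := by
    intro j
    change _ = _ + a ^ 2 * (R.c j * x j ^ 2)
    by_cases hjm : j = R.m
    · rw [hjm, hxm, R.c_m]; ring
    by_cases hjn : j = R.n
    · rw [hjn, hn, R.c_n, show R.f R.n = 0 from R.f_n]; ring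
    have hc := R.c_ne_zero hjm hjn
    have h1 := hν j
    rw [he j] at h1 ⊢
    field_simp
    linear_combination ((ε * R.f j + a * R.c j) * x j + 2 * R.c j * ρ j) * h1
  have hsum : ε ^ 2 * ∑ j, R.f j ^ 2 * (R.c j)⁻¹ * x j ^ 2 = 0 := by
    rw [Finset.mul_sum]
    simp only [key, Finset.sum_add_distrib, Finset.sum_sub_distrib, ← Finset.mul_sum, hρ,
      sum_comb_mul_sq hx]
    ring
  exact (mul_eq_zero.1 hsum).resolve_left (pow_ne_zero 2 hm)

/-- The conditions on the points of the base locus where a ruling may fail to be smooth. -/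
def IsDegenerate (x : Fin 6 → k) : Prop :=
  (x R.m = 0 ∧ x R.n = 0) ∨ (fun j => x j ^ 2) ∈ R.tangency ∨
    (fun j => x j ^ 2) ∈ R.swap.tangency

/-- The three kinds of degenerate points correspond to the position of the variables `m` and `n` in
the member `ν` of the net whose gradient at `x` is a gradient of the quadric. If neither of them
occurs in it, this member is a multiple of the quadric, which is excluded by assumption. -/
lemma isDegenerate_of_comb (x ρ : Fin 6 → k) (hx : x ∈ baseCone N)
    (hρ : ∑ j, R.c j * ρ j ^ 2 = 0) {ν : Fin 3 → k}
    (hν : ∀ j, comb N ν j * x j = 2 * R.c j * ρ j)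
    (hne : ∀ a : k, ¬ ∀ j, j ≠ R.m → j ≠ R.n → a * x j = 2 * ρ j) : R.IsDegenerate x := by
  have hm := hν R.m
  have hn := hν R.n
  rw [R.c_m, mul_zero, zero_mul, mul_eq_zero] at hm
  rw [R.c_n, mul_zero, zero_mul, mul_eq_zero] at hn
  by_cases em : comb N ν R.m = 0
  · by_cases en : comb N ν R.n = 0
    · obtain ⟨a, rfl⟩ := R.eq_smul_of_comb_eq_zero em en
      refine (hne a fun j hjm hjn => mul_left_cancel₀ (R.c_ne_zero hjm hjn) ?_).elim
      have := hν j
      rw [comb_smul] at this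
      change a * R.c j * x j = _ at this
      linear_combination this
    · exact Or.inr (Or.inr (R.swap.mem_tangency x ρ hx hρ hν en em))
  · by_cases en : comb N ν R.n = 0
    · exact Or.inr (Or.inl (R.mem_tangency x ρ hx hρ hν em en))
    · exact Or.inl ⟨hm.resolve_left em, hn.resolve_left en⟩

/-- If the differential of `[L₀ : L₁]` or `[L₂ : L₃]` on the base locus is zero at a point where it
is defined, the point is degenerate. -/
lemma isDegenerate_of_differential_eq_zero (h2 : (2 : k) ≠ 0) {x : Fin 6 → k}
    (hx : x ∈ baseCone N) {i i' : Fin 4} (hi : i = 0 ∧ i' = 1 ∨ i = 2 ∧ i' = 3)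
    (hne : R.L i ⬝ᵥ x ≠ 0 ∨ R.L i' ⬝ᵥ x ≠ 0) {ν : Fin 3 → k}
    (hν : ∀ j, comb N ν j * x j = (R.L i ⬝ᵥ x) * R.L i' j - (R.L i' ⬝ᵥ x) * R.L i j) :
    R.IsDegenerate x := by
  have hd := R.dotProduct_dualVec h2
  rcases hi with ⟨rfl, rfl⟩ | ⟨rfl, rfl⟩
  · set α := R.L 0 ⬝ᵥ x with hα
    set β := R.L 1 ⬝ᵥ x with hβ
    let ρ : Fin 6 → k := -(α • R.dualVec h2 2) - β • R.dualVec h2 3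
    have r0 : R.L 0 ⬝ᵥ ρ = 0 := by simp [ρ, dotProduct_sub, hd]
    have r1 : R.L 1 ⬝ᵥ ρ = 0 := by simp [ρ, dotProduct_sub, hd]
    have r2 : R.L 2 ⬝ᵥ ρ = -α := by simp [ρ, dotProduct_sub, hd]
    have r3 : R.L 3 ⬝ᵥ ρ = -β := by simp [ρ, dotProduct_sub, hd]
    refine R.isDegenerate_of_comb x ρ hx ?_ (ν := ν) ?_ ?_
    · change ∑ j, comb N R.μ j * _ = 0
      rw [← R.hq, r0, r1]
      ring
    · intro j
      obtain ⟨a0, a1, -, -⟩ := R.L_apply h2 j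
      rw [hν, a0, a1]
      simp only [ρ, Pi.sub_apply, Pi.neg_apply, Pi.smul_apply, smul_eq_mul]
      ring
    · intro a h
      have hL : ∀ l, a * (R.L l ⬝ᵥ x) = 2 * (R.L l ⬝ᵥ ρ) := by
        intro l
        simp only [dotProduct, Finset.mul_sum]
        refine Finset.sum_congr rfl fun j _ => ?_
        by_cases hj : R.c j = 0
        · rw [R.L_apply_eq_zero h2 hj]; ring
        · have h1 := h j (fun e => hj (e ▸ R.c_m)) (fun e => hj (e ▸ R.c_n))
          linear_combination R.L l j * h1
      have e0 := hL 0
      have e1 := hL 1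
      have e2 := hL 2
      have e3 := hL 3
      rw [r0, mul_zero, mul_eq_zero] at e0
      rw [r1, mul_zero, mul_eq_zero] at e1
      have ha : a = 0 := by
        rcases hne with hne | hne
        · exact e0.resolve_right hne
        · exact e1.resolve_right hne
      rw [r2, ha, zero_mul, eq_comm, mul_eq_zero, neg_eq_zero] at e2
      rw [r3, ha, zero_mul, eq_comm, mul_eq_zero, neg_eq_zero] at e3
      exact hne.elim (fun h => h (e2.resolve_left h2)) (fun h => h (e3.resolve_left h2))
  · set α := R.L 2 ⬝ᵥ x with hα
    set β := R.L 3 ⬝ᵥ x with hβ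
    let ρ : Fin 6 → k := α • R.dualVec h2 0 + β • R.dualVec h2 1
    have r0 : R.L 0 ⬝ᵥ ρ = α := by simp [ρ, dotProduct_add, hd]
    have r1 : R.L 1 ⬝ᵥ ρ = β := by simp [ρ, dotProduct_add, hd]
    have r2 : R.L 2 ⬝ᵥ ρ = 0 := by simp [ρ, dotProduct_add, hd]
    have r3 : R.L 3 ⬝ᵥ ρ = 0 := by simp [ρ, dotProduct_add, hd]
    refine R.isDegenerate_of_comb x ρ hx ?_ (ν := ν) ?_ ?_
    · change ∑ j, comb N R.μ j * _ = 0
      rw [← R.hq, r2, r3]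
      ring
    · intro j
      obtain ⟨-, -, a2, a3⟩ := R.L_apply h2 j
      rw [hν, a2, a3]
      simp only [ρ, Pi.add_apply, Pi.smul_apply, smul_eq_mul]
      ring
    · intro a h
      have hL : ∀ l, a * (R.L l ⬝ᵥ x) = 2 * (R.L l ⬝ᵥ ρ) := by
        intro l
        simp only [dotProduct, Finset.mul_sum]
        refine Finset.sum_congr rfl fun j _ => ?_
        by_cases hj : R.c j = 0
        · rw [R.L_apply_eq_zero h2 hj]; ring
        · have h1 := h j (fun e => hj (e ▸ R.c_m)) (fun e => hj (e ▸ R.c_n))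
          linear_combination R.L l j * h1
      have e0 := hL 0
      have e1 := hL 1
      have e2 := hL 2
      have e3 := hL 3
      rw [r2, mul_zero, mul_eq_zero] at e2
      rw [r3, mul_zero, mul_eq_zero] at e3
      have ha : a = 0 := by
        rcases hne with hne | hne
        · exact e2.resolve_right hne
        · exact e3.resolve_right hne
      rw [r0, ha, zero_mul, eq_comm, mul_eq_zero] at e0
      rw [r1, ha, zero_mul, eq_comm, mul_eq_zero] at e1
      exact hne.elim (fun h => h (e0.resolve_left h2)) (fun h => h (e1.resolve_left h2))

end Ruling

/-- Points of the projective line with proportional coordinates are equal. -/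
lemma projectiveLine_ext {k : Type*} [Field k] {p q : ℙ k (Fin 2 → k)}
    (h : p.rep 0 * q.rep 1 = p.rep 1 * q.rep 0) : p = q := by
  rw [← p.mk_rep, ← q.mk_rep, Projectivization.mk_eq_mk_iff']
  by_cases h0 : q.rep 0 = 0
  · have h1 : q.rep 1 ≠ 0 := fun h1 => q.rep_nonzero (by
      funext i; fin_cases i <;> assumption)
    refine ⟨p.rep 1 / q.rep 1, ?_⟩
    funext i
    fin_cases i
    · change p.rep 1 / q.rep 1 * q.rep 0 = p.rep 0
      field_simp
      linear_combination -h
    · change p.rep 1 / q.rep 1 * q.rep 1 = p.rep 1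
      field_simp
  · refine ⟨p.rep 0 / q.rep 0, ?_⟩
    funext i
    fin_cases i
    · change p.rep 0 / q.rep 0 * q.rep 0 = p.rep 0
      field_simp
    · change p.rep 0 / q.rep 0 * q.rep 1 = p.rep 1
      field_simp
      linear_combination h

lemma exists_bezout {k : Type*} [Field k] {p : Fin 2 → k} (hp : p ≠ 0) :
    ∃ r : Fin 2 → k, r 0 * p 0 + r 1 * p 1 = 1 := by
  by_cases h0 : p 0 = 0
  · have h1 : p 1 ≠ 0 := fun h1 => hp (by funext i; fin_cases i <;> assumption)
    exact ⟨![0, (p 1)⁻¹], by simp [h1]⟩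
  · exact ⟨![(p 0)⁻¹, 0], by simp [h0]⟩

lemma evalAt_linForm_eq_dotProduct {k : Type*} [Field k] {n : ℕ} (l : Fin n → k)
    (x : ℙ k (Fin n → k)) : evalAt (linForm l) x = l ⬝ᵥ x.rep := by
  simp [evalAt_linForm, dotProduct]

section Fibration

variable {K k : Type*} [Field K] [Field k] [Algebra K k] {M : Fin 3 → Fin 6 → K}

/-- A map which is not smooth at a point where it is given by linear forms: its differential is a
combination of the differentials of the equations. -/
lemma exists_comb_of_not_isSmoothAt {π : zeroLocus k (fun r => diagForm (M r)) → ℙ k (Fin 2 → k)}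
    {x : zeroLocus k (fun r => diagForm (M r))} {l l' : Fin 6 → k}
    (hrep : IsLocalRep π x (linForm l) (linForm l'))
    (h : ¬ IsSmoothAt (fun r => diagForm (M r)) π x) :
    ∃ ν, ∀ j, comb (baseChange k M) ν j * x.1.rep j
      = (l ⬝ᵥ x.1.rep) * l' j - (l' ⬝ᵥ x.1.rep) * l j := by
  set J := jacobian (fun r => diagForm (M r)) x.1 with hJ
  let δ : Fin 6 → k := fun j => (l ⬝ᵥ x.1.rep) * l' j - (l' ⬝ᵥ x.1.rep) * l j
  let G : Fin 3 → (Fin 6 → k) →ₗ[k] k := fun r => (LinearMap.proj r).comp J.mulVecLin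
  let D : (Fin 6 → k) →ₗ[k] k := (LinearMap.proj (0 : Fin 1)).comp
    (Matrix.mulVecLin (Matrix.of fun _ : Fin 1 => δ))
  have hD : ∀ w, D w = δ ⬝ᵥ w := fun w => rfl
  have hdir : ∀ (m : Fin 6 → k) (w : Fin 6 → k), dirDeriv (linForm m) x.1 w = m ⬝ᵥ w := by
    intro m w
    simp [dirDeriv, pderiv_linForm, evalAt, dotProduct]
  have hker : ⨅ r, LinearMap.ker (G r) ≤ LinearMap.ker D := by
    intro w hw
    rw [LinearMap.mem_ker, hD]
    by_contra hne
    refine h ⟨_, _, hrep, w, ?_, ?_⟩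
    · funext r
      exact LinearMap.mem_ker.1 ((Submodule.mem_iInf _).1 hw r)
    · rw [evalAt_linForm_eq_dotProduct, evalAt_linForm_eq_dotProduct, hdir, hdir]
      intro h0
      apply hne
      rw [← h0]
      simp only [δ, dotProduct, Finset.mul_sum, ← Finset.sum_sub_distrib]
      refine Finset.sum_congr rfl fun j _ => ?_
      ring
  obtain ⟨ν, hν⟩ := (Submodule.mem_span_range_iff_exists_fun k).1 (mem_span_of_iInf_ker_le_ker hker)
  refine ⟨fun r => 2 * ν r, fun j => ?_⟩
  have h1 := congrArg (fun f => f (Pi.single j 1)) hν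
  simp only [hD, dotProduct_single, mul_one] at h1
  change _ = δ j
  rw [← h1]
  simp only [LinearMap.coe_sum, LinearMap.coe_smul, Finset.sum_apply, Pi.smul_apply, smul_eq_mul,
    G, LinearMap.comp_apply, Matrix.mulVecLin_apply, LinearMap.proj_apply,
    Matrix.mulVec_single_one, comb, Finset.sum_mul, Matrix.col_apply, hJ, jacobian_diagForm,
    baseChange]
  refine Finset.sum_congr rfl fun r _ => ?_
  ring

variable (R : Ruling (baseChange k M)) {π : zeroLocus k (fun r => diagForm (M r)) → ℙ k (Fin 2 → k)}

namespace Ruling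

/-- The map `π` is given by the linear forms of a ruling. -/
def Gives (π : zeroLocus k (fun r => diagForm (M r)) → ℙ k (Fin 2 → k)) : Prop :=
  IsGivenBy π (linForm (R.L 0)) (linForm (R.L 1)) ∧
    IsGivenBy π (linForm (R.L 2)) (linForm (R.L 3))

lemma Gives.apply (h : R.Gives π) (x) :
    (π x).rep 0 * (R.L 1 ⬝ᵥ x.1.rep) = (π x).rep 1 * (R.L 0 ⬝ᵥ x.1.rep) ∧
      (π x).rep 0 * (R.L 3 ⬝ᵥ x.1.rep) = (π x).rep 1 * (R.L 2 ⬝ᵥ x.1.rep) := by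
  have h1 := h.1 x
  have h2 := h.2 x
  simp only [evalAt_linForm_eq_dotProduct] at h1 h2
  exact ⟨h1, h2⟩

lemma exists_localRep (h2 : (2 : k) ≠ 0) (h : R.Gives π) (x) :
    ∃ i i' : Fin 4, (i = 0 ∧ i' = 1 ∨ i = 2 ∧ i' = 3) ∧
      (R.L i ⬝ᵥ x.1.rep ≠ 0 ∨ R.L i' ⬝ᵥ x.1.rep ≠ 0) ∧
      IsLocalRep π x (linForm (R.L i)) (linForm (R.L i')) := by
  obtain ⟨i, hi⟩ := R.exists_form_ne_zero h2 ((mem_zeroLocus_iff M x.1).1 x.2) x.1.rep_nonzero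
  have hrep : ∀ a b : Fin 4, (R.L a ⬝ᵥ x.1.rep ≠ 0 ∨ R.L b ⬝ᵥ x.1.rep ≠ 0) →
      IsGivenBy π (linForm (R.L a)) (linForm (R.L b)) →
      IsLocalRep π x (linForm (R.L a)) (linForm (R.L b)) := by
    intro a b hab hg
    refine ⟨⟨1, linForm_isHomogeneous _, linForm_isHomogeneous _⟩, ?_, hg⟩
    simpa only [evalAt_linForm_eq_dotProduct] using hab
  fin_cases i
  · exact ⟨0, 1, Or.inl ⟨rfl, rfl⟩, Or.inl hi, hrep _ _ (Or.inl hi) h.1⟩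
  · exact ⟨0, 1, Or.inl ⟨rfl, rfl⟩, Or.inr hi, hrep _ _ (Or.inr hi) h.1⟩
  · exact ⟨2, 3, Or.inr ⟨rfl, rfl⟩, Or.inl hi, hrep _ _ (Or.inl hi) h.2⟩
  · exact ⟨2, 3, Or.inr ⟨rfl, rfl⟩, Or.inr hi, hrep _ _ (Or.inr hi) h.2⟩

/-- The value of `π` at a point is determined by the linear forms. -/
lemma Gives.eq_iff (h2 : (2 : k) ≠ 0) (h : R.Gives π) (x) (p : ℙ k (Fin 2 → k)) : π x = p ↔
    p.rep 0 * (R.L 1 ⬝ᵥ x.1.rep) = p.rep 1 * (R.L 0 ⬝ᵥ x.1.rep) ∧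
      p.rep 0 * (R.L 3 ⬝ᵥ x.1.rep) = p.rep 1 * (R.L 2 ⬝ᵥ x.1.rep) := by
  obtain ⟨h1, h3⟩ := h.apply R x
  constructor
  · rintro rfl
    exact ⟨h1, h3⟩
  · rintro ⟨h4, h5⟩
    obtain ⟨i, i', hi, hne, -⟩ := R.exists_localRep h2 h x
    apply projectiveLine_ext
    rcases hi with ⟨rfl, rfl⟩ | ⟨rfl, rfl⟩
    · rcases hne with hne | hne
      · apply mul_right_cancel₀ hne
        linear_combination p.rep 0 * h1 - (π x).rep 0 * h4
      · apply mul_right_cancel₀ hne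
        linear_combination p.rep 1 * h1 - (π x).rep 1 * h4
    · rcases hne with hne | hne
      · apply mul_right_cancel₀ hne
        linear_combination p.rep 0 * h3 - (π x).rep 0 * h5
      · apply mul_right_cancel₀ hne
        linear_combination p.rep 1 * h3 - (π x).rep 1 * h5

lemma dotProduct_mk_rep {n : ℕ} (l v : Fin n → k) (hv : v ≠ 0) : ∃ u : k, u ≠ 0 ∧
    (Projectivization.mk k v hv).rep = u • v ∧
    l ⬝ᵥ (Projectivization.mk k v hv).rep = u * (l ⬝ᵥ v) := by
  obtain ⟨u, hu⟩ := Projectivization.exists_smul_eq_mk_rep k v hv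
  exact ⟨u, u.ne_zero, hu.symm, by rw [← hu, Units.smul_def, dotProduct_smul, smul_eq_mul]⟩

lemma Gives.mk_mem_fibre_iff (h2 : (2 : k) ≠ 0) (h : R.Gives π) (p : ℙ k (Fin 2 → k))
    {r : Fin 2 → k} (hr : r 0 * p.rep 0 + r 1 * p.rep 1 = 1) (v : Fin 6 → k) (hv : v ≠ 0) :
    Projectivization.mk k v hv ∈ fibre π p ↔ v ∈ (R.cover h2 p.rep r hr).cone := by
  obtain ⟨u, hu0, hu, -⟩ := dotProduct_mk_rep v v hv
  rw [mem_cone_cover_iff, ← mk_mem_zeroLocus_iff M v hv]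
  constructor
  · rintro ⟨x, hx, hxv⟩
    refine ⟨hxv ▸ x.2, ?_⟩
    have := (h.eq_iff R h2 x p).1 hx
    rw [hxv, hu] at this
    simp only [dotProduct_smul, smul_eq_mul] at this
    exact ⟨mul_left_cancel₀ hu0 (by linear_combination this.1),
      mul_left_cancel₀ hu0 (by linear_combination this.2)⟩
  · rintro ⟨hx, h3, h4⟩
    refine ⟨⟨_, hx⟩, (h.eq_iff R h2 _ p).2 ?_, rfl⟩
    rw [hu]
    simp only [dotProduct_smul, smul_eq_mul]
    exact ⟨by linear_combination u * h3, by linear_combination u * h4⟩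

/-- The maps given by a ruling of a quadric of rank four are elliptic fibrations. -/
theorem Gives.isEllipticFibration [IsAlgClosed k] (h2 : (2 : k) ≠ 0) (h : R.Gives π) :
    IsEllipticFibration (fun r => diagForm (M r)) π := by
  have hconn : ∀ p, IsZariskiConnected (fibre π p) := by
    intro p
    obtain ⟨r, hr⟩ := exists_bezout p.rep_nonzero
    exact (R.cover h2 p.rep r hr).isZariskiConnected h2 fun v hv => h.mk_mem_fibre_iff R h2 p hr v hv
  refine ⟨fun x => ?_, fun p => ?_, hconn, ?_⟩
  · obtain ⟨i, i', -, -, hrep⟩ := R.exists_localRep h2 h x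
    exact ⟨_, _, hrep⟩
  · obtain ⟨-, x, hx, -⟩ := (hconn p).1
    exact ⟨x, hx⟩
  let B : Set (zeroLocus k (fun r => diagForm (M r))) := {x | R.IsDegenerate x.1.rep}
  have hB : B.Finite := by
    have hfin := (R.finite_branch.union (R.finite_tangency.union R.swap.finite_tangency))
    refine (hfin.preimage (Subtype.val_injective.injOn)).subset ?_
    rintro x (hx | hx | hx)
    · exact Or.inl ⟨(mem_zeroLocus_iff M x.1).1 x.2, hx⟩
    · exact Or.inr (Or.inl hx)
    · exact Or.inr (Or.inr hx)
  refine (hB.image π).subset fun p hp => ?_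
  by_contra hpB
  have hnd : ∀ x, π x = p → ¬ R.IsDegenerate x.1.rep := fun x hx hd => hpB ⟨x, hd, hx⟩
  refine hp ⟨fun x hx => ?_, ?_⟩
  · by_contra hns
    obtain ⟨i, i', hi, hne, hrep⟩ := R.exists_localRep h2 h x
    obtain ⟨ν, hν⟩ := exists_comb_of_not_isSmoothAt hrep hns
    exact hnd x hx (R.isDegenerate_of_differential_eq_zero h2
      ((mem_zeroLocus_iff M x.1).1 x.2) hi hne hν)
  · obtain ⟨r, hr⟩ := exists_bezout p.rep_nonzero
    set D := R.cover h2 p.rep r hr with hD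
    -- a common zero of the two binary forms gives a point on the fibre with `x_m = x_n = 0`
    have hpt : ∀ w : Fin 2 → k, w ≠ 0 → aeval w D.f = (0 : k) → aeval w D.g = (0 : k) → False := by
      intro w hw hf hg
      have hv := D.point_ne_zero hw 0 0
      have hmem := (h.mk_mem_fibre_iff R h2 p hr _ hv).2
        ⟨w, 0, 0, ⟨by rw [← hD, hf]; ring, by rw [← hD, hg]; ring⟩, rfl⟩
      obtain ⟨x, hx, hxv⟩ := hmem
      obtain ⟨u, -, hu, -⟩ := dotProduct_mk_rep (D.point w 0 0) _ hv
      refine hnd x hx (Or.inl ?_)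
      rw [hxv, hu]
      have hi := D.point_i w 0 0
      have hj := D.point_j w 0 0
      change D.point w 0 0 R.m = 0 at hi
      change D.point w 0 0 R.n = 0 at hj
      simp [hi, hj]
    refine D.isCurveOfGenus_one h2 ?_ ?_ fun v hv => h.mk_mem_fibre_iff R h2 p hr v hv
    · intro hf
      obtain ⟨w, hw, hg⟩ := exists_zero_of_binaryForm D.hg
      exact hpt w hw (by rw [hf, map_zero]) hg
    · intro hg
      obtain ⟨w, hw, hf⟩ := exists_zero_of_binaryForm D.hf
      exact hpt w hw hf (by rw [hg, map_zero])

end Ruling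

end Fibration

/-! ### The fibrations defined by a quadric of rank four -/

/-- Two pairs of transversal equivalence relations with the same union and the same intersection
consist of the same relations. -/
lemma setoid_eq_or_eq {α : Type*} [Nonempty α] {E₁ E₂ F₁ F₂ : Setoid α}
    (hE : ∀ x y, ∃ z, E₁ x z ∧ E₂ z y) (hE₁ : ∀ x, ∃ y, E₁ x y ∧ ¬ E₂ x y)
    (hF₁ : ∀ x, ∃ y, F₁ x y ∧ ¬ F₂ x y) (hF₂ : ∀ x, ∃ y, F₂ x y ∧ ¬ F₁ x y)
    (hor : ∀ x y, F₁ x y ∨ F₂ x y ↔ E₁ x y ∨ E₂ x y)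
    (hand : ∀ x y, F₁ x y ∧ F₂ x y ↔ E₁ x y ∧ E₂ x y) : F₁ = E₁ ∨ F₁ = E₂ := by
  -- for each point, the class of `F₁` is one of the classes of `E₁` and `E₂`
  have hpt : ∀ x, (∀ y, F₁ x y ↔ E₁ x y) ∨ ∀ y, F₁ x y ↔ E₂ x y := by
    intro x
    -- two points related to `x` by `F₁` only and by `F₂` only are not related by `E₁` or `E₂`
    have hcross : ∀ y z, F₁ x y → ¬ F₂ x y → F₂ x z → ¬ F₁ x z → ¬ (E₁ y z ∨ E₂ y z) := by
      intro y z h1 h2 h3 h4 h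
      rcases (hor y z).2 h with h | h
      · exact h4 (F₁.trans h1 h)
      · exact h2 (F₂.trans h3 (F₂.symm h))
    obtain ⟨y, hy1, hy2⟩ := hF₁ x
    obtain ⟨z, hz2, hz1⟩ := hF₂ x
    have hcase : ∀ a, F₁ x a → ¬ F₂ x a → (E₁ x a ∧ ¬ E₂ x a) ∨ (E₂ x a ∧ ¬ E₁ x a) := by
      intro a h1 h2
      have := (hor x a).1 (Or.inl h1)
      have h3 : ¬ (E₁ x a ∧ E₂ x a) := fun h => h2 ((hand x a).2 h).2
      tauto
    have hcase' : ∀ a, F₂ x a → ¬ F₁ x a → (E₁ x a ∧ ¬ E₂ x a) ∨ (E₂ x a ∧ ¬ E₁ x a) := by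
      intro a h1 h2
      have := (hor x a).1 (Or.inr h1)
      have h3 : ¬ (E₁ x a ∧ E₂ x a) := fun h => h2 ((hand x a).2 h).1
      tauto
    have hx : ∀ a b, E₁ x a → E₁ x b → E₁ a b := fun a b h h' => E₁.trans (E₁.symm h) h'
    have hx' : ∀ a b, E₂ x a → E₂ x b → E₂ a b := fun a b h h' => E₂.trans (E₂.symm h) h'
    rcases hcase y hy1 hy2 with hy | hy
    · left
      have hz : ∀ a, F₂ x a → ¬ F₁ x a → ¬ E₁ x a := fun a h h' h'' =>
        hcross y a hy1 hy2 h h' (Or.inl (hx _ _ hy.1 h''))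
      have hzE : E₂ x z := ((hcase' z hz2 hz1).resolve_left fun h => hz z hz2 hz1 h.1).1
      have hy' : ∀ a, F₁ x a → ¬ F₂ x a → ¬ E₂ x a := fun a h h' h'' =>
        hcross a z h h' hz2 hz1 (Or.inr (hx' _ _ h'' hzE))
      intro a
      have q1 := hz a
      have q2 := hy' a
      have q3 := hor x a
      have q4 := hand x a
      tauto
    · right
      have hz : ∀ a, F₂ x a → ¬ F₁ x a → ¬ E₂ x a := fun a h h' h'' =>
        hcross y a hy1 hy2 h h' (Or.inr (hx' _ _ hy.1 h''))
      have hzE : E₁ x z := ((hcase' z hz2 hz1).resolve_right fun h => hz z hz2 hz1 h.1).1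
      have hy' : ∀ a, F₁ x a → ¬ F₂ x a → ¬ E₁ x a := fun a h h' h'' =>
        hcross a z h h' hz2 hz1 (Or.inl (hx _ _ h'' hzE))
      intro a
      have q1 := hz a
      have q2 := hy' a
      have q3 := hor x a
      have q4 := hand x a
      tauto
  by_cases h : ∀ x y, F₁ x y ↔ E₁ x y
  · exact Or.inl (Setoid.ext h)
  · right
    push Not at h
    obtain ⟨x, hx⟩ := h
    have hx2 : ∀ y, F₁ x y ↔ E₂ x y := (hpt x).resolve_left fun h => by
      obtain ⟨y, hy⟩ := hx
      have := h y
      tauto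
    refine Setoid.ext fun x' y => ?_
    refine (hpt x').resolve_left (fun h' => ?_) y
    -- the class of `x'` for `E₁` and that of `x` for `E₂` have a common point
    obtain ⟨z, hz1, hz2⟩ := hE x' x
    have hxz : F₁ x z := (hx2 z).2 (E₂.symm hz2)
    have hx'z : F₁ x' z := (h' z).2 hz1
    obtain ⟨a, ha1, ha2⟩ := hE₁ z
    apply ha2
    have h1 : F₁ x' a := (h' a).2 (E₁.trans hz1 ha1)
    have h3 : F₁ x a := F₁.trans hxz (F₁.trans (F₁.symm hx'z) h1)
    exact E₂.trans hz2 ((hx2 a).1 h3)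

namespace Ruling

variable {K k : Type*} [Field K] [Field k] [Algebra K k] {M : Fin 3 → Fin 6 → K}
  (R R' : Ruling (baseChange k M))
  {π π' ω ω' : zeroLocus k (fun r => diagForm (M r)) → ℙ k (Fin 2 → k)}

/-- The ruling defines a map on the base locus. -/
lemma exists_gives (h2 : (2 : k) ≠ 0) :
    ∃ π : zeroLocus k (fun r => diagForm (M r)) → ℙ k (Fin 2 → k), R.Gives π := by
  have key : ∀ x : zeroLocus k (fun r => diagForm (M r)), ∃ p : ℙ k (Fin 2 → k),
      p.rep 0 * (R.L 1 ⬝ᵥ x.1.rep) = p.rep 1 * (R.L 0 ⬝ᵥ x.1.rep) ∧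
      p.rep 0 * (R.L 3 ⬝ᵥ x.1.rep) = p.rep 1 * (R.L 2 ⬝ᵥ x.1.rep) := by
    intro x
    have hx := (mem_zeroLocus_iff M x.1).1 x.2
    have hdet := R.hq x.1.rep
    rw [sum_comb_mul_sq hx, sub_eq_zero] at hdet
    obtain ⟨i, hi⟩ := R.exists_form_ne_zero h2 hx x.1.rep_nonzero
    have hmk : ∀ a b : k, (a ≠ 0 ∨ b ≠ 0) → ∃ (p : ℙ k (Fin 2 → k)) (u : k), p.rep 0 = u * a ∧
        p.rep 1 = u * b := by
      intro a b hab
      have hv : (![a, b] : Fin 2 → k) ≠ 0 := fun h =>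
        hab.elim (fun h' => h' (congrFun h 0)) (fun h' => h' (congrFun h 1))
      obtain ⟨u, -, hu, -⟩ := dotProduct_mk_rep ![a, b] _ hv
      exact ⟨_, u, by rw [hu]; simp, by rw [hu]; simp⟩
    have h01 : R.L 0 ⬝ᵥ x.1.rep ≠ 0 ∨ R.L 1 ⬝ᵥ x.1.rep ≠ 0 ∨ R.L 2 ⬝ᵥ x.1.rep ≠ 0 ∨
        R.L 3 ⬝ᵥ x.1.rep ≠ 0 := by
      fin_cases i <;> tauto
    by_cases hab : R.L 0 ⬝ᵥ x.1.rep ≠ 0 ∨ R.L 1 ⬝ᵥ x.1.rep ≠ 0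
    · obtain ⟨p, u, h0, h1⟩ := hmk _ _ hab
      refine ⟨p, ?_, ?_⟩
      · rw [h0, h1]; ring
      · rw [h0, h1]; linear_combination u * hdet
    · obtain ⟨p, u, h0, h1⟩ := hmk (R.L 2 ⬝ᵥ x.1.rep) (R.L 3 ⬝ᵥ x.1.rep) (by tauto)
      refine ⟨p, ?_, ?_⟩
      · rw [h0, h1]; linear_combination -u * hdet
      · rw [h0, h1]; ring
  choose π hπ using key
  refine ⟨π, fun x => ?_, fun x => ?_⟩
  · simpa only [evalAt_linForm_eq_dotProduct] using (hπ x).1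
  · simpa only [evalAt_linForm_eq_dotProduct] using (hπ x).2

/-- The two maps to the projective line determine the values of the linear forms, up to a common
factor. -/
lemma Gives.exists_factor (h2 : (2 : k) ≠ 0) (h : R.Gives π) (h' : R.other.Gives ω) (x) :
    ∃ u : k, u ≠ 0 ∧ R.L 0 ⬝ᵥ x.1.rep = u * ((ω x).rep 0 * (π x).rep 0) ∧
      R.L 1 ⬝ᵥ x.1.rep = u * ((ω x).rep 0 * (π x).rep 1) ∧
      R.L 2 ⬝ᵥ x.1.rep = u * ((ω x).rep 1 * (π x).rep 0) ∧
      R.L 3 ⬝ᵥ x.1.rep = u * ((ω x).rep 1 * (π x).rep 1) := by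
  obtain ⟨e1, e2⟩ := h.apply R x
  obtain ⟨e3, e4⟩ := h'.apply R.other x
  change (ω x).rep 0 * (R.L 2 ⬝ᵥ _) = (ω x).rep 1 * (R.L 0 ⬝ᵥ _) at e3
  change (ω x).rep 0 * (R.L 3 ⬝ᵥ _) = (ω x).rep 1 * (R.L 1 ⬝ᵥ _) at e4
  obtain ⟨r, hr⟩ := exists_bezout (π x).rep_nonzero
  obtain ⟨s, hs⟩ := exists_bezout (ω x).rep_nonzero
  obtain ⟨i, hi⟩ := R.exists_form_ne_zero h2 ((mem_zeroLocus_iff M x.1).1 x.2) x.1.rep_nonzero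
  set a := R.L 0 ⬝ᵥ x.1.rep with ha
  set b := R.L 1 ⬝ᵥ x.1.rep with hb
  set c := R.L 2 ⬝ᵥ x.1.rep with hc
  set d := R.L 3 ⬝ᵥ x.1.rep with hd
  set p := (π x).rep with hp
  set q := (ω x).rep with hq
  set u := s 0 * (r 0 * a + r 1 * b) + s 1 * (r 0 * c + r 1 * d) with hu
  -- contract with the vectors `r` and `s`, one after the other
  have k1 : a = (r 0 * a + r 1 * b) * p 0 := by linear_combination -a * hr - r 1 * e1
  have k2 : b = (r 0 * a + r 1 * b) * p 1 := by linear_combination -b * hr + r 0 * e1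
  have k3 : c = (r 0 * c + r 1 * d) * p 0 := by linear_combination -c * hr - r 1 * e2
  have k4 : d = (r 0 * c + r 1 * d) * p 1 := by linear_combination -d * hr + r 0 * e2
  have e5 : q 0 * (r 0 * c + r 1 * d) = q 1 * (r 0 * a + r 1 * b) := by
    linear_combination r 0 * e3 + r 1 * e4
  have l1 : r 0 * a + r 1 * b = u * q 0 := by
    linear_combination -(r 0 * a + r 1 * b) * hs - s 1 * e5
  have l2 : r 0 * c + r 1 * d = u * q 1 := by
    linear_combination -(r 0 * c + r 1 * d) * hs + s 0 * e5
  have m1 : a = u * (q 0 * p 0) := by rw [k1, l1]; ring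
  have m2 : b = u * (q 0 * p 1) := by rw [k2, l1]; ring
  have m3 : c = u * (q 1 * p 0) := by rw [k3, l2]; ring
  have m4 : d = u * (q 1 * p 1) := by rw [k4, l2]; ring
  refine ⟨u, fun h0 => hi ?_, m1, m2, m3, m4⟩
  fin_cases i
  · exact m1.trans (by rw [h0, zero_mul])
  · exact m2.trans (by rw [h0, zero_mul])
  · exact m3.trans (by rw [h0, zero_mul])
  · exact m4.trans (by rw [h0, zero_mul])

lemma projectiveLine_eq_iff {p q : ℙ k (Fin 2 → k)} :
    p = q ↔ p.rep 0 * q.rep 1 - p.rep 1 * q.rep 0 = 0 :=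
  ⟨by rintro rfl; ring, fun h => projectiveLine_ext (sub_eq_zero.1 h)⟩

/-- Two points lie on the same fibre for one of the two rulings if and only if they are orthogonal
with respect to the quadric. -/
lemma Gives.eq_or_eq_iff (h2 : (2 : k) ≠ 0) (h : R.Gives π) (h' : R.other.Gives ω) (x y) :
    (π x = π y ∨ ω x = ω y) ↔ ∑ j, R.c j * (x.1.rep j * y.1.rep j) = 0 := by
  obtain ⟨u, hu, a0, a1, a2, a3⟩ := h.exists_factor R h2 h' x
  obtain ⟨v, hv, b0, b1, b2, b3⟩ := h.exists_factor R h2 h' y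
  have hp := R.polar x.1.rep y.1.rep
  rw [a0, a1, a2, a3, b0, b1, b2, b3] at hp
  have hp' : (u * v) * (((π x).rep 0 * (π y).rep 1 - (π x).rep 1 * (π y).rep 0) *
      ((ω x).rep 0 * (ω y).rep 1 - (ω x).rep 1 * (ω y).rep 0))
      = 2 * ∑ j, R.c j * (x.1.rep j * y.1.rep j) := by
    rw [← hp]; ring
  rw [projectiveLine_eq_iff, projectiveLine_eq_iff, ← mul_eq_zero]
  constructor
  · intro h0
    rw [h0, mul_zero, eq_comm] at hp'
    exact (mul_eq_zero.1 hp').resolve_left h2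
  · intro h0
    rw [h0, mul_zero] at hp'
    exact (mul_eq_zero.1 hp').resolve_left (mul_ne_zero hu hv)

lemma Gives.eq_of_rep (h2 : (2 : k) ≠ 0) (h : R.Gives π) {x y} {u : k}
    (hxy : ∀ j, R.c j ≠ 0 → y.1.rep j = u * x.1.rep j) : π x = π y := by
  have hL : ∀ i, R.L i ⬝ᵥ y.1.rep = u * (R.L i ⬝ᵥ x.1.rep) := by
    intro i
    simp only [dotProduct, Finset.mul_sum]
    refine Finset.sum_congr rfl fun j _ => ?_
    by_cases hj : R.c j = 0
    · rw [R.L_apply_eq_zero h2 hj]; ring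
    · rw [hxy j hj]; ring
  obtain ⟨h1, h3⟩ := h.apply R x
  refine ((h.eq_iff R h2 y (π x)).2 ⟨?_, ?_⟩).symm
  · rw [hL, hL]; linear_combination u * h1
  · rw [hL, hL]; linear_combination u * h3

/-- Two points lie on the same fibre for both rulings if and only if their projections from the
vertex of the quadric coincide. -/
lemma Gives.eq_and_eq_iff (h2 : (2 : k) ≠ 0) (h : R.Gives π) (h' : R.other.Gives ω) (x y) :
    (π x = π y ∧ ω x = ω y) ↔ ∃ u : k, ∀ j, R.c j ≠ 0 → y.1.rep j = u * x.1.rep j := by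
  constructor
  · rintro ⟨e1, e2⟩
    obtain ⟨u, hu, a0, a1, a2, a3⟩ := h.exists_factor R h2 h' x
    obtain ⟨v, hv, b0, b1, b2, b3⟩ := h.exists_factor R h2 h' y
    refine ⟨v / u, fun j hj => ?_⟩
    have hjm : j ≠ R.m := fun e => hj (e ▸ R.c_m)
    have hjn : j ≠ R.n := fun e => hj (e ▸ R.c_n)
    have := R.eq_zero_of_forms_eq_zero h2 (x := y.1.rep - (v / u) • x.1.rep) ?_ hjm hjn
    · simpa [sub_eq_zero] using this
    · intro i
      rw [dotProduct_sub, dotProduct_smul, smul_eq_mul, sub_eq_zero]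
      fin_cases i
      · change R.L 0 ⬝ᵥ _ = _ * (R.L 0 ⬝ᵥ _)
        rw [a0, b0, e1, e2]; field_simp
      · change R.L 1 ⬝ᵥ _ = _ * (R.L 1 ⬝ᵥ _)
        rw [a1, b1, e1, e2]; field_simp
      · change R.L 2 ⬝ᵥ _ = _ * (R.L 2 ⬝ᵥ _)
        rw [a2, b2, e1, e2]; field_simp
      · change R.L 3 ⬝ᵥ _ = _ * (R.L 3 ⬝ᵥ _)
        rw [a3, b3, e1, e2]; field_simp
  · rintro ⟨u, hu⟩
    exact ⟨h.eq_of_rep R h2 hu, h'.eq_of_rep R.other h2 hu⟩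

/-- The projection of the base locus to the smooth quadric surface is surjective. -/
lemma Gives.exists_apply_eq [IsAlgClosed k] (h2 : (2 : k) ≠ 0) (h : R.Gives π)
    (h' : R.other.Gives ω) (p q : ℙ k (Fin 2 → k)) : ∃ x, π x = p ∧ ω x = q := by
  obtain ⟨r, hr⟩ := exists_bezout p.rep_nonzero
  set D := R.cover h2 p.rep r hr with hD
  obtain ⟨X, Y, hXY⟩ := D.exists_onCurve q.rep
  have hv := D.point_ne_zero q.rep_nonzero X Y
  have hmem := (h.mk_mem_fibre_iff R h2 p hr _ hv).2 ⟨_, X, Y, hXY, rfl⟩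
  obtain ⟨x, hx, hxv⟩ := hmem
  refine ⟨x, hx, (h'.eq_iff R.other h2 x q).2 ?_⟩
  obtain ⟨u, -, hu, -⟩ := dotProduct_mk_rep (D.point q.rep X Y) _ hv
  have hL := R.L_dotProduct_cover_point h2 p.rep r hr q.rep X Y
  have l0 := hL 0
  have l1 := hL 1
  have l2 := hL 2
  have l3 := hL 3
  simp only [Matrix.cons_val] at l0 l1 l2 l3
  rw [hxv, hu]
  change q.rep 0 * (R.L 2 ⬝ᵥ _) = q.rep 1 * (R.L 0 ⬝ᵥ _) ∧
    q.rep 0 * (R.L 3 ⬝ᵥ _) = q.rep 1 * (R.L 1 ⬝ᵥ _)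
  simp only [dotProduct_smul, smul_eq_mul, hD, l0, l1, l2, l3]
  constructor <;> ring

lemma exists_projectiveLine_ne (p : ℙ k (Fin 2 → k)) : ∃ q, q ≠ p := by
  have h1 : (![1, 0] : Fin 2 → k) ≠ 0 := fun h => one_ne_zero (congrFun h 0)
  have h3 : (![0, 1] : Fin 2 → k) ≠ 0 := fun h => one_ne_zero (congrFun h 1)
  have hne : Projectivization.mk k _ h1 ≠ Projectivization.mk k _ h3 := by
    intro h
    obtain ⟨a, ha⟩ := (Projectivization.mk_eq_mk_iff' k _ _ h1 h3).1 h
    have := congrFun ha 0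
    simp at this
  by_cases hp : p = Projectivization.mk k _ h1
  · exact ⟨_, fun h => hne (hp ▸ h.symm)⟩
  · exact ⟨_, fun h => hp h.symm⟩

lemma Gives.exists_eq_ne [IsAlgClosed k] (h2 : (2 : k) ≠ 0) (h : R.Gives π)
    (h' : R.other.Gives ω) (x) :
    (∃ y, π x = π y ∧ ¬ ω x = ω y) ∧ ∃ y, ω x = ω y ∧ ¬ π x = π y := by
  obtain ⟨q, hq⟩ := exists_projectiveLine_ne (ω x)
  obtain ⟨p, hp⟩ := exists_projectiveLine_ne (π x)
  obtain ⟨y, hy1, hy2⟩ := h.exists_apply_eq R h2 h' (π x) q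
  obtain ⟨z, hz1, hz2⟩ := h.exists_apply_eq R h2 h' p (ω x)
  exact ⟨⟨y, hy1.symm, by rw [hy2]; exact hq.symm⟩, ⟨z, hz2.symm, by rw [hz1]; exact hp.symm⟩⟩

/-- Two decompositions of the same quadric have the same rulings, up to order. -/
lemma Gives.ker_eq_or [IsAlgClosed k] (h2 : (2 : k) ≠ 0) (hc : R.c = R'.c) (h : R.Gives π)
    (hω : R.other.Gives ω) (h' : R'.Gives π') :
    Setoid.ker π' = Setoid.ker π ∨ Setoid.ker π' = Setoid.ker ω := by
  obtain ⟨ω', hω'⟩ := R'.other.exists_gives h2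
  obtain ⟨x, -⟩ := h.exists_apply_eq R h2 hω (Projectivization.mk k ![1, 0]
    fun h => one_ne_zero (congrFun h 0)) (Projectivization.mk k ![1, 0]
    fun h => one_ne_zero (congrFun h 0))
  have : Nonempty (zeroLocus k (fun r => diagForm (M r))) := ⟨x⟩
  refine setoid_eq_or_eq (F₂ := Setoid.ker ω') ?_ ?_ ?_ ?_ ?_ ?_ <;>
    simp only [Setoid.ker_def]
  · intro x y
    obtain ⟨z, hz1, hz2⟩ := h.exists_apply_eq R h2 hω (π x) (ω y)
    exact ⟨z, hz1.symm, hz2⟩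
  · exact fun x => (h.exists_eq_ne R h2 hω x).1
  · exact fun x => (h'.exists_eq_ne R' h2 hω' x).1
  · exact fun x => (h'.exists_eq_ne R' h2 hω' x).2
  · intro x y
    rw [h'.eq_or_eq_iff R' h2 hω', h.eq_or_eq_iff R h2 hω, hc]
  · intro x y
    rw [h'.eq_and_eq_iff R' h2 hω', h.eq_and_eq_iff R h2 hω, hc]

/-- The sign change of a coordinate preserves the fibres of a ruling if and only if this coordinate
does not occur in the quadric. -/
lemma Gives.flip_iff [IsAlgClosed k] (h2 : (2 : k) ≠ 0) (h : R.Gives π) (j : Fin 6) :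
    (∀ x y, (∃ u : k, y.1.rep = u • KummerKlein.flip j x.1.rep) → π x = π y) ↔ R.c j = 0 := by
  constructor
  · intro hfix
    by_contra hcj
    obtain ⟨i, hij, -⟩ := exists_third j j
    obtain ⟨v, hv, hvj, -⟩ := R.mds.exists_mem_baseCone_ne_zero hij.symm
    have hv0 : v ≠ 0 := fun h => hvj (by rw [h]; rfl)
    have hw : KummerKlein.flip j v ∈ baseCone (baseChange k M) := by
      intro r
      rw [← hv r]
      refine Finset.sum_congr rfl fun l _ => ?_
      simp only [KummerKlein.flip]
      split_ifs <;> ring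
    have hw0 : KummerKlein.flip j v ≠ 0 := fun h => hvj (by
      have := congrFun h j
      simpa [KummerKlein.flip] using this)
    let x : zeroLocus k (fun r => diagForm (M r)) := ⟨_, (mk_mem_zeroLocus_iff M v hv0).2 hv⟩
    let y : zeroLocus k (fun r => diagForm (M r)) := ⟨_, (mk_mem_zeroLocus_iff M _ hw0).2 hw⟩
    obtain ⟨a, ha0, ha, -⟩ := dotProduct_mk_rep v v hv0
    obtain ⟨b, hb0, hb, -⟩ := dotProduct_mk_rep v _ hw0
    have hxa : x.1.rep = a • v := ha
    have hyb : y.1.rep = b • KummerKlein.flip j v := hb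
    have hxy : π x = π y := by
      refine hfix x y ⟨b * a⁻¹, ?_⟩
      rw [hyb, hxa]
      funext l
      simp only [KummerKlein.flip, Pi.smul_apply, smul_eq_mul]
      split_ifs <;> field_simp
    obtain ⟨ω, hω⟩ := R.other.exists_gives h2
    have horth := (h.eq_or_eq_iff R h2 hω x y).1 (Or.inl hxy)
    rw [hxa, hyb] at horth
    have hterm : ∀ l, R.c l * ((a • v) l * (b • KummerKlein.flip j v) l)
        = a * b * (comb (baseChange k M) R.μ l * v l ^ 2)
          - (if l = j then 2 * a * b * (R.c l * v l ^ 2) else 0) := by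
      intro l
      change _ = a * b * (R.c l * v l ^ 2) - _
      simp only [KummerKlein.flip, Pi.smul_apply, smul_eq_mul]
      split_ifs <;> ring
    simp only [hterm, Finset.sum_sub_distrib, ← Finset.mul_sum, sum_comb_mul_sq hv,
      Finset.sum_ite_eq', Finset.mem_univ, if_true] at horth
    simp [h2, ha0, hb0, hcj, hvj] at horth
  · rintro hj x y ⟨u, hu⟩
    refine h.eq_of_rep R h2 (u := u) fun l hl => ?_
    have hlj : l ≠ j := fun e => hl (e ▸ hj)
    rw [hu]
    simp [KummerKlein.flip, hlj]

end Ruling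

/-! ### Counting the fibrations -/

section Count

variable {K k : Type*} [Field K] [Field k] [Algebra K k] {M : Fin 3 → Fin 6 → K}

lemma isGivenBy_linForm_iff {X : Set (ℙ k (Fin 6 → k))} {π : X → ℙ k (Fin 2 → k)}
    (a b : Fin 6 → K) : IsGivenBy π (linForm a) (linForm b) ↔
      IsGivenBy π (linForm fun j => algebraMap K k (a j))
        (linForm fun j => algebraMap K k (b j)) := by
  simp only [IsGivenBy, evalAt_linForm, Algebra.algebraMap_self, RingHom.id_apply]

/-- A decomposition over the ground field of a quadric of rank four gives a ruling. -/
lemma exists_ruling (hM : IsMDS (baseChange k M)) {μ : Fin 3 → K} {a b : Fin 6} (hab : a ≠ b)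
    (hμ : ∀ j, comb M μ j = 0 ↔ j = a ∨ j = b) {l : Fin 4 → Fin 6 → K}
    (hl : diagForm (comb M μ) = linForm (l 0) * linForm (l 3) - linForm (l 1) * linForm (l 2)) :
    ∃ R : Ruling (baseChange k M), (∀ j, R.c j = algebraMap K k (comb M μ j)) ∧
      ∀ i, R.L i = fun j => algebraMap K k (l i j) := by
  obtain ⟨c, hca, hcb⟩ := exists_third a b
  obtain ⟨νf, f1, f2, -⟩ := hM.exists_comb hab hca.symm hcb.symm 1 0 0
  obtain ⟨νg, g1, g2, -⟩ := hM.exists_comb hab hca.symm hcb.symm 0 1 0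
  refine ⟨⟨a, b, fun r => algebraMap K k (μ r), νf, νg, fun i j => algebraMap K k (l i j), hM, hab,
    fun j => ?_, f1, f2, g1, g2, fun x => ?_⟩, fun j => comb_baseChange M μ j, fun i => rfl⟩
  · rw [comb_baseChange, map_eq_zero, hμ]
  · have := congrArg (aeval x) hl
    simp only [aeval_diagForm, map_sub, map_mul, aeval_linForm] at this
    simp only [comb_baseChange]
    exact this.symm

/-- A quadric of rank four which splits over the ground field defines exactly two fibrations, both
of them elliptic; the sign changes of the coordinates which preserve their fibres are those of the
two variables that do not occur in the quadric. -/
theorem rulingMaps_spec [IsAlgClosed k] (h2 : (2 : k) ≠ 0) (hM : IsMDS (baseChange k M))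
    {μ : Fin 3 → K} {a b : Fin 6} (hab : a ≠ b) (hμ : ∀ j, comb M μ j = 0 ↔ j = a ∨ j = b)
    (hl : ∃ l : Fin 4 → Fin 6 → K, diagForm (comb M μ)
      = linForm (l 0) * linForm (l 3) - linForm (l 1) * linForm (l 2)) :
    (∀ π ∈ rulingMaps (zeroLocus k (fun r => diagForm (M r))) (diagForm (comb M μ)),
      IsEllipticFibration (fun r => diagForm (M r)) π) ∧
    (∃ E E' : Setoid (zeroLocus k (fun r => diagForm (M r))), E ≠ E' ∧ fibrationClasses
      (rulingMaps (zeroLocus k (fun r => diagForm (M r))) (diagForm (comb M μ))) = {E, E'}) ∧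
    ∀ E ∈ fibrationClasses
      (rulingMaps (zeroLocus k (fun r => diagForm (M r))) (diagForm (comb M μ))), ∀ j,
      (∀ x y, (∃ u : k, y.1.rep = u • KummerKlein.flip j x.1.rep) → E x y) ↔ j = a ∨ j = b := by
  have hgives : ∀ π ∈ rulingMaps (zeroLocus k (fun r => diagForm (M r))) (diagForm (comb M μ)),
      ∃ R : Ruling (baseChange k M), (∀ j, R.c j = algebraMap K k (comb M μ j)) ∧ R.Gives π := by
    rintro π ⟨a', b', c', d', ha, hb, hc, hd, hq, hg1, hg2⟩
    obtain ⟨a', rfl⟩ := exists_eq_linForm ha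
    obtain ⟨b', rfl⟩ := exists_eq_linForm hb
    obtain ⟨c', rfl⟩ := exists_eq_linForm hc
    obtain ⟨d', rfl⟩ := exists_eq_linForm hd
    obtain ⟨R, hRc, hRL⟩ := exists_ruling (k := k) hM hab hμ (l := ![a', b', c', d']) hq
    refine ⟨R, hRc, ?_, ?_⟩
    · rw [hRL, hRL]; exact (isGivenBy_linForm_iff a' b').1 hg1
    · rw [hRL, hRL]; exact (isGivenBy_linForm_iff c' d').1 hg2
  refine ⟨fun π hπ => ?_, ?_, ?_⟩
  · obtain ⟨R, -, hR⟩ := hgives π hπ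
    exact hR.isEllipticFibration R h2
  · obtain ⟨l, hl⟩ := hl
    obtain ⟨R, hRc, hRL⟩ := exists_ruling (k := k) hM hab hμ hl
    obtain ⟨π, hπ⟩ := R.exists_gives h2
    obtain ⟨ω, hω⟩ := R.other.exists_gives h2
    have mπ : π ∈ rulingMaps (zeroLocus k (fun r => diagForm (M r))) (diagForm (comb M μ)) := by
      refine ⟨_, _, _, _, linForm_isHomogeneous _, linForm_isHomogeneous _,
        linForm_isHomogeneous _, linForm_isHomogeneous _, hl, ?_, ?_⟩
      · rw [isGivenBy_linForm_iff, ← hRL, ← hRL]; exact hπ.1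
      · rw [isGivenBy_linForm_iff, ← hRL, ← hRL]; exact hπ.2
    have mω : ω ∈ rulingMaps (zeroLocus k (fun r => diagForm (M r))) (diagForm (comb M μ)) := by
      refine ⟨linForm (l 0), linForm (l 2), linForm (l 1), linForm (l 3), linForm_isHomogeneous _,
        linForm_isHomogeneous _, linForm_isHomogeneous _, linForm_isHomogeneous _, ?_, ?_, ?_⟩
      · rw [hl, mul_comm (linForm (l 1))]
      · rw [isGivenBy_linForm_iff, ← hRL, ← hRL]; exact hω.1
      · rw [isGivenBy_linForm_iff, ← hRL, ← hRL]; exact hω.2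
    refine ⟨Setoid.ker π, Setoid.ker ω, ?_, ?_⟩
    · intro h
      obtain ⟨x, -⟩ := hπ.exists_apply_eq R h2 hω (Projectivization.mk k ![1, 0]
        fun h => one_ne_zero (congrFun h 0)) (Projectivization.mk k ![1, 0]
        fun h => one_ne_zero (congrFun h 0))
      obtain ⟨y, hy1, hy2⟩ := (hπ.exists_eq_ne R h2 hω x).1
      have hy : Setoid.ker π x y := hy1
      rw [h] at hy
      exact hy2 hy
    · apply Set.Subset.antisymm
      · rintro _ ⟨π', hπ', rfl⟩
        obtain ⟨R', hRc', hR'⟩ := hgives π' hπ'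
        exact hπ.ker_eq_or R R' h2 (funext fun j => (hRc j).trans (hRc' j).symm) hω hR'
      · rintro _ (rfl | rfl)
        · exact ⟨π, mπ, rfl⟩
        · exact ⟨ω, mω, rfl⟩
  · rintro _ ⟨π, hπ, rfl⟩ j
    obtain ⟨R, hRc, hR⟩ := hgives π hπ
    rw [← hμ, ← map_eq_zero (algebraMap K k), ← hRc, ← hR.flip_iff R h2]
    rfl

lemma rulingMaps_C_mul (X : Set (ℙ k (Fin 6 → k))) {c : K} (hc : c ≠ 0)
    (q : MvPolynomial (Fin 6) K) : rulingMaps X (C c * q) = rulingMaps X q := by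
  have key : ∀ (c : K) (q : MvPolynomial (Fin 6) K), c ≠ 0 →
      rulingMaps X q ⊆ rulingMaps X (C c * q) := by
    rintro c q hc π ⟨a, b, d, e, ha, hb, hd, he, hq, hg1, hg2⟩
    refine ⟨C c * a, C c * b, d, e, ha.C_mul c, hb.C_mul c, hd, he, by rw [hq]; ring, fun y => ?_,
      hg2⟩
    have := hg1 y
    simp only [evalAt, map_mul, aeval_C] at this ⊢
    linear_combination algebraMap K k c * this
  refine Set.Subset.antisymm ?_ (key c q hc)
  have := key c⁻¹ (C c * q) (inv_ne_zero hc)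
  rwa [← mul_assoc, ← C_mul, inv_mul_cancel₀ hc, C_1, one_mul] at this

end Count

/-- The quadrics through the surface and the fibrations defined by them. The equations are a
variable `F`, since the type of the fibrations depends on them. -/
theorem quadrics_and_fibrations {K k : Type*} [Field K] [Field k] [Algebra K k] [IsAlgClosed k]
    (h2 : (2 : K) ≠ 0) (t s : K) {F : Fin 3 → MvPolynomial (Fin 6) K}
    (hF : F = fun r => diagForm (kummerCoeff t s r)) (hX : IsSmoothSurface k F) :
    (∀ q : MvPolynomial (Fin 6) K, ¬ IsQuadricThrough (zeroLocus k F) 3 q) ∧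
    (∀ q : MvPolynomial (Fin 6) K, IsQuadricThrough (zeroLocus k F) 4 q ↔
      ∃ (i : Fin 15) (c : K), c ≠ 0 ∧ q = C c * quadricTable t s i) ∧
    (∀ (i j : Fin 15) (c : K), quadricTable t s i = C c * quadricTable t s j → i = j) ∧
    (∀ q : MvPolynomial (Fin 6) K, IsQuadricThrough (zeroLocus k F) 4 q →
      (∀ π ∈ rulingMaps (zeroLocus k F) q, IsEllipticFibration F π) ∧
      (fibrationClasses (rulingMaps (zeroLocus k F) q)).ncard = 2) ∧
    (fibrationClasses {π | ∃ q : MvPolynomial (Fin 6) K, IsQuadricThrough (zeroLocus k F) 4 q ∧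
      π ∈ rulingMaps (zeroLocus k F) q}).ncard = 30 := by
  have h2k : (2 : k) ≠ 0 := by
    rw [← map_ofNat (algebraMap K k) 2]
    exact (map_ne_zero _).2 h2
  subst hF
  set M := kummerCoeff t s with hMdef
  have hM : IsMDS (baseChange k M) := isMDS_of_isSmoothSurface hX
  have hMK : IsMDS M := hM.of_baseChange
  simp only [quadricTable_eq, ← hMdef]
  set ν := tableParam t s with hν
  have hzero : ∀ i j, comb M (ν i) j = 0 ↔ j = (tablePair i).1 ∨ j = (tablePair i).2 := fun i =>
    hMK.comb_eq_zero_iff (tableParam_ne_zero h2 hMK i) (tablePair_ne i) (comb_tablePair t s i).1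
      (comb_tablePair t s i).2
  have hspec := fun i => rulingMaps_spec (k := k) h2k hM (tablePair_ne i) (hzero i)
    (exists_split_table (hzero i))
  have hthrough : ∀ q : MvPolynomial (Fin 6) K,
      IsQuadricThrough (zeroLocus k fun r => diagForm (M r)) 4 q ↔
        ∃ (i : Fin 15) (c : K), c ≠ 0 ∧ q = C c * diagForm (comb M (ν i)) := by
    intro q
    constructor
    · intro hq
      obtain ⟨-, μ, rfl, a, b, hab, hμ⟩ := hq.rank_eq_four h2 hM (by norm_num) le_rfl
      obtain ⟨i, hi⟩ := exists_tablePair a b hab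
      have hμi : ∀ j, comb M μ j = 0 ↔ j = (tablePair i).1 ∨ j = (tablePair i).2 := by
        intro j
        rw [hμ]
        rcases hi with hi | hi <;> rw [hi]
        exact or_comm
      -- compare a third coefficient
      obtain ⟨l, hl1, hl2⟩ := exists_third (tablePair i).1 (tablePair i).2
      have hl : ∀ {κ : Fin 3 → K}, (∀ j, comb M κ j = 0 ↔ j = (tablePair i).1 ∨
          j = (tablePair i).2) → comb M κ l ≠ 0 := fun h h0 => ((h l).1 h0).elim hl1 hl2
      have hli := hl (hzero i)
      refine ⟨i, comb M μ l / comb M (ν i) l, div_ne_zero (hl hμi) hli, ?_⟩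
      have : μ = (comb M μ l / comb M (ν i) l) • ν i := by
        refine hMK.eq_of_comb_eq (tablePair_ne i) hl1.symm hl2.symm ?_ ?_ ?_
        · rw [comb_smul, (hzero i _).2 (Or.inl rfl), (hμi _).2 (Or.inl rfl), mul_zero]
        · rw [comb_smul, (hzero i _).2 (Or.inr rfl), (hμi _).2 (Or.inr rfl), mul_zero]
        · rw [comb_smul, div_mul_cancel₀ _ hli]
      rw [C_mul_diagForm]
      congr 1
      funext j
      conv_lhs => rw [this]
      exact comb_smul _ _ _
    · rintro ⟨i, c, hc, rfl⟩
      have hcomb : C c * diagForm (comb M (ν i)) = diagForm (comb M (c • ν i)) := by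
        rw [C_mul_diagForm]
        congr 1
        funext j
        exact (comb_smul _ _ _).symm
      rw [hcomb]
      refine ⟨diagForm_isHomogeneous _, quadricRank_eq_four h2 (tablePair_ne i) fun j => ?_,
        fun x hx => evalAt_diagForm_comb M _ hx⟩
      rw [comb_smul, mul_eq_zero, hzero]
      simp [hc]
  refine ⟨fun q hq => ?_, hthrough, fun i j c h => ?_, fun q hq => ?_, ?_⟩
  · have := (hq.rank_eq_four h2 hM (by norm_num) (by norm_num)).1
    omega
  · rw [C_mul_diagForm] at h
    have h := diagForm_injective h
    have hc : c ≠ 0 := by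
      rintro rfl
      obtain ⟨l, hl1, hl2⟩ := exists_third (tablePair i).1 (tablePair i).2
      have := congrFun h l
      rw [zero_mul, hzero] at this
      exact this.elim hl1 hl2
    refine tablePair_injective i j fun l => ?_
    rw [← hzero, ← hzero, congrFun h l, mul_eq_zero]
    simp [hc]
  · obtain ⟨i, c, hc, rfl⟩ := (hthrough q).1 hq
    rw [rulingMaps_C_mul _ hc]
    obtain ⟨h1, ⟨E, E', hne, hE⟩, -⟩ := hspec i
    exact ⟨h1, by rw [hE, Set.ncard_pair hne]⟩
  · choose E E' hne hE using fun i => (hspec i).2.1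
    have hinv := fun i => (hspec i).2.2
    let Φ : Fin 15 × Bool → Setoid (zeroLocus k fun r => diagForm (M r)) :=
      fun a => bif a.2 then E a.1 else E' a.1
    have hΦ : ∀ a, Φ a ∈ fibrationClasses (rulingMaps (zeroLocus k fun r => diagForm (M r))
        (diagForm (comb M (ν a.1)))) := by
      rintro ⟨i, b⟩
      rw [hE]
      cases b
      · exact Or.inr rfl
      · exact Or.inl rfl
    have hinj : Function.Injective Φ := by
      rintro ⟨i, b⟩ ⟨j, d⟩ h
      -- the fibration determines the two variables that do not occur in the quadric
      have hij : i = j := by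
        refine tablePair_injective i j fun l => ?_
        rw [← hinv i _ (hΦ (i, b)) l, ← hinv j _ (hΦ (j, d)) l, h]
      subst hij
      cases b <;> cases d
      · rfl
      · exact (hne i h.symm).elim
      · exact (hne i h).elim
      · rfl
    have hrange : fibrationClasses {π | ∃ q : MvPolynomial (Fin 6) K,
        IsQuadricThrough (zeroLocus k fun r => diagForm (M r)) 4 q ∧
        π ∈ rulingMaps (zeroLocus k fun r => diagForm (M r)) q} = Set.range Φ := by
      apply Set.Subset.antisymm
      · rintro _ ⟨π, ⟨q, hq, hπ⟩, rfl⟩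
        obtain ⟨i, c, hc, rfl⟩ := (hthrough q).1 hq
        rw [rulingMaps_C_mul _ hc] at hπ
        have hmem : Setoid.ker π ∈ fibrationClasses (rulingMaps
          (zeroLocus k fun r => diagForm (M r)) (diagForm (comb M (ν i)))) := ⟨π, hπ, rfl⟩
        rw [hE] at hmem
        rcases hmem with h | h
        · exact ⟨(i, true), h.symm⟩
        · exact ⟨(i, false), h.symm⟩
      · rintro _ ⟨⟨i, b⟩, rfl⟩
        obtain ⟨π, hπ, hπΦ⟩ := hΦ (i, b)
        rw [← hπΦ]
        exact ⟨π, ⟨_, (hthrough _).2 ⟨i, 1, one_ne_zero, by rw [C_1, one_mul]⟩, hπ⟩,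
          rfl⟩
    rw [hrange, ← Set.image_univ, Set.ncard_image_of_injective _ hinj, Set.ncard_univ]
    simp

end KummerKlein

end

theorem mainTheorem9 {K k : Type*} [Field K] [Field k] [Algebra K k] [IsAlgClosed k]
    (h2 : (2 : K) ≠ 0) (t s : K)
    (hX : KummerKlein.IsSmoothSurface k (KummerKlein.kummerEqs t s)) :
    -- no quadric of rank three contains `X`
    (∀ q : MvPolynomial (Fin 6) K,
      ¬ KummerKlein.IsQuadricThrough (KummerKlein.kummerSurface k t s) 3 q) ∧
    -- the quadrics of rank four containing `X` are exactly those in the table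
    (∀ q : MvPolynomial (Fin 6) K,
      KummerKlein.IsQuadricThrough (KummerKlein.kummerSurface k t s) 4 q ↔
        ∃ (i : Fin 15) (c : K), c ≠ 0 ∧ q = MvPolynomial.C c * KummerKlein.quadricTable t s i) ∧
    -- the table lists fifteen different quadrics
    (∀ (i j : Fin 15) (c : K),
      KummerKlein.quadricTable t s i = MvPolynomial.C c * KummerKlein.quadricTable t s j →
        i = j) ∧
    -- each quadric of rank four containing `X` determines exactly two elliptic fibrations
    (∀ q : MvPolynomial (Fin 6) K,
      KummerKlein.IsQuadricThrough (KummerKlein.kummerSurface k t s) 4 q →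
        (∀ π ∈ KummerKlein.rulingMaps (KummerKlein.kummerSurface k t s) q,
          KummerKlein.IsEllipticFibration (KummerKlein.kummerEqs t s) π) ∧
        (KummerKlein.fibrationClasses
          (KummerKlein.rulingMaps (KummerKlein.kummerSurface k t s) q)).ncard = 2) ∧
    -- there are thirty elliptic fibrations in total
    (KummerKlein.fibrationClasses
      {π | ∃ q : MvPolynomial (Fin 6) K,
        KummerKlein.IsQuadricThrough (KummerKlein.kummerSurface k t s) 4 q ∧
        π ∈ KummerKlein.rulingMaps (KummerKlein.kummerSurface k t s) q}).ncard = 30 :=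
  KummerKlein.quadrics_and_fibrations h2 t s (KummerKlein.kummerEqs_eq t s) hX
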